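/- Let $L$ be the loop transfer function of a unity feedback system and $S=\frac{1}{1+L}$ its sensitivity function. Suppose that $L$ has infinitely many poles $p_1,p_2,\dots$ in the open right half plane $\{\Re s>0\}$, of orders $d_1,d_2,\dots\in\{1,2,\dots\}$, that the set of these poles has exactly one limit point $p^*\in\mathbb C$, and that $L$ is holomorphic at all other points of the open right half plane except possibly $p^*$. Suppose that the closed loop is stable, that is, $S$ is holomorphic in the open right half plane. Let $E\subset i\mathbb R$ be a set (for instance the poles and branch points of $L$ on the imaginary axis) with no limit point other than possibly $p^*$, such that $S$ is continuous on $\{\Re s\ge 0\}\setminus(E\cup\{p^*\})$, and such that $1+L(s)\neq0$ and $S(s)=\frac1{1+L(s)}$ at every $s$ with $\Re s\ge0$, $s\notin E\cup\{p^*\}\cup\{p_j\}$. Assume moreover: (a) at each $q\in E\cup\{p^*\}$ the function $S$ has subexponential growth and decay: there are radii $\varepsilon_n\downarrow0$ such that the arcs $\{|s-q|=\varepsilon_n,\ \Re s\ge0\}$ avoid $E$ and the zeros of $S$, and $\varepsilon_n\max_{|s-q|=\varepsilon_n,\,\Re s\ge0}\bigl|\log|S(s)|\bigr|\to0$; (b)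 the contribution of the large semicircle vanishes: for suitable continuous branches of $\log S$ along the semicircles $\gamma_R=\{|s|=R,\ \Re s\ge0\}$ one has $\int_{\gamma_R}\log S(s)\,ds\to0$ as $R\to\infty$ through the radii for which $\gamma_R$ does not meet $E\cup\{p^*\}\cup\{p_j\}$; (c) $\omega\mapsto\log|S(i\omega)|^2$ is locally integrable on $\mathbb R$. Then $p^*$ lies on the imaginary axis, and the Bode integral of $S$ is $$I(S)=\int_{-\infty}^{\infty}\log|S(i\omega)|^2\,d\omega=4\pi\sum_j d_j\,\Re(p_j),$$ where the integral is understood as $\lim_{R\to\infty}\int_{-R}^{R}$ and both sides may be $+\infty$. If $\log|S(i\omega)|^2$ is integrable on $\mathbb R$, then the series converges and the equality holds with the Lebesgue integral. -/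

import Mathlib

open Filter Topology MeasureTheory

namespace BodeIntegral

/-- The sequence `p` enumerates, without repetition, the poles in the open right half plane of the
loop transfer function `L`, the pole `p j` having order `d j`. At every other point of the open
right half plane, except possibly `pstar`, the function `L` is holomorphic. -/
structure IsPoleEnumeration (L : ℂ → ℂ) (p : ℕ → ℂ) (d : ℕ → ℕ) (pstar : ℂ) : Prop where
  injective : Function.Injective p
  re_pos : ∀ j, 0 < (p j).re
  order_pos : ∀ j, 0 < d j
  order_eq : ∀ j, meromorphicOrderAt L (p j) = ((-(d j : ℤ) : ℤ) : WithTop ℤ)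
  analyticAt : ∀ s : ℂ, 0 < s.re → s ∉ Set.range p → s ≠ pstar → AnalyticAt ℂ L s

/-- `S` is the sensitivity function `1 / (1 + L)` of the unity feedback loop with loop transfer
function `L`, on the closed right half plane away from the poles `p j`, from the set `E` of singular
points of the loop on the imaginary axis, and from the point `pstar`; and the closed loop is
stable: `S` is holomorphic in the whole open right half plane. -/
structure IsStableSensitivity (L S : ℂ → ℂ) (p : ℕ → ℂ) (E : Set ℂ) (pstar : ℂ) : Prop where
  eq_inv : ∀ s : ℂ, 0 ≤ s.re → s ∉ Set.range p → s ∉ E → s ≠ pstar →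
    1 + L s ≠ 0 ∧ S s = 1 / (1 + L s)
  differentiableOn : DifferentiableOn ℂ S {s : ℂ | 0 < s.re}
  continuousOn : ContinuousOn S {s : ℂ | 0 ≤ s.re ∧ s ∉ E ∧ s ≠ pstar}

/-- `log |S(s)| = o(1 / |s - q|)` along a sequence of semicircles around `q` in the closed right
half plane that shrink to `q` and avoid the zeros of `S` and the points of `E`. -/
def HasSubexponentialGrowthAt (S : ℂ → ℂ) (E : Set ℂ) (q : ℂ) : Prop :=
  ∀ η : ℝ, 0 < η → ∃ᶠ ε : ℝ in 𝓝[>] 0, ∀ s : ℂ, 0 ≤ s.re → ‖s - q‖ = ε →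
    s ∉ E ∧ S s ≠ 0 ∧ ε * |Real.log ‖S s‖| ≤ η

/-- The radii `R` for which the circle `|s| = R` meets neither a pole `p j`, nor `E`, nor
`pstar`. -/
def admissibleRadii (p : ℕ → ℂ) (E : Set ℂ) (pstar : ℂ) : Set ℝ :=
  {R : ℝ | 0 < R ∧ ∀ s : ℂ, ‖s‖ = R → s ∉ Set.range p ∧ s ∉ E ∧ s ≠ pstar}

/-- `∫ log S(s) ds` over the semicircle `|s| = R`, `Re s ≥ 0`, tends to `0` as `R → ∞` through
the set `A`, where `log S` is a continuous branch of the logarithm of `S` along the semicircle. -/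
def LargeArcIntegralVanishes (S : ℂ → ℂ) (A : Set ℝ) : Prop :=
  ∃ logS : ℝ → ℝ → ℂ,
    (∀ R ∈ A, ContinuousOn (logS R) (Set.Icc (-(Real.pi / 2)) (Real.pi / 2)) ∧
      ∀ θ ∈ Set.Icc (-(Real.pi / 2)) (Real.pi / 2),
        Complex.exp (logS R θ) = S (R * Complex.exp (θ * Complex.I))) ∧
    Tendsto
      (fun R : ℝ => ∫ θ in (-(Real.pi / 2))..(Real.pi / 2),
        logS R θ * (R * Complex.exp (θ * Complex.I) * Complex.I))
      (atTop ⊓ 𝓟 A) (𝓝 0)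

/-- The integrand `log |S(iω)|²` of the Bode integral of `S`. -/
noncomputable def bodeIntegrand (S : ℂ → ℂ) (ω : ℝ) : ℝ :=
  Real.log (‖S (ω * Complex.I)‖ ^ 2)

end BodeIntegral

/-!
The zeros of `S` in the half plane `Re s > 0` are the poles of `L`, which accumulate at `pstar`, and
near `pstar` and the points of `E` the function `S` is controlled on small arcs only. The proof is
Carleman's formula, which on the half disc `|s - c| < r` of the half plane `Re s > Re c` reads

  `∫ log |S(c + iω)| dω = Re ∫ log S · r e^{iθ} dθ + 2π ∑ d j Re (p j - c)`

(`integral_axis_halfDisc`), and on a half annulus `ε < |s - c| < r` has the same shape with the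
weight `1 - ε² / ω²` and an additional arc integral of size at most `ε max log |S|`
(`integral_axis_halfAnnulus`). Both follow from Cauchy's theorem for a zero free function after
dividing by the Blaschke factors of the half plane, which have modulus `1` on its boundary and whose
arc integrals are computed by Fourier series. The weight of the half annulus is chosen such that
only `log |S|`, and not the argument of `S`, enters on the inner arc.

Carleman's formula is applied to half planes `Re s > δ` inside the domain of holomorphy, and then
`δ → 0`. Nothing is lost at a point of `E` other than `pstar`: near it `S` has no zeros, and by
subexponential growth both the integral over the axis and the limit of the shifted integrals are
equal to the same arc integral (`integral_axis_eq_of_subexponential`,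
`IsSensitivity.axisConvergence_near_singular`). At `pstar` the zeros accumulate. There the formula
on half annuli around `pstar`, with `ε → 0` along the good radii, shows both that `∑ d j Re p j`
over the zeros near `pstar` converges and that Carleman's formula holds on a half disc around
`pstar` for `S` on the axis itself (`IsSensitivity.hasSum_zeroWeight`). Dominated convergence for
the sum over the zeros turns this into the convergence of the shifted integrals near `pstar`, hence
on all of `[-R, R]`, and Carleman's formula follows on every half disc with a regular boundary
circle (`IsSensitivity.integral_axis_eq`).

For admissible `R → ∞` the arc integral vanishes by assumption and the sums over `|p j| < R`
increase to the full sum, in `[0, ∞]`. All but countably many radii are admissible and the integral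
over `[-R, R]` is continuous in `R`, so that the limit exists along all `R`. Finally `pstar` lies on
the imaginary axis because otherwise the zeros of `S` would accumulate inside its domain of
holomorphy.
-/

namespace BodeIntegral
open Complex Set
open scoped Real ComplexConjugate

/-! ### Continuous logarithms -/

/-- A nowhere vanishing continuous function on a closed rectangle has a continuous logarithm. -/
theorem exists_continuous_log_rect {a b c d : ℝ} (hab : a ≤ b) (hcd : c ≤ d) {G : ℂ → ℂ}
    (hG : ContinuousOn G (Icc a b ×ℂ Icc c d)) (hG0 : ∀ z ∈ Icc a b ×ℂ Icc c d, G z ≠ 0) :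
    ∃ F : ℂ → ℂ, Continuous F ∧ ∀ z ∈ Icc a b ×ℂ Icc c d, exp (F z) = G z := by
  -- Precomposing with the retraction `κ` of the plane onto the rectangle gives a map of the plane.
  set κ : ℂ → ℂ := fun z => (projIcc a b hab z.re : ℝ) + (projIcc c d hcd z.im : ℝ) * I with hκ
  have hκc : Continuous κ := by
    have h1 : Continuous fun z : ℂ => (projIcc a b hab z.re : ℝ) :=
      continuous_subtype_val.comp (continuous_projIcc.comp continuous_re)
    have h2 : Continuous fun z : ℂ => (projIcc c d hcd z.im : ℝ) :=
      continuous_subtype_val.comp (continuous_projIcc.comp continuous_im)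
    exact (continuous_ofReal.comp h1).add ((continuous_ofReal.comp h2).mul continuous_const)
  have hκm : ∀ z, κ z ∈ Icc a b ×ℂ Icc c d := by
    intro z
    rw [mem_reProdIm]
    constructor
    · have : (κ z).re = (projIcc a b hab z.re : ℝ) := by simp [hκ]
      rw [this]; exact (projIcc a b hab z.re).2
    · have : (κ z).im = (projIcc c d hcd z.im : ℝ) := by simp [hκ]
      rw [this]; exact (projIcc c d hcd z.im).2
  have hκid : ∀ z ∈ Icc a b ×ℂ Icc c d, κ z = z := by
    intro z hz
    rw [mem_reProdIm] at hz
    simp only [hκ, projIcc_of_mem hab hz.1, projIcc_of_mem hcd hz.2, re_add_im]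
  have hcont : Continuous fun z => G (κ z) := hG.comp_continuous hκc hκm
  obtain ⟨F, ⟨-, hF⟩, -⟩ := isCoveringMapOn_exp.existsUnique_continuousMap_lifts
    ⟨fun z => G (κ z), hcont⟩ (a₀ := 0) (e₀ := log (G (κ 0)))
    (by simpa using exp_log (hG0 _ (hκm 0))) (fun z => hG0 _ (hκm z))
  refine ⟨F, F.continuous, fun z hz => ?_⟩
  have := congrFun hF z
  simpa [hκid z hz] using this

theorem exists_continuousOn_log_Icc {a b : ℝ} (hab : a ≤ b) {φ : ℝ → ℂ}
    (hφ : ContinuousOn φ (Icc a b)) (hφ0 : ∀ t ∈ Icc a b, φ t ≠ 0) :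
    ∃ ℓ : ℝ → ℂ, ContinuousOn ℓ (Icc a b) ∧ ∀ t ∈ Icc a b, exp (ℓ t) = φ t := by
  obtain ⟨F, hF, hFe⟩ := exists_continuous_log_rect (le_refl (0 : ℝ)) hab
    (G := fun z => φ z.im)
    (hφ.comp continuous_im.continuousOn fun z hz => hz.2) (fun z hz => hφ0 _ hz.2)
  refine ⟨fun t => F (t * I), (by fun_prop : Continuous fun t : ℝ => F (t * I)).continuousOn,
    fun t ht => ?_⟩
  rw [hFe _ (by simpa [mem_reProdIm] using ht)]
  simp

/-- A continuous logarithm of a holomorphic function is holomorphic. -/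
theorem differentiableAt_of_exp_eq {F G : ℂ → ℂ} {z : ℂ} (hF : ContinuousAt F z)
    (hG : DifferentiableAt ℂ G z) (h : ∀ᶠ w in 𝓝 z, exp (F w) = G w) :
    DifferentiableAt ℂ F z := by
  have hz : exp (F z) = G z := h.self_of_nhds
  have h0 : G z ≠ 0 := hz ▸ exp_ne_zero _
  -- Near `z`, the function `F` is `F z` plus the principal logarithm of `G / G z`.
  have him : ∀ᶠ w in 𝓝 z, |(F w - F z).im| < π := by
    have : Tendsto (fun w => |(F w - F z).im|) (𝓝 z) (𝓝 |(F z - F z).im|) :=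
      ((continuous_abs.comp continuous_im).continuousAt.tendsto.comp (hF.sub continuousAt_const))
    rw [sub_self, zero_im, abs_zero] at this
    exact this.eventually_lt_const Real.pi_pos
  have heq : F =ᶠ[𝓝 z] fun w => F z + log (G w / G z) := by
    filter_upwards [h, him] with w hw hi
    rw [← hw, ← hz, ← exp_sub, log_exp (by linarith [(abs_lt.1 hi).1]) (abs_lt.1 hi).2.le]
    ring
  refine DifferentiableAt.congr_of_eventuallyEq ?_ heq
  refine (differentiableAt_const _).add (DifferentiableAt.clog (hG.div_const _) ?_)
  rw [div_self h0]; exact one_mem_slitPlane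

/-- The modulus of a value determines the real part of its logarithm. -/
theorem re_eq_log_norm_of_exp_eq {z w : ℂ} (h : exp z = w) : z.re = Real.log ‖w‖ := by
  rw [← h, norm_exp, Real.log_exp]

/-! ### Cauchy's theorem on a half annulus -/

/-- The closed half annulus `ε ≤ |s| ≤ ρ`, `Re s ≥ 0`. -/
def halfAnnulus (ε ρ : ℝ) : Set ℂ := {s : ℂ | 0 ≤ s.re ∧ ε ≤ ‖s‖ ∧ ‖s‖ ≤ ρ}

theorem circleMap_zero_re (ρ θ : ℝ) : (circleMap 0 ρ θ).re = ρ * Real.cos θ := by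
  simp [circleMap, exp_ofReal_mul_I_re]

theorem circleMap_zero_re_nonneg {ρ θ : ℝ} (hρ : 0 ≤ ρ) (hθ : θ ∈ Icc (-(π / 2)) (π / 2)) :
    0 ≤ (circleMap 0 ρ θ).re := by
  rw [circleMap_zero_re]
  exact mul_nonneg hρ (Real.cos_nonneg_of_mem_Icc hθ)

theorem norm_circleMap_zero_of_nonneg {ρ : ℝ} (hρ : 0 ≤ ρ) (θ : ℝ) : ‖circleMap 0 ρ θ‖ = ρ := by
  rw [norm_circleMap_zero, abs_of_nonneg hρ]

theorem exp_add_mul_I_mem_halfAnnulus {ε ρ : ℝ} (hε : 0 < ε) {z : ℂ}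
    (hz : z ∈ Icc (Real.log ε) (Real.log ρ) ×ℂ Icc (-(π / 2)) (π / 2)) (hρ : 0 < ρ) :
    exp z ∈ halfAnnulus ε ρ := by
  rw [mem_reProdIm] at hz
  refine ⟨?_, ?_, ?_⟩
  · rw [exp_re]
    exact mul_nonneg (Real.exp_pos _).le (Real.cos_nonneg_of_mem_Icc hz.2)
  · rw [norm_exp, ← Real.log_le_iff_le_exp hε]; exact hz.1.1
  · rw [norm_exp, ← Real.le_log_iff_exp_le hρ]; exact hz.1.2

theorem exp_ofReal_add_pi_div_two (t : ℝ) : exp (t + ((π / 2 : ℝ) : ℂ) * I) = Real.exp t * I := by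
  rw [exp_add]; push_cast; rw [exp_pi_div_two_mul_I]

theorem exp_ofReal_add_neg_pi_div_two (t : ℝ) :
    exp (t + ((-(π / 2) : ℝ) : ℂ) * I) = -(Real.exp t * I) := by
  rw [exp_add]; push_cast
  rw [show -((π : ℂ) / 2) * I = -(π / 2 * I) by ring, exp_neg, exp_pi_div_two_mul_I]
  simp

theorem exp_log_add_mul_I {ρ : ℝ} (hρ : 0 < ρ) (θ : ℝ) :
    exp (Real.log ρ + θ * I) = circleMap 0 ρ θ := by
  rw [exp_add, ← ofReal_exp, Real.exp_log hρ]; simp [circleMap]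

theorem mul_I_mem_halfAnnulus {ε ρ ω : ℝ} (hε : 0 < ε) (hω : ω ∈ Icc ε ρ) :
    (ω * I : ℂ) ∈ halfAnnulus ε ρ ∧ -(ω * I : ℂ) ∈ halfAnnulus ε ρ := by
  have : ‖(ω * I : ℂ)‖ = ω := by simp [abs_of_nonneg (hε.le.trans hω.1)]
  refine ⟨⟨by simp, ?_, ?_⟩, ⟨by simp, ?_, ?_⟩⟩ <;> simp only [norm_neg, this] <;>
    first | exact hω.1 | exact hω.2

theorem _root_.ContinuousOn.comp_mul_I {ε ρ : ℝ} {f : ℂ → ℂ}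
    (hf : ContinuousOn f (halfAnnulus ε ρ)) (hε : 0 < ε) :
    ContinuousOn (fun ω : ℝ => f (ω * I)) (Icc ε ρ) :=
  hf.comp (by fun_prop : Continuous fun ω : ℝ => (ω * I : ℂ)).continuousOn
    fun _ hω => (mul_I_mem_halfAnnulus hε hω).1

theorem _root_.ContinuousOn.comp_neg_mul_I {ε ρ : ℝ} {f : ℂ → ℂ}
    (hf : ContinuousOn f (halfAnnulus ε ρ)) (hε : 0 < ε) :
    ContinuousOn (fun ω : ℝ => f (-(ω * I))) (Icc ε ρ) :=
  hf.comp (by fun_prop : Continuous fun ω : ℝ => -(ω * I : ℂ)).continuousOn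
    fun _ hω => (mul_I_mem_halfAnnulus hε hω).2

/-- Change of variables `ω = e^t`. -/
theorem integral_comp_exp_mul_exp {ε ρ : ℝ} (hε : 0 < ε) (hερ : ε ≤ ρ) (v : ℝ → ℝ)
    (hv : ContinuousOn v (Icc ε ρ)) :
    ∫ t in Real.log ε..Real.log ρ, v (Real.exp t) * Real.exp t = ∫ ω in ε..ρ, v ω := by
  have hl : Real.log ε ≤ Real.log ρ := Real.log_le_log hε hερ
  have key := intervalIntegral.integral_comp_mul_deriv'' (a := Real.log ε) (b := Real.log ρ)
    (f := Real.exp) (f' := Real.exp) (g := v) Real.continuous_exp.continuousOn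
    (fun x _ => (Real.hasDerivAt_exp x).hasDerivWithinAt) Real.continuous_exp.continuousOn ?_
  · rw [Real.exp_log hε, Real.exp_log (hε.trans_le hερ)] at key
    exact key
  · refine hv.mono ?_
    rintro _ ⟨t, ht, rfl⟩
    rw [uIcc_of_le hl] at ht
    exact ⟨(Real.log_le_iff_le_exp hε).1 ht.1, (Real.le_log_iff_exp_le (hε.trans_le hερ)).1 ht.2⟩

/-- Cauchy's theorem for `log g · h ds` on a half annulus, the weight `h ds` being imaginary on
the axis and on the inner arc. Only `log |g|` enters there, so that the argument of `g` matters on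
the outer arc alone, where any continuous branch `ℓ` of `log g` will do. -/
theorem integral_axis_eq_of_ne_zero {ε ρ : ℝ} (hε : 0 < ε) (hερ : ε < ρ) {g h : ℂ → ℂ}
    (hgc : ContinuousOn g (halfAnnulus ε ρ)) (hg0 : ∀ s ∈ halfAnnulus ε ρ, g s ≠ 0)
    (hgd : ∀ s : ℂ, 0 < s.re → ε < ‖s‖ → ‖s‖ < ρ → DifferentiableAt ℂ g s)
    (hhc : ContinuousOn h (halfAnnulus ε ρ))
    (hhd : ∀ s : ℂ, 0 < s.re → ε < ‖s‖ → ‖s‖ < ρ → DifferentiableAt ℂ h s)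
    (haxis : ∀ ω : ℝ, ε ≤ |ω| → |ω| ≤ ρ → (h (ω * I)).im = 0)
    (harc : ∀ s : ℂ, 0 ≤ s.re → ‖s‖ = ε → (s * h s).im = 0)
    {ℓ : ℝ → ℂ} (hℓ : ContinuousOn ℓ (Icc (-(π / 2)) (π / 2)))
    (hℓe : ∀ θ ∈ Icc (-(π / 2)) (π / 2), exp (ℓ θ) = g (circleMap 0 ρ θ)) :
    ∫ ω in ε..ρ, (Real.log ‖g (ω * I)‖ * (h (ω * I)).re +
        Real.log ‖g (-(ω * I))‖ * (h (-(ω * I))).re) =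
      (∫ θ in (-(π / 2))..(π / 2), (ℓ θ * (circleMap 0 ρ θ * h (circleMap 0 ρ θ))).re) -
        ∫ θ in (-(π / 2))..(π / 2),
          Real.log ‖g (circleMap 0 ε θ)‖ * (circleMap 0 ε θ * h (circleMap 0 ε θ)).re := by
  have hρ : 0 < ρ := hε.trans hερ
  have hpi : -(π / 2) ≤ π / 2 := by linarith [Real.pi_pos]
  have hlog : Real.log ε < Real.log ρ := Real.log_lt_log hε hερ
  set Q : Set ℂ := Icc (Real.log ε) (Real.log ρ) ×ℂ Icc (-(π / 2)) (π / 2) with hQ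
  have hQm : ∀ z ∈ Q, exp z ∈ halfAnnulus ε ρ :=
    fun z hz => exp_add_mul_I_mem_halfAnnulus hε hz hρ
  have hexpc : ContinuousOn exp Q := continuous_exp.continuousOn
  obtain ⟨F₀, hF₀, hF₀e⟩ := exists_continuous_log_rect hlog.le hpi
    (G := fun z => g (exp z)) (hgc.comp hexpc hQm) (fun z hz => hg0 _ (hQm z hz))
  have hQi : ∀ (t θ : ℝ), t ∈ Icc (Real.log ε) (Real.log ρ) → θ ∈ Icc (-(π / 2)) (π / 2) →
      (t + θ * I : ℂ) ∈ Q := by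
    intro t θ ht hθ
    rw [hQ, mem_reProdIm]; simpa using ⟨ht, hθ⟩
  -- Two branches on the outer arc differ by a constant, so `F₀` may be adjusted to extend `ℓ`.
  obtain ⟨F, hF, hFe, hFℓ⟩ : ∃ F : ℂ → ℂ, Continuous F ∧ (∀ z ∈ Q, exp (F z) = g (exp z)) ∧
      ∀ θ ∈ Icc (-(π / 2)) (π / 2), F (Real.log ρ + θ * I) = ℓ θ := by
    have h0 : (0 : ℝ) ∈ Icc (-(π / 2)) (π / 2) := ⟨by linarith [Real.pi_pos], by positivity⟩
    set D : ℝ → ℂ := fun θ => ℓ θ - F₀ (Real.log ρ + θ * I) with hD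
    have hDc : ContinuousOn D (Icc (-(π / 2)) (π / 2)) :=
      hℓ.sub (by fun_prop : Continuous fun θ : ℝ => F₀ (Real.log ρ + θ * I)).continuousOn
    have hDe : ∀ θ ∈ Icc (-(π / 2)) (π / 2), exp (D θ) = 1 := by
      intro θ hθ
      have h1 := hF₀e _ (hQi _ θ (right_mem_Icc.2 hlog.le) hθ)
      simp only [exp_log_add_mul_I hρ] at h1
      rw [hD]
      simp only
      rw [exp_sub, hℓe θ hθ, h1, div_self]
      rw [← h1]; exact exp_ne_zero _
    have hconst : ∀ θ ∈ Icc (-(π / 2)) (π / 2), D θ = D 0 := by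
      intro θ hθ
      have hpre : IsPreconnected (Icc (-(π / 2)) (π / 2)) := isPreconnected_Icc
      -- `D / (2πi)` takes values in the discrete set of integers.
      have hT : IsDiscrete (Set.range ((↑) : ℤ → ℝ)) :=
        isDiscrete_iff_discreteTopology.2
          Int.isClosedEmbedding_coe_real.isEmbedding.toHomeomorph.symm.isEmbedding.discreteTopology
      have hval : ∀ t ∈ Icc (-(π / 2)) (π / 2), ∃ n : ℤ, D t = n * (2 * π * I) :=
        fun t ht => exp_eq_one_iff.1 (hDe t ht)
      have hre : ∀ n : ℤ, ((n * (2 * π * I) : ℂ) / (2 * π * I)).re = n := by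
        intro n
        rw [mul_div_cancel_right₀ _ two_pi_I_ne_zero, intCast_re]
      have key : (D θ / (2 * π * I)).re = (D 0 / (2 * π * I)).re := by
        refine hpre.constant_of_mapsTo hT (f := fun t => (D t / (2 * π * I)).re)
          (continuous_re.comp_continuousOn (hDc.div_const _)) ?_ hθ h0
        intro t ht
        obtain ⟨n, hn⟩ := hval t ht
        exact ⟨n, by simp only [hn, hre]⟩
      obtain ⟨n, hn⟩ := hval θ hθ
      obtain ⟨m, hm⟩ := hval 0 h0
      rw [hn, hm, hre, hre] at key
      rw [hn, hm, show n = m by exact_mod_cast key]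
    refine ⟨fun z => F₀ z + D 0, hF₀.add continuous_const, fun z hz => ?_, fun θ hθ => ?_⟩
    · rw [exp_add, hF₀e z hz, hDe 0 h0, mul_one]
    · rw [← hconst θ hθ, hD]; ring
  have hFre : ∀ z ∈ Q, (F z).re = Real.log ‖g (exp z)‖ :=
    fun z hz => re_eq_log_norm_of_exp_eq (hFe z hz)
  set Φ : ℂ → ℂ := fun z => F z * (exp z * h (exp z)) with hΦ
  have hΦc : ContinuousOn Φ Q := hF.continuousOn.mul (hexpc.mul (hhc.comp hexpc hQm))
  have hint := integral_boundary_rect_eq_zero_of_continuousOn_of_differentiableOn Φ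
    (⟨Real.log ε, -(π / 2)⟩ : ℂ) (⟨Real.log ρ, π / 2⟩ : ℂ)
    (by simpa only [uIcc_of_le hlog.le, uIcc_of_le hpi] using hΦc) ?_
  swap
  · simp only [min_eq_left hlog.le, max_eq_right hlog.le, min_eq_left hpi, max_eq_right hpi]
    intro z hz
    rw [mem_reProdIm] at hz
    have hs1 : 0 < (exp z).re := by
      rw [exp_re]; exact mul_pos (Real.exp_pos _) (Real.cos_pos_of_mem_Ioo hz.2)
    have hs2 : ε < ‖exp z‖ := by rw [norm_exp]; exact (Real.log_lt_iff_lt_exp hε).1 hz.1.1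
    have hs3 : ‖exp z‖ < ρ := by rw [norm_exp]; exact (Real.lt_log_iff_exp_lt hρ).1 hz.1.2
    have hQn : Q ∈ 𝓝 z := by
      refine mem_of_superset ((isOpen_Ioo.reProdIm isOpen_Ioo).mem_nhds
        (mem_reProdIm.2 hz)) ?_
      intro w hw
      exact ⟨Ioo_subset_Icc_self hw.1, Ioo_subset_Icc_self hw.2⟩
    have hFd : DifferentiableAt ℂ F z :=
      differentiableAt_of_exp_eq hF.continuousAt (G := fun w => g (exp w))
        ((hgd _ hs1 hs2 hs3).comp z differentiableAt_exp)
        (by filter_upwards [hQn] with w hw using hFe w hw)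
    exact (hFd.mul (differentiableAt_exp.mul
      ((hhd _ hs1 hs2 hs3).comp z differentiableAt_exp))).differentiableWithinAt
  have hI1 : ∀ θ ∈ Icc (-(π / 2)) (π / 2), IntervalIntegrable (fun t : ℝ => Φ (t + θ * I))
      volume (Real.log ε) (Real.log ρ) := fun θ hθ =>
    ContinuousOn.intervalIntegrable_of_Icc hlog.le
      (hΦc.comp (by fun_prop : Continuous fun t : ℝ => (t + θ * I : ℂ)).continuousOn
        fun t ht => hQi t θ ht hθ)
  have hI2 : ∀ t ∈ Icc (Real.log ε) (Real.log ρ), IntervalIntegrable (fun θ : ℝ => Φ (t + θ * I))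
      volume (-(π / 2)) (π / 2) := fun t ht =>
    ContinuousOn.intervalIntegrable_of_Icc hpi
      (hΦc.comp (by fun_prop : Continuous fun θ : ℝ => (t + θ * I : ℂ)).continuousOn
        fun θ hθ => hQi t θ ht hθ)
  have hpl := right_mem_Icc.2 hpi
  have hmi := left_mem_Icc.2 hpi
  have hel := left_mem_Icc.2 hlog.le
  have hrl := right_mem_Icc.2 hlog.le
  have hIm := congrArg Complex.im hint
  simp only [sub_im, add_im, smul_eq_mul, I_mul_im, zero_im] at hIm
  rw [← imCLM_apply, ← imCLM_apply (∫ x in Real.log ε..Real.log ρ, Φ (x + _ * I)),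
    ← reCLM_apply, ← reCLM_apply,
    ← imCLM.intervalIntegral_comp_comm (hI1 _ hmi), ← imCLM.intervalIntegral_comp_comm (hI1 _ hpl),
    ← reCLM.intervalIntegral_comp_comm (hI2 _ hrl), ← reCLM.intervalIntegral_comp_comm (hI2 _ hel),
    ← intervalIntegral.integral_sub] at hIm
  rotate_left
  · exact ⟨imCLM.integrable_comp (hI1 _ hmi).1, imCLM.integrable_comp (hI1 _ hmi).2⟩
  · exact ⟨imCLM.integrable_comp (hI1 _ hpl).1, imCLM.integrable_comp (hI1 _ hpl).2⟩
  simp only [imCLM_apply, reCLM_apply] at hIm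
  have hA : ∫ t in Real.log ε..Real.log ρ, ((Φ (t + ((-(π / 2) : ℝ) : ℂ) * I)).im -
      (Φ (t + ((π / 2 : ℝ) : ℂ) * I)).im) = -∫ ω in ε..ρ, (Real.log ‖g (ω * I)‖ * (h (ω * I)).re +
        Real.log ‖g (-(ω * I))‖ * (h (-(ω * I))).re) := by
    rw [← integral_comp_exp_mul_exp hε hερ.le, ← intervalIntegral.integral_neg]
    · refine intervalIntegral.integral_congr fun t ht => ?_
      rw [uIcc_of_le hlog.le] at ht
      have e1 : ε ≤ Real.exp t := (Real.log_le_iff_le_exp hε).1 ht.1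
      have e2 : Real.exp t ≤ ρ := (Real.le_log_iff_exp_le hρ).1 ht.2
      have r1 := hFre _ (hQi t _ ht hpl)
      have r2 := hFre _ (hQi t _ ht hmi)
      have i1 := haxis (Real.exp t) (by rwa [Real.abs_exp]) (by rwa [Real.abs_exp])
      have i2 := haxis (-Real.exp t) (by rwa [abs_neg, Real.abs_exp])
        (by rwa [abs_neg, Real.abs_exp])
      rw [show (((-Real.exp t : ℝ) : ℂ) * I) = -((Real.exp t : ℝ) * I) by push_cast; ring] at i2
      simp only [hΦ]
      rw [exp_ofReal_add_pi_div_two] at r1 ⊢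
      rw [exp_ofReal_add_neg_pi_div_two] at r2 ⊢
      simp only [mul_im, mul_re, neg_im, neg_re, I_re, I_im, ofReal_re, ofReal_im, i1, i2, r1, r2]
      ring
    · refine ContinuousOn.add (ContinuousOn.mul ?_ ?_) (ContinuousOn.mul ?_ ?_)
      · exact (hgc.comp_mul_I hε).norm.log fun ω hω =>
          norm_ne_zero_iff.2 (hg0 _ (mul_I_mem_halfAnnulus hε hω).1)
      · exact continuous_re.comp_continuousOn (hhc.comp_mul_I hε)
      · exact (hgc.comp_neg_mul_I hε).norm.log fun ω hω =>
          norm_ne_zero_iff.2 (hg0 _ (mul_I_mem_halfAnnulus hε hω).2)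
      · exact continuous_re.comp_continuousOn (hhc.comp_neg_mul_I hε)
  have hB : ∫ θ in (-(π / 2))..(π / 2), (Φ (Real.log ρ + θ * I)).re =
      ∫ θ in (-(π / 2))..(π / 2), (ℓ θ * (circleMap 0 ρ θ * h (circleMap 0 ρ θ))).re := by
    refine intervalIntegral.integral_congr fun θ hθ => ?_
    rw [uIcc_of_le hpi] at hθ
    simp only [hΦ, exp_log_add_mul_I hρ, hFℓ θ hθ]
  have hC : ∫ θ in (-(π / 2))..(π / 2), (Φ (Real.log ε + θ * I)).re =
      ∫ θ in (-(π / 2))..(π / 2),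
          Real.log ‖g (circleMap 0 ε θ)‖ * (circleMap 0 ε θ * h (circleMap 0 ε θ)).re := by
    refine intervalIntegral.integral_congr fun θ hθ => ?_
    rw [uIcc_of_le hpi] at hθ
    have r := hFre _ (hQi _ θ hel hθ)
    have i := harc (circleMap 0 ε θ) (circleMap_zero_re_nonneg hε.le hθ)
      (norm_circleMap_zero_of_nonneg hε.le θ)
    simp only [hΦ]
    rw [exp_log_add_mul_I hε] at r ⊢
    rw [mul_re (F _), i, r]; ring
  rw [hA, hB, hC] at hIm
  linarith

/-! ### Shrinking the inner arc -/

theorem intervalIntegrable_of_neg {f : ℝ → ℝ} {r : ℝ} (hr : 0 ≤ r)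
    (hf : IntervalIntegrable f volume (-r) r) :
    IntervalIntegrable f volume (-r) 0 ∧ IntervalIntegrable f volume 0 r ∧
      IntervalIntegrable (fun ω => f (-ω)) volume 0 r := by
  have h1 : IntervalIntegrable f volume (-r) 0 := hf.mono_set (by
    rw [uIcc_of_le (by linarith), uIcc_of_le (by linarith)]; exact Icc_subset_Icc_right hr)
  have h2 : IntervalIntegrable f volume 0 r := hf.mono_set (by
    rw [uIcc_of_le (by linarith), uIcc_of_le (by linarith)]; exact Icc_subset_Icc_left (by linarith))
  exact ⟨h1, h2, by simpa using ((IntervalIntegrable.iff_comp_neg (by simp)).1 h1).symm⟩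

theorem integral_fold {f : ℝ → ℝ} {r : ℝ} (hr : 0 ≤ r)
    (hf : IntervalIntegrable f volume (-r) r) :
    ∫ ω in (-r)..r, f ω = ∫ ω in (0 : ℝ)..r, (f ω + f (-ω)) := by
  obtain ⟨h1, h2, h3⟩ := intervalIntegrable_of_neg hr hf
  rw [intervalIntegral.integral_add h2 h3, intervalIntegral.integral_comp_neg, neg_zero,
    ← intervalIntegral.integral_add_adjacent_intervals h1 h2, add_comm]

/-- Dominated convergence for the weighted integrals along the two halves of the axis. -/
theorem tendsto_integral_axis {r C : ℝ} (hr : 0 < r) {v₁ v₂ K₁ K₂ : ℝ → ℝ} {H₁ H₂ : ℝ → ℝ → ℝ}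
    (hv₁ : IntervalIntegrable v₁ volume 0 r) (hv₂ : IntervalIntegrable v₂ volume 0 r)
    (hH₁ : ∀ ε ∈ Ioo 0 r, ContinuousOn (H₁ ε) (Icc ε r))
    (hH₂ : ∀ ε ∈ Ioo 0 r, ContinuousOn (H₂ ε) (Icc ε r))
    (hC₁ : ∀ ε ∈ Ioo 0 r, ∀ ω ∈ Icc ε r, |H₁ ε ω| ≤ C)
    (hC₂ : ∀ ε ∈ Ioo 0 r, ∀ ω ∈ Icc ε r, |H₂ ε ω| ≤ C)
    (hl₁ : ∀ ω ∈ Ioc 0 r, Tendsto (fun ε => H₁ ε ω) (𝓝[>] 0) (𝓝 (K₁ ω)))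
    (hl₂ : ∀ ω ∈ Ioc 0 r, Tendsto (fun ε => H₂ ε ω) (𝓝[>] 0) (𝓝 (K₂ ω))) :
    Tendsto (fun ε => ∫ ω in ε..r, (v₁ ω * H₁ ε ω + v₂ ω * H₂ ε ω)) (𝓝[>] 0)
      (𝓝 (∫ ω in (0 : ℝ)..r, (v₁ ω * K₁ ω + v₂ ω * K₂ ω))) := by
  have hC : 0 ≤ C := by
    have h2 : r / 2 ∈ Ioo 0 r := ⟨by linarith, by linarith⟩
    exact (abs_nonneg _).trans (hC₁ (r / 2) h2 r ⟨by linarith, le_refl r⟩)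
  have hev : ∀ᶠ ε in 𝓝[>] (0 : ℝ), ε ∈ Ioo 0 r := Ioo_mem_nhdsGT hr
  have heq : ∀ᶠ ε in 𝓝[>] (0 : ℝ),
      ∫ ω in (0 : ℝ)..r, (Ioc ε r).indicator (fun ω => v₁ ω * H₁ ε ω + v₂ ω * H₂ ε ω) ω =
      ∫ ω in ε..r, (v₁ ω * H₁ ε ω + v₂ ω * H₂ ε ω) := by
    filter_upwards [hev] with ε hε
    rw [intervalIntegral.integral_of_le hr.le, intervalIntegral.integral_of_le hε.2.le,
      setIntegral_indicator measurableSet_Ioc,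
      inter_eq_right.2 (Ioc_subset_Ioc_left hε.1.le)]
  refine Tendsto.congr' heq ?_
  refine intervalIntegral.tendsto_integral_filter_of_dominated_convergence
    (fun ω => C * (|v₁ ω| + |v₂ ω|)) ?_ ?_ ((hv₁.abs.add hv₂.abs).const_mul C) ?_
  · filter_upwards [hev] with ε hε
    rw [uIoc_of_le hr.le, aestronglyMeasurable_indicator_iff measurableSet_Ioc,
      Measure.restrict_restrict measurableSet_Ioc, inter_eq_left.2 (Ioc_subset_Ioc_left hε.1.le)]
    have m : ∀ {v : ℝ → ℝ}, IntervalIntegrable v volume 0 r →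
        AEStronglyMeasurable v (volume.restrict (Ioc ε r)) := fun h =>
      (h.1.aestronglyMeasurable).mono_set (Ioc_subset_Ioc_left hε.1.le)
    have n : ∀ {H : ℝ → ℝ}, ContinuousOn H (Icc ε r) →
        AEStronglyMeasurable H (volume.restrict (Ioc ε r)) := fun h =>
      (h.mono Ioc_subset_Icc_self).aestronglyMeasurable measurableSet_Ioc
    exact ((m hv₁).mul (n (hH₁ ε hε))).add ((m hv₂).mul (n (hH₂ ε hε)))
  · filter_upwards [hev] with ε hε
    refine Eventually.of_forall fun ω hω => ?_
    by_cases h : ω ∈ Ioc ε r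
    · rw [indicator_of_mem h, Real.norm_eq_abs]
      have h' : ω ∈ Icc ε r := Ioc_subset_Icc_self h
      calc |v₁ ω * H₁ ε ω + v₂ ω * H₂ ε ω| ≤ |v₁ ω * H₁ ε ω| + |v₂ ω * H₂ ε ω| := abs_add_le _ _
        _ = |v₁ ω| * |H₁ ε ω| + |v₂ ω| * |H₂ ε ω| := by rw [abs_mul, abs_mul]
        _ ≤ |v₁ ω| * C + |v₂ ω| * C := by
            gcongr
            · exact hC₁ ε hε ω h'
            · exact hC₂ ε hε ω h'
        _ = _ := by ring
    · rw [indicator_of_notMem h, norm_zero]; positivity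
  · refine Eventually.of_forall fun ω hω => ?_
    rw [uIoc_of_le hr.le] at hω
    have : Tendsto (fun ε => v₁ ω * H₁ ε ω + v₂ ω * H₂ ε ω) (𝓝[>] 0)
        (𝓝 (v₁ ω * K₁ ω + v₂ ω * K₂ ω)) :=
      ((hl₁ ω hω).const_mul _).add ((hl₂ ω hω).const_mul _)
    refine this.congr' ?_
    filter_upwards [Ioo_mem_nhdsGT hω.1] with ε hε
    rw [indicator_of_mem (show ω ∈ Ioc ε r from ⟨hε.2, hω.2⟩)]

/-- Carleman's modification of a weight `k`: if `k` is real on the imaginary axis, then so is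
`carlemanWeight k ε`, and moreover `carlemanWeight k ε s ds` is imaginary along `|s| = ε`.
For `k = 1` this is `1 + ε² / s²`. -/
noncomputable def carlemanWeight (k : ℂ → ℂ) (ε : ℝ) (s : ℂ) : ℂ :=
  k s + (ε ^ 2 / s ^ 2) * conj (k (conj (ε ^ 2 / s)))

theorem carlemanWeight_axis_im {k : ℂ → ℂ} {r' : ℝ}
    (hk : ∀ ω : ℝ, |ω| < r' → (k (ω * I)).im = 0) {ε ω : ℝ} (hε : 0 < ε) (hω : ε ≤ |ω|)
    (hω' : |ω| < r') : (carlemanWeight k ε (ω * I)).im = 0 := by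
  have hω0 : ω ≠ 0 := by rintro rfl; rw [abs_zero] at hω; linarith
  have h1 : conj ((ε : ℂ) ^ 2 / (ω * I)) = ((ε ^ 2 / ω : ℝ) : ℂ) * I := by
    have : (ω : ℂ) ≠ 0 := by exact_mod_cast hω0
    simp only [map_div₀, map_pow, map_mul, conj_ofReal, conj_I]
    push_cast
    field_simp
    rw [I_sq]; ring
  have h2 : (ε : ℂ) ^ 2 / (ω * I) ^ 2 = ((-(ε ^ 2 / ω ^ 2) : ℝ) : ℂ) := by
    rw [mul_pow, I_sq]; push_cast; ring
  have h3 : |ε ^ 2 / ω| < r' := by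
    rw [abs_div, abs_of_pos (by positivity : 0 < ε ^ 2)]
    refine lt_of_le_of_lt ?_ hω'
    rw [div_le_iff₀ (by positivity)]
    nlinarith [abs_nonneg ω]
  rw [carlemanWeight, h1, h2, add_im, im_ofReal_mul, conj_im, hk ω hω', hk _ h3]
  simp

theorem carlemanWeight_arc_im (k : ℂ → ℂ) {ε : ℝ} (hε : 0 < ε) {s : ℂ} (hs : ‖s‖ = ε) :
    (s * carlemanWeight k ε s).im = 0 := by
  have hs0 : s ≠ 0 := by rintro rfl; rw [norm_zero] at hs; linarith
  have h1 : (ε : ℂ) ^ 2 / s = conj s := by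
    rw [div_eq_iff hs0, mul_comm, mul_conj, normSq_eq_norm_sq, hs]; push_cast; ring
  have h2 : s * carlemanWeight k ε s = s * k s + conj (s * k s) := by
    rw [carlemanWeight, h1, conj_conj, map_mul, ← h1]; field_simp
  rw [h2, add_im, conj_im]; ring

theorem norm_carlemanWeight_sub_le {k : ℂ → ℂ} {r M : ℝ} (hM : ∀ s : ℂ, ‖s‖ ≤ r → ‖k s‖ ≤ M)
    {ε : ℝ} (hε : 0 < ε) {s : ℂ} (hs : ε ≤ ‖s‖) (hr : ‖s‖ ≤ r) :
    ‖carlemanWeight k ε s - k s‖ ≤ ε ^ 2 / ‖s‖ ^ 2 * M := by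
  have hs0 : 0 < ‖s‖ := hε.trans_le hs
  rw [carlemanWeight, add_sub_cancel_left, norm_mul, RCLike.norm_conj, norm_div, norm_pow, norm_pow,
    norm_real, Real.norm_eq_abs, abs_of_pos hε]
  gcongr
  refine hM _ ?_
  rw [RCLike.norm_conj, norm_div, norm_pow, norm_real, Real.norm_eq_abs, abs_of_pos hε,
    div_le_iff₀ hs0]
  nlinarith

theorem norm_carlemanWeight_le {k : ℂ → ℂ} {r M : ℝ} (hM : ∀ s : ℂ, ‖s‖ ≤ r → ‖k s‖ ≤ M)
    {ε : ℝ} (hε : 0 < ε) {s : ℂ} (hs : ε ≤ ‖s‖) (hr : ‖s‖ ≤ r) :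
    ‖carlemanWeight k ε s‖ ≤ 2 * M := by
  have hs0 : 0 < ‖s‖ := hε.trans_le hs
  have hM0 : 0 ≤ M := (norm_nonneg _).trans (hM s hr)
  have h1 := norm_carlemanWeight_sub_le hM hε hs hr
  have h2 : ε ^ 2 / ‖s‖ ^ 2 * M ≤ 1 * M := by
    gcongr
    rw [div_le_one (by positivity)]; gcongr
  have h3 : ‖carlemanWeight k ε s‖ ≤ ‖carlemanWeight k ε s - k s‖ + ‖k s‖ := by
    simpa using norm_add_le (carlemanWeight k ε s - k s) (k s)
  linarith [hM s hr]

theorem tendsto_carlemanWeight {k : ℂ → ℂ} {r M : ℝ} (hM : ∀ s : ℂ, ‖s‖ ≤ r → ‖k s‖ ≤ M)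
    {s : ℂ} (hs : s ≠ 0) (hr : ‖s‖ ≤ r) :
    Tendsto (fun ε => carlemanWeight k ε s) (𝓝[>] 0) (𝓝 (k s)) := by
  rw [tendsto_iff_norm_sub_tendsto_zero]
  have hs0 : 0 < ‖s‖ := norm_pos_iff.2 hs
  have hlim : Tendsto (fun ε : ℝ => ε ^ 2 / ‖s‖ ^ 2 * M) (𝓝[>] 0) (𝓝 0) := by
    have : ContinuousAt (fun ε : ℝ => ε ^ 2 / ‖s‖ ^ 2 * M) 0 := by fun_prop
    have h := this.tendsto.mono_left (nhdsWithin_le_nhds (s := Ioi 0))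
    simpa using h
  refine squeeze_zero' (Eventually.of_forall fun _ => norm_nonneg _) ?_ hlim
  filter_upwards [Ioo_mem_nhdsGT hs0] with ε hε
  exact norm_carlemanWeight_sub_le hM hε.1 hε.2.le hr

theorem differentiableAt_carlemanWeight {k : ℂ → ℂ} {r' : ℝ}
    (hk : DifferentiableOn ℂ k (Metric.ball 0 r')) {ε : ℝ} (hε : 0 < ε) {s : ℂ} (hs : ε ≤ ‖s‖)
    (hr : ‖s‖ < r') : DifferentiableAt ℂ (carlemanWeight k ε) s := by
  have hs0 : 0 < ‖s‖ := hε.trans_le hs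
  have hsn : s ≠ 0 := norm_pos_iff.1 hs0
  have hka : ∀ w : ℂ, ‖w‖ < r' → DifferentiableAt ℂ k w := fun w hw =>
    hk.differentiableAt (Metric.isOpen_ball.mem_nhds (by simpa using hw))
  have hw : ‖conj ((ε : ℂ) ^ 2 / s)‖ < r' := by
    refine lt_of_le_of_lt ?_ hr
    rw [RCLike.norm_conj, norm_div, norm_pow, norm_real, Real.norm_eq_abs, abs_of_pos hε,
      div_le_iff₀ hs0]
    nlinarith
  have h1 : DifferentiableAt ℂ (conj ∘ k ∘ conj) ((ε : ℂ) ^ 2 / s) :=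
    differentiableAt_conj_conj_iff.2 (hka _ hw)
  have h2 : DifferentiableAt ℂ (fun w : ℂ => (ε : ℂ) ^ 2 / w) s :=
    (differentiableAt_const _).div differentiableAt_id hsn
  have h3 : DifferentiableAt ℂ (fun w : ℂ => (ε : ℂ) ^ 2 / w ^ 2) s :=
    (differentiableAt_const _).div (differentiableAt_id.pow 2) (pow_ne_zero 2 hsn)
  exact (hka s hr).add (h3.mul (h1.comp s h2))

/-- Cauchy's theorem on a half disc for a zero free holomorphic function `G` that may be singular at
the centre of the diameter, provided that it has subexponential growth and decay on small arcs
around it: the imaginary part of the contour integral of `log G · k ds` vanishes. -/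
theorem integral_axis_eq_of_subexponential {r r' : ℝ} (hr : 0 < r) (hr' : r < r') {G k : ℂ → ℂ}
    (hGc : ContinuousOn G {s | 0 ≤ s.re ∧ s ≠ 0 ∧ ‖s‖ ≤ r})
    (hG0 : ∀ s : ℂ, 0 ≤ s.re → s ≠ 0 → ‖s‖ ≤ r → G s ≠ 0)
    (hGd : ∀ s : ℂ, 0 < s.re → ‖s‖ < r → DifferentiableAt ℂ G s)
    (hk : DifferentiableOn ℂ k (Metric.ball 0 r'))
    (hkim : ∀ ω : ℝ, |ω| < r' → (k (ω * I)).im = 0)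
    (hu : IntervalIntegrable (fun ω : ℝ => Real.log ‖G (ω * I)‖) volume (-r) r)
    (hgrowth : ∀ η : ℝ, 0 < η → ∃ᶠ ε : ℝ in 𝓝[>] 0, ∀ s : ℂ, 0 ≤ s.re → ‖s‖ = ε →
      ε * |Real.log ‖G s‖| ≤ η)
    {ℓ : ℝ → ℂ} (hℓ : ContinuousOn ℓ (Icc (-(π / 2)) (π / 2)))
    (hℓe : ∀ θ ∈ Icc (-(π / 2)) (π / 2), exp (ℓ θ) = G (circleMap 0 r θ)) :
    ∫ ω in (-r)..r, Real.log ‖G (ω * I)‖ * (k (ω * I)).re =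
      ∫ θ in (-(π / 2))..(π / 2), (ℓ θ * (circleMap 0 r θ * k (circleMap 0 r θ))).re := by
  have hpi : -(π / 2) ≤ π / 2 := by linarith [Real.pi_pos]
  have hkball : ∀ s : ℂ, ‖s‖ ≤ r → ContinuousAt k s := fun s hs =>
    (hk.differentiableAt (Metric.isOpen_ball.mem_nhds
      (by simpa using hs.trans_lt hr'))).continuousAt
  obtain ⟨M, hM⟩ : ∃ M, ∀ s : ℂ, ‖s‖ ≤ r → ‖k s‖ ≤ M := by
    obtain ⟨M, hM⟩ := (isCompact_closedBall (0 : ℂ) r).exists_bound_of_continuousOn (f := k)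
      fun s hs => (hkball s (by simpa using hs)).continuousWithinAt
    exact ⟨M, fun s hs => hM s (by simpa using hs)⟩
  have hM0 : 0 ≤ M := (norm_nonneg _).trans (hM 0 (by simpa using hr.le))
  have hdiff : ∀ ε, 0 < ε → ∀ s : ℂ, ε ≤ ‖s‖ → ‖s‖ ≤ r →
      DifferentiableAt ℂ (carlemanWeight k ε) s := fun ε hε s h1 h2 =>
    differentiableAt_carlemanWeight hk hε h1 (h2.trans_lt hr')
  have hcont : ∀ ε, 0 < ε → ContinuousOn (carlemanWeight k ε) (halfAnnulus ε r) :=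
    fun ε hε s hs => (hdiff ε hε s hs.2.1 hs.2.2).continuousAt.continuousWithinAt
  have hneg : ∀ ω : ℝ, (((-ω : ℝ) : ℂ) * I) = -(ω * I) := fun ω => by push_cast; ring
  have hX : Tendsto (fun ε : ℝ => ∫ ω in ε..r,
      (Real.log ‖G (ω * I)‖ * (carlemanWeight k ε (ω * I)).re +
        Real.log ‖G (-(ω * I))‖ * (carlemanWeight k ε (-(ω * I))).re)) (𝓝[>] 0)
      (𝓝 (∫ ω in (-r)..r, Real.log ‖G (ω * I)‖ * (k (ω * I)).re)) := by
    have hkc : ContinuousOn (fun ω : ℝ => (k (ω * I)).re) (uIcc (-r) r) := by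
      rw [uIcc_of_le (by linarith)]
      intro ω hω
      have h1 : ContinuousAt k (ω * I) := hkball _ (by simpa [abs_le] using hω)
      exact (continuous_re.continuousAt.comp (ContinuousAt.comp (f := fun ω : ℝ => (ω * I : ℂ))
        h1 (by fun_prop))).continuousWithinAt
    rw [integral_fold hr.le (hu.mul_continuousOn hkc)]
    obtain ⟨-, hu1, hu2⟩ := intervalIntegrable_of_neg hr.le hu
    simp only [hneg] at hu2 ⊢
    have hax : ∀ {ε ω : ℝ}, ε ∈ Ioo 0 r → ω ∈ Icc ε r → ‖(ω * I : ℂ)‖ = ω := fun h h' => by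
      simp [abs_of_nonneg (h.1.le.trans h'.1)]
    have hax' : ∀ {ω : ℝ}, ω ∈ Ioc 0 r → ‖(ω * I : ℂ)‖ ≤ r ∧ (ω * I : ℂ) ≠ 0 := fun h =>
      ⟨by simpa [abs_of_pos h.1] using h.2, by simpa using h.1.ne'⟩
    refine tendsto_integral_axis (C := 2 * M)
      (H₁ := fun ε ω => (carlemanWeight k ε (ω * I)).re)
      (H₂ := fun ε ω => (carlemanWeight k ε (-(ω * I))).re)
      (K₁ := fun ω => (k (ω * I)).re) (K₂ := fun ω => (k (-(ω * I))).re) hr hu1 hu2 ?_ ?_ ?_ ?_ ?_ ?_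
    · exact fun ε hε => continuous_re.comp_continuousOn ((hcont ε hε.1).comp_mul_I hε.1)
    · exact fun ε hε => continuous_re.comp_continuousOn ((hcont ε hε.1).comp_neg_mul_I hε.1)
    · refine fun ε hε ω hω => (abs_re_le_norm _).trans (norm_carlemanWeight_le hM hε.1 ?_ ?_)
      · rw [hax hε hω]; exact hω.1
      · rw [hax hε hω]; exact hω.2
    · refine fun ε hε ω hω => (abs_re_le_norm _).trans (norm_carlemanWeight_le hM hε.1 ?_ ?_)
      · rw [norm_neg, hax hε hω]; exact hω.1
      · rw [norm_neg, hax hε hω]; exact hω.2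
    · exact fun ω hω => (continuous_re.tendsto _).comp
        (tendsto_carlemanWeight hM (hax' hω).2 (hax' hω).1)
    · exact fun ω hω => (continuous_re.tendsto _).comp
        (tendsto_carlemanWeight hM (neg_ne_zero.2 (hax' hω).2) (by rw [norm_neg]; exact (hax' hω).1))
  have harcn : ∀ θ, ‖circleMap 0 r θ‖ = r := norm_circleMap_zero_of_nonneg hr.le
  have hev : ∀ᶠ ε in 𝓝[>] (0 : ℝ), ε ∈ Ioo 0 r := Ioo_mem_nhdsGT hr
  have hY : Tendsto (fun ε : ℝ => ∫ θ in (-(π / 2))..(π / 2),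
      (ℓ θ * (circleMap 0 r θ * carlemanWeight k ε (circleMap 0 r θ))).re) (𝓝[>] 0)
      (𝓝 (∫ θ in (-(π / 2))..(π / 2),
        (ℓ θ * (circleMap 0 r θ * k (circleMap 0 r θ))).re)) := by
    refine intervalIntegral.tendsto_integral_filter_of_dominated_convergence
      (fun θ => ‖ℓ θ‖ * (r * (2 * M))) ?_ ?_ ?_ ?_
    · filter_upwards [hev] with ε hε
      rw [uIoc_of_le hpi]
      refine ContinuousOn.aestronglyMeasurable ?_ measurableSet_Ioc
      refine continuous_re.comp_continuousOn ((hℓ.mono Ioc_subset_Icc_self).mul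
        ((continuous_circleMap 0 r).continuousOn.mul ?_))
      refine (hcont ε hε.1).comp (continuous_circleMap 0 r).continuousOn fun θ hθ => ?_
      exact ⟨circleMap_zero_re_nonneg hr.le (Ioc_subset_Icc_self hθ),
        by rw [harcn]; exact hε.2.le, (harcn θ).le⟩
    · filter_upwards [hev] with ε hε
      refine Eventually.of_forall fun θ _ => ?_
      rw [Real.norm_eq_abs]
      refine (abs_re_le_norm _).trans ?_
      rw [norm_mul, norm_mul, harcn]
      gcongr
      exact norm_carlemanWeight_le hM hε.1 (by rw [harcn]; exact hε.2.le) (harcn θ).le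
    · exact ContinuousOn.intervalIntegrable_of_Icc hpi (hℓ.norm.mul continuousOn_const)
    · refine Eventually.of_forall fun θ _ => (continuous_re.tendsto _).comp ?_
      refine ((tendsto_carlemanWeight hM ?_ (harcn θ).le).const_mul _).const_mul _
      rw [← norm_pos_iff, harcn]; exact hr
  refine eq_of_abs_sub_nonpos (le_of_forall_pos_le_add fun η hη => ?_)
  have hfreq := (hgrowth (η / (2 * M * π + 1)) (by positivity)).and_eventually hev
  refine le_of_tendsto_of_frequently ((hX.sub hY).abs) (hfreq.mono ?_)
  rintro ε ⟨hgr, hε⟩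
  have hsub : ∀ s ∈ halfAnnulus ε r, 0 ≤ s.re ∧ s ≠ 0 ∧ ‖s‖ ≤ r := fun s hs =>
    ⟨hs.1, norm_pos_iff.1 (hε.1.trans_le hs.2.1), hs.2.2⟩
  have hcauchy := integral_axis_eq_of_ne_zero hε.1 hε.2 (g := G) (h := carlemanWeight k ε)
    (hGc.mono hsub) (fun s hs => hG0 s (hsub s hs).1 (hsub s hs).2.1 (hsub s hs).2.2)
    (fun s h1 _ h3 => hGd s h1 h3) (hcont ε hε.1) (fun s _ h2 h3 => hdiff ε hε.1 s h2.le h3.le)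
    (fun ω h1 h2 => carlemanWeight_axis_im hkim hε.1 h1 (h2.trans_lt hr'))
    (fun s _ hs => carlemanWeight_arc_im k hε.1 hs) hℓ hℓe
  rw [hcauchy, sub_sub_cancel_left, abs_neg, zero_add]
  have hZ := intervalIntegral.norm_integral_le_of_norm_le_const (a := -(π / 2)) (b := π / 2)
    (C := 2 * M * (η / (2 * M * π + 1))) (f := fun θ => Real.log ‖G (circleMap 0 ε θ)‖ *
      (circleMap 0 ε θ * carlemanWeight k ε (circleMap 0 ε θ)).re) ?_
  · rw [Real.norm_eq_abs] at hZ
    refine hZ.trans ?_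
    rw [show π / 2 - -(π / 2) = π by ring, abs_of_pos Real.pi_pos]
    rw [show 2 * M * (η / (2 * M * π + 1)) * π = η * ((2 * M * π) / (2 * M * π + 1)) by ring]
    refine mul_le_of_le_one_right hη.le ?_
    rw [div_le_one (by positivity)]; linarith
  · intro θ hθ
    rw [uIoc_of_le hpi] at hθ
    have hn := norm_circleMap_zero_of_nonneg hε.1.le θ
    have h1 := hgr _ (circleMap_zero_re_nonneg hε.1.le (Ioc_subset_Icc_self hθ)) hn
    rw [norm_mul, Real.norm_eq_abs, Real.norm_eq_abs]
    calc _ ≤ |Real.log ‖G (circleMap 0 ε θ)‖| * (ε * (2 * M)) := by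
            gcongr
            refine (abs_re_le_norm _).trans ?_
            rw [norm_mul, hn]
            refine mul_le_mul_of_nonneg_left ?_ hε.1.le
            exact norm_carlemanWeight_le hM hε.1 hn.ge (hn.trans_le hε.2.le)
      _ = 2 * M * (ε * |Real.log ‖G (circleMap 0 ε θ)‖|) := by ring
      _ ≤ _ := by gcongr

/-! ### Blaschke factors on arcs -/

theorem one_sub_mem_slitPlane {w : ℂ} (hw : ‖w‖ < 1) : 1 - w ∈ slitPlane := by
  left
  have := (abs_le.1 (abs_re_le_norm w)).2
  simp only [sub_re, one_re]; linarith

theorem one_add_mem_slitPlane {w : ℂ} (hw : ‖w‖ < 1) : 1 + w ∈ slitPlane := by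
  simpa using one_sub_mem_slitPlane (w := -w) (by simpa using hw)

/-- The two Fourier coefficients of `log (1 - b e^{iθ})` of order `1` and `-1`. -/
theorem integral_log_one_sub_mul {b : ℂ} (hb : ‖b‖ < 1) :
    ∫ θ in (0 : ℝ)..2 * π, log (1 - b * exp (θ * I)) * exp (-(θ * I)) = -(2 * π * b) ∧
      ∫ θ in (0 : ℝ)..2 * π, log (1 - b * exp (θ * I)) * exp (θ * I) = 0 := by
  set U : Set ℂ := {z | ‖b * z‖ < 1} with hU
  have hUo : IsOpen U := isOpen_lt (by fun_prop) continuous_const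
  have hsub : Metric.closedBall (0 : ℂ) 1 ⊆ U := by
    intro z hz
    rw [mem_closedBall_zero_iff] at hz
    rw [hU, mem_ofPred_eq, norm_mul]
    nlinarith [norm_nonneg b, norm_nonneg z]
  have hd : DifferentiableOn ℂ (fun z : ℂ => log (1 - b * z)) U := by
    intro z hz
    have : DifferentiableAt ℂ (fun z : ℂ => 1 - b * z) z := by fun_prop
    exact (this.clog (one_sub_mem_slitPlane hz)).differentiableWithinAt
  have h0 : HasDerivAt (fun z : ℂ => log (1 - b * z)) (-b) 0 := by
    have h1 : HasDerivAt (fun z : ℂ => 1 - b * z) (-b) 0 := by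
      simpa using ((hasDerivAt_id (0 : ℂ)).const_mul b).const_sub 1
    simpa using h1.clog (by simp)
  constructor
  · have key := two_pi_I_inv_smul_circleIntegral_sub_sq_inv_smul_of_differentiable hUo hsub hd
      (Metric.mem_ball_self one_pos)
    rw [h0.deriv, inv_smul_eq_iff₀ two_pi_I_ne_zero, circleIntegral] at key
    have h2 : ∀ θ : ℝ, deriv (circleMap 0 1) θ * (((circleMap 0 1 θ - 0) ^ 2)⁻¹ *
        log (1 - b * circleMap 0 1 θ)) = I * (log (1 - b * exp (θ * I)) * exp (-(θ * I))) := by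
      intro θ
      simp only [deriv_circleMap, circleMap, ofReal_one, one_mul, zero_add, sub_zero, exp_neg]
      field_simp
    simp only [smul_eq_mul, h2, intervalIntegral.integral_const_mul] at key
    have : I * ∫ θ in (0 : ℝ)..2 * π, log (1 - b * exp (θ * I)) * exp (-(θ * I)) =
        I * -(2 * π * b) := by rw [key]; ring
    exact mul_left_cancel₀ I_ne_zero this
  · have key := circleIntegral_eq_zero_of_differentiable_on_off_countable (zero_le_one)
      countable_empty (c := (0 : ℂ)) (f := fun z : ℂ => log (1 - b * z))
      (hd.continuousOn.mono hsub) (fun z hz => hd.differentiableAt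
        (hUo.mem_nhds (hsub (Metric.ball_subset_closedBall hz.1))))
    rw [circleIntegral] at key
    have h2 : ∀ θ : ℝ, deriv (circleMap 0 1) θ • log (1 - b * circleMap 0 1 θ) =
        I * (log (1 - b * exp (θ * I)) * exp (θ * I)) := by
      intro θ
      simp only [deriv_circleMap, circleMap, ofReal_one, one_mul, zero_add, smul_eq_mul]
      ring
    simp only [h2, intervalIntegral.integral_const_mul] at key
    exact (mul_eq_zero.1 key).resolve_left I_ne_zero

/-- Unfolding an integral over a half circle into one over the circle. -/
theorem integral_half_circle_unfold {W : ℝ → ℝ} (hW : Continuous W)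
    (hper : Function.Periodic W (2 * π)) :
    ∫ θ in (-(π / 2))..(π / 2), (W θ + W (π - θ)) = ∫ θ in (0 : ℝ)..2 * π, W θ := by
  have hW' : Continuous fun θ => W (π - θ) := hW.comp (by fun_prop)
  rw [intervalIntegral.integral_add (hW.intervalIntegrable _ _) (hW'.intervalIntegrable _ _),
    intervalIntegral.integral_comp_sub_left,
    show π - π / 2 = π / 2 by ring, show π - -(π / 2) = -(π / 2) + 2 * π by ring,
    intervalIntegral.integral_add_adjacent_intervals (hW.intervalIntegrable _ _)
      (hW.intervalIntegrable _ _), hper.intervalIntegral_add_eq (-(π / 2)) 0, zero_add]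

theorem circleMap_pi_sub (ρ θ : ℝ) : circleMap 0 ρ (π - θ) = -conj (circleMap 0 ρ θ) := by
  simp only [circleMap, zero_add, map_mul, conj_ofReal, ← exp_conj, conj_I]
  push_cast
  rw [sub_mul, exp_sub, exp_pi_mul_I, mul_neg, exp_neg]
  ring

theorem circleMap_two_pi_sub (ρ θ : ℝ) : circleMap 0 ρ (2 * π - θ) = conj (circleMap 0 ρ θ) := by
  simp only [circleMap, zero_add, map_mul, conj_ofReal, ← exp_conj, conj_I]
  push_cast
  rw [sub_mul, exp_sub, exp_two_pi_mul_I, mul_neg, exp_neg]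
  ring

theorem log_one_add_conj {w : ℂ} (hw : ‖w‖ < 1) : log (1 + conj w) = conj (log (1 + w)) := by
  rw [← log_conj _ (mem_slitPlane_iff_arg.1 (one_add_mem_slitPlane hw)).1, map_add, map_one]

/-- A continuous logarithm of the Blaschke factor `(s - a) / (s + conj a)` on the arc `|s| = ρ`,
where `|a| < ρ`. -/
noncomputable def logBlaschke (a : ℂ) (ρ θ : ℝ) : ℂ :=
  log (1 - a / circleMap 0 ρ θ) - log (1 + conj a / circleMap 0 ρ θ)

theorem norm_div_circleMap_lt {a : ℂ} {ρ : ℝ} (ha : ‖a‖ < ρ) (θ : ℝ) :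
    ‖a / circleMap 0 ρ θ‖ < 1 := by
  have hρ : 0 < ρ := (norm_nonneg a).trans_lt ha
  rw [norm_div, norm_circleMap_zero_of_nonneg hρ.le, div_lt_one hρ]; exact ha

theorem circleMap_zero_ne_zero {ρ : ℝ} (hρ : 0 < ρ) (θ : ℝ) : circleMap 0 ρ θ ≠ 0 := by
  rw [← norm_pos_iff, norm_circleMap_zero_of_nonneg hρ.le]; exact hρ

theorem continuous_logBlaschke {a : ℂ} {ρ : ℝ} (ha : ‖a‖ < ρ) : Continuous (logBlaschke a ρ) := by
  have hρ : 0 < ρ := (norm_nonneg a).trans_lt ha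
  have hc : ∀ b : ℂ, Continuous fun θ => b / circleMap 0 ρ θ := fun b =>
    continuous_const.div (continuous_circleMap 0 ρ) (circleMap_zero_ne_zero hρ)
  refine Continuous.sub ?_ ?_
  · exact (continuous_const.sub (hc a)).clog fun θ => one_sub_mem_slitPlane
      (norm_div_circleMap_lt ha θ)
  · exact (continuous_const.add (hc _)).clog fun θ => one_add_mem_slitPlane
      (norm_div_circleMap_lt (by rwa [RCLike.norm_conj]) θ)

theorem exp_logBlaschke {a : ℂ} {ρ : ℝ} (ha : ‖a‖ < ρ) (θ : ℝ) :
    exp (logBlaschke a ρ θ) =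
      (circleMap 0 ρ θ - a) / (circleMap 0 ρ θ + conj a) := by
  have hρ : 0 < ρ := (norm_nonneg a).trans_lt ha
  have h0 := circleMap_zero_ne_zero hρ θ
  have h1 := one_sub_mem_slitPlane (norm_div_circleMap_lt ha θ)
  have h2 := one_add_mem_slitPlane
    (norm_div_circleMap_lt (show ‖conj a‖ < ρ by rwa [RCLike.norm_conj]) θ)
  rw [logBlaschke, exp_sub, exp_log (slitPlane_ne_zero h1), exp_log (slitPlane_ne_zero h2)]
  rw [← mul_div_mul_left _ _ h0, mul_sub, mul_add, mul_one, mul_div_cancel₀ _ h0,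
    mul_div_cancel₀ _ h0]

/-- The outer arc contributes `-2π Re a`, whatever the constant `c` in the weight. -/
theorem integral_logBlaschke {a : ℂ} {ρ : ℝ} (ha : ‖a‖ < ρ) (c : ℝ) :
    ∫ θ in (-(π / 2))..(π / 2), (logBlaschke a ρ θ *
      (circleMap 0 ρ θ + c / circleMap 0 ρ θ)).re = -(2 * π * a.re) := by
  have hρ : 0 < ρ := (norm_nonneg a).trans_lt ha
  have h0 := circleMap_zero_ne_zero hρ
  set W : ℝ → ℝ := fun θ => (log (1 - a / circleMap 0 ρ θ) *
    (circleMap 0 ρ θ + c / circleMap 0 ρ θ)).re with hW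
  have hdiv : ∀ b : ℂ, Continuous fun θ => b / circleMap 0 ρ θ := fun b =>
    continuous_const.div (continuous_circleMap 0 ρ) h0
  have hWc : Continuous W := by
    refine continuous_re.comp (Continuous.mul ?_ ((continuous_circleMap 0 ρ).add (hdiv c)))
    exact (continuous_const.sub (hdiv a)).clog fun θ => one_sub_mem_slitPlane
      (norm_div_circleMap_lt ha θ)
  have hper : Function.Periodic W (2 * π) := by
    intro θ
    simp only [hW, periodic_circleMap 0 ρ θ]
  have h1 : ∀ θ, (logBlaschke a ρ θ * (circleMap 0 ρ θ + c / circleMap 0 ρ θ)).re =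
      W θ + W (π - θ) := by
    intro θ
    have e1 : W (π - θ) = -(log (1 + conj a / circleMap 0 ρ θ) *
        (circleMap 0 ρ θ + c / circleMap 0 ρ θ)).re := by
      have e2 : 1 - a / circleMap 0 ρ (π - θ) = 1 + conj (conj a / circleMap 0 ρ θ) := by
        rw [circleMap_pi_sub, map_div₀, conj_conj]
        ring
      have e3 : circleMap 0 ρ (π - θ) + c / circleMap 0 ρ (π - θ) =
          -conj (circleMap 0 ρ θ + c / circleMap 0 ρ θ) := by
        rw [circleMap_pi_sub, map_add, map_div₀, conj_ofReal]; ring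
      simp only [hW]
      rw [e2, e3, log_one_add_conj (norm_div_circleMap_lt (by rwa [RCLike.norm_conj]) θ),
        mul_neg, ← map_mul, neg_re, conj_re]
    rw [e1, logBlaschke, sub_mul, sub_re]; ring
  simp only [h1]
  rw [integral_half_circle_unfold hWc hper]
  set b : ℂ := a / ρ with hb
  have hb1 : ‖b‖ < 1 := by
    rw [hb, norm_div, norm_real, Real.norm_eq_abs, abs_of_pos hρ, div_lt_one hρ]; exact ha
  obtain ⟨f1, f2⟩ := integral_log_one_sub_mul hb1
  have hr : (ρ : ℂ) ≠ 0 := by exact_mod_cast hρ.ne'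
  have hlogc : Continuous fun θ : ℝ => log (1 - b * exp (θ * I)) :=
    (by fun_prop : Continuous fun θ : ℝ => 1 - b * exp (θ * I)).clog fun θ =>
      one_sub_mem_slitPlane (by rwa [norm_mul, norm_exp_ofReal_mul_I, mul_one])
  have h2 : ∀ θ, W (2 * π - θ) = (ρ * (log (1 - b * exp (θ * I)) * exp (-(θ * I))) +
      (c / ρ) * (log (1 - b * exp (θ * I)) * exp (θ * I))).re := by
    intro θ
    have e : circleMap 0 ρ (2 * π - θ) = ρ * exp (-(θ * I)) := by
      rw [circleMap_two_pi_sub]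
      simp only [circleMap, zero_add, map_mul, conj_ofReal, ← exp_conj, conj_I, mul_neg]
    simp only [hW, e, hb, exp_neg]
    congr 1
    have := exp_ne_zero (θ * I)
    field_simp
  have h3 : ∫ θ in (0 : ℝ)..2 * π, W θ = ∫ θ in (0 : ℝ)..2 * π, W (2 * π - θ) := by
    rw [intervalIntegral.integral_comp_sub_left, sub_self, sub_zero]
  rw [h3]
  simp only [h2]
  have i1 : IntervalIntegrable (fun θ : ℝ => (ρ : ℂ) * (log (1 - b * exp (θ * I)) *
      exp (-(θ * I)))) volume 0 (2 * π) := Continuous.intervalIntegrable (by fun_prop) _ _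
  have i2 : IntervalIntegrable (fun θ : ℝ => (c / ρ : ℂ) * (log (1 - b * exp (θ * I)) *
      exp (θ * I))) volume 0 (2 * π) := Continuous.intervalIntegrable (by fun_prop) _ _
  have h4 := reCLM.intervalIntegral_comp_comm (i1.add i2)
  simp only [reCLM_apply] at h4
  rw [h4, intervalIntegral.integral_add i1 i2, intervalIntegral.integral_const_mul,
    intervalIntegral.integral_const_mul, f1, f2, mul_zero, add_zero, hb]
  rw [show (ρ : ℂ) * -(2 * π * (a / ρ)) = ((-(2 * π) : ℝ) : ℂ) * a by push_cast; field_simp]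
  rw [re_ofReal_mul]; ring

/-- The inner arc contributes `-2π ε² Re a / |a|²`. -/
theorem integral_log_norm_blaschke {a : ℂ} {ε : ℝ} (hε : 0 < ε) (ha : ε < ‖a‖) :
    2 * ε * ∫ θ in (-(π / 2))..(π / 2), Real.log ‖(circleMap 0 ε θ - a) /
      (circleMap 0 ε θ + conj a)‖ * Real.cos θ = -(2 * π * (a.re * (ε ^ 2 / ‖a‖ ^ 2))) := by
  have ha0 : a ≠ 0 := norm_pos_iff.1 (hε.trans ha)
  set b : ℂ := ε / a with hb
  have hb1 : ‖b‖ < 1 := by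
    rw [hb, norm_div, norm_real, Real.norm_eq_abs, abs_of_pos hε, div_lt_one (hε.trans ha)]
    exact ha
  have hslit : ∀ θ : ℝ, 1 - b * exp (θ * I) ∈ slitPlane := fun θ =>
    one_sub_mem_slitPlane (by rwa [norm_mul, norm_exp_ofReal_mul_I, mul_one])
  have hlogc : Continuous fun θ : ℝ => log (1 - b * exp (θ * I)) :=
    (by fun_prop : Continuous fun θ : ℝ => 1 - b * exp (θ * I)).clog hslit
  set W : ℝ → ℝ := fun θ => (log (1 - b * exp (θ * I))).re * Real.cos θ with hW
  have hWc : Continuous W := (continuous_re.comp hlogc).mul Real.continuous_cos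
  have hper : Function.Periodic W (2 * π) := by
    intro θ
    simp only [hW, Real.cos_add_two_pi]
    push_cast
    rw [add_mul, exp_add, exp_two_pi_mul_I, mul_one]
  have h1 : ∀ θ, Real.log ‖(circleMap 0 ε θ - a) / (circleMap 0 ε θ + conj a)‖ * Real.cos θ =
      W θ + W (π - θ) := by
    intro θ
    have e1 : ‖circleMap 0 ε θ - a‖ = ‖a‖ * ‖1 - b * exp (θ * I)‖ := by
      rw [← norm_mul, ← norm_neg]
      congr 1
      rw [hb, circleMap]; field_simp; ring
    have e2 : ‖circleMap 0 ε θ + conj a‖ = ‖a‖ * ‖1 - b * exp ((π - θ : ℝ) * I)‖ := by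
      rw [← norm_mul, ← RCLike.norm_conj]
      congr 1
      have := circleMap_pi_sub ε θ
      rw [map_add, conj_conj, eq_neg_iff_add_eq_zero.1 this |> eq_neg_of_add_eq_zero_right]
      rw [hb, circleMap]; field_simp; ring
    have hn : ∀ θ : ℝ, ‖1 - b * exp (θ * I)‖ ≠ 0 := fun θ =>
      norm_ne_zero_iff.2 (slitPlane_ne_zero (hslit θ))
    rw [norm_div, e1, e2, mul_div_mul_left _ _ (norm_ne_zero_iff.2 ha0),
      Real.log_div (hn _) (hn _)]
    simp only [hW, log_re, Real.cos_pi_sub]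
    ring
  simp only [h1]
  rw [integral_half_circle_unfold hWc hper]
  obtain ⟨f1, f2⟩ := integral_log_one_sub_mul hb1
  have i1 : IntervalIntegrable (fun θ : ℝ => log (1 - b * exp (θ * I)) * exp (-(θ * I))) volume
      0 (2 * π) := Continuous.intervalIntegrable (by fun_prop) _ _
  have i2 : IntervalIntegrable (fun θ : ℝ => log (1 - b * exp (θ * I)) * exp (θ * I)) volume
      0 (2 * π) := Continuous.intervalIntegrable (by fun_prop) _ _
  have h2 : ∀ θ, W θ = 2⁻¹ * (log (1 - b * exp (θ * I)) * exp (-(θ * I)) +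
      log (1 - b * exp (θ * I)) * exp (θ * I)).re := by
    intro θ
    rw [← mul_add, show exp (-(θ * I)) + exp (θ * I) = ((2 * Real.cos θ : ℝ) : ℂ) by
      push_cast; rw [two_cos]; ring_nf, mul_comm (log _), re_ofReal_mul]
    simp only [hW]; ring
  have h4 := reCLM.intervalIntegral_comp_comm (i1.add i2)
  simp only [reCLM_apply] at h4
  simp only [h2, intervalIntegral.integral_const_mul]
  rw [h4, intervalIntegral.integral_add i1 i2, f1, f2, add_zero, hb]
  have : ((ε : ℂ) / a).re = ε * (a.re / ‖a‖ ^ 2) := by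
    rw [div_eq_mul_inv, re_ofReal_mul, inv_re, normSq_eq_norm_sq]
  rw [neg_re, show (2 * (π : ℂ) * (ε / a)) = ((2 * π : ℝ) : ℂ) * (ε / a) by push_cast; ring,
    re_ofReal_mul, this]
  ring

/-! ### Carleman's formula with finitely many zeros -/

theorem norm_blaschke_mul_I (a : ℂ) {ω : ℝ} (ha : 0 < a.re) :
    ‖((ω * I : ℂ) - a) / (ω * I + conj a)‖ = 1 := by
  have h1 : (ω * I : ℂ) + conj a = -conj (ω * I - a) := by
    simp only [map_sub, map_mul, conj_ofReal, conj_I]; ring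
  have h2 : (ω * I : ℂ) - a ≠ 0 := by
    intro h
    have := congrArg re h
    simp at this; linarith
  rw [h1, norm_div, norm_neg, RCLike.norm_conj, div_self (norm_ne_zero_iff.2 h2)]

theorem log_norm_prod_blaschke_mul {ι : Type*} (J : Finset ι) (a : ι → ℂ) (d : ι → ℕ) {s w : ℂ}
    (hs : ∀ j ∈ J, (s - a j) / (s + conj (a j)) ≠ 0) (hw : w ≠ 0) :
    Real.log ‖(∏ j ∈ J, ((s - a j) / (s + conj (a j))) ^ d j) * w‖ =
      (∑ j ∈ J, d j * Real.log ‖(s - a j) / (s + conj (a j))‖) + Real.log ‖w‖ := by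
  rw [norm_mul, Real.log_mul _ (norm_ne_zero_iff.2 hw), norm_prod, Real.log_prod]
  · simp only [norm_pow, Real.log_pow]
  · intro j hj
    exact norm_ne_zero_iff.2 (pow_ne_zero _ (hs j hj))
  · exact norm_ne_zero_iff.2 (Finset.prod_ne_zero_iff.2 fun j hj => pow_ne_zero _ (hs j hj))

theorem blaschke_ne_zero {a s : ℂ} (ha : 0 < a.re) (hs : 0 ≤ s.re) (hsa : s ≠ a) :
    (s - a) / (s + conj a) ≠ 0 := by
  refine div_ne_zero (sub_ne_zero.2 hsa) fun h => ?_
  have := congrArg re h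
  simp at this; linarith

/-- Dividing out Blaschke factors changes the branch of the logarithm on the outer arc by an
explicit amount. -/
theorem exp_sub_sum_logBlaschke {ι : Type*} {J : Finset ι} {a : ι → ℂ} {d : ι → ℕ} {ρ θ : ℝ}
    (hρ : 0 < ρ) (hθ : θ ∈ Icc (-(π / 2)) (π / 2)) (ha : ∀ j ∈ J, 0 < (a j).re ∧ ‖a j‖ < ρ)
    {ℓ w : ℂ}
    (hℓ : exp ℓ = (∏ j ∈ J, ((circleMap 0 ρ θ - a j) / (circleMap 0 ρ θ + conj (a j))) ^ d j) * w) :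
    exp (ℓ - ∑ j ∈ J, d j * logBlaschke (a j) ρ θ) = w := by
  have h1 : exp (∑ j ∈ J, d j * logBlaschke (a j) ρ θ) =
      ∏ j ∈ J, ((circleMap 0 ρ θ - a j) / (circleMap 0 ρ θ + conj (a j))) ^ d j := by
    rw [exp_sum]
    refine Finset.prod_congr rfl fun j hj => ?_
    rw [exp_nat_mul, exp_logBlaschke (ha j hj).2]
  rw [exp_sub, hℓ, h1, mul_div_cancel_left₀]
  refine Finset.prod_ne_zero_iff.2 fun j hj => pow_ne_zero _ (blaschke_ne_zero (ha j hj).1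
    (circleMap_zero_re_nonneg hρ.le hθ) ?_)
  intro h
  have := (ha j hj).2
  rw [← h, norm_circleMap_zero_of_nonneg hρ.le] at this
  exact lt_irrefl _ this

/-- The effect on the outer arc of dividing out Blaschke factors: by `integral_logBlaschke`, each of
them accounts for `2π Re a`. -/
theorem integral_sub_sum_logBlaschke {ι : Type*} (J : Finset ι) (a : ι → ℂ) (d : ι → ℕ) {ρ : ℝ}
    (hρ : 0 < ρ) (ha : ∀ j ∈ J, ‖a j‖ < ρ) (c : ℝ) {ℓ : ℝ → ℂ}
    (hℓ : ContinuousOn ℓ (Icc (-(π / 2)) (π / 2))) :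
    ∫ θ in (-(π / 2))..(π / 2), ((ℓ θ - ∑ j ∈ J, d j * logBlaschke (a j) ρ θ) *
        (circleMap 0 ρ θ + c / circleMap 0 ρ θ)).re =
      (∫ θ in (-(π / 2))..(π / 2), (ℓ θ * (circleMap 0 ρ θ + c / circleMap 0 ρ θ)).re) +
        2 * π * ∑ j ∈ J, d j * (a j).re := by
  have hpi : -(π / 2) ≤ π / 2 := by linarith [Real.pi_pos]
  have hwc : Continuous fun θ => circleMap 0 ρ θ + c / circleMap 0 ρ θ :=
    (continuous_circleMap 0 ρ).add
      (continuous_const.div (continuous_circleMap 0 ρ) (circleMap_zero_ne_zero hρ))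
  have i1 : IntervalIntegrable (fun θ => (ℓ θ * (circleMap 0 ρ θ + c / circleMap 0 ρ θ)).re)
      volume (-(π / 2)) (π / 2) := ContinuousOn.intervalIntegrable_of_Icc hpi
    (continuous_re.comp_continuousOn (hℓ.mul hwc.continuousOn))
  have i2 : ∀ j ∈ J, IntervalIntegrable (fun θ => (d j : ℝ) * (logBlaschke (a j) ρ θ *
      (circleMap 0 ρ θ + c / circleMap 0 ρ θ)).re) volume (-(π / 2)) (π / 2) := fun j hj =>
    (continuous_const.mul (continuous_re.comp
      ((continuous_logBlaschke (ha j hj)).mul hwc))).intervalIntegrable _ _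
  have e : ∀ θ, ((ℓ θ - ∑ j ∈ J, d j * logBlaschke (a j) ρ θ) *
      (circleMap 0 ρ θ + c / circleMap 0 ρ θ)).re =
      (ℓ θ * (circleMap 0 ρ θ + c / circleMap 0 ρ θ)).re -
      ∑ j ∈ J, (d j : ℝ) * (logBlaschke (a j) ρ θ *
        (circleMap 0 ρ θ + c / circleMap 0 ρ θ)).re := by
    intro θ
    rw [sub_mul, sub_re, Finset.sum_mul, re_sum]
    congr 1
    refine Finset.sum_congr rfl fun j _ => ?_
    rw [mul_assoc, ← ofReal_natCast, re_ofReal_mul]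
  simp only [e]
  rw [intervalIntegral.integral_sub i1
      (by simpa only [Finset.sum_fn] using IntervalIntegrable.sum J i2),
    intervalIntegral.integral_finsetSum i2, sub_eq_add_neg, ← Finset.sum_neg_distrib,
    Finset.mul_sum]
  congr 1
  refine Finset.sum_congr rfl fun j hj => ?_
  rw [intervalIntegral.integral_const_mul, integral_logBlaschke (ha j hj)]; ring

theorem circleMap_mul_carlemanWeight_one (ε : ℝ) {ρ : ℝ} (hρ : 0 < ρ) (θ : ℝ) :
    circleMap 0 ρ θ * carlemanWeight 1 ε (circleMap 0 ρ θ) =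
      circleMap 0 ρ θ + ((ε ^ 2 : ℝ) : ℂ) / circleMap 0 ρ θ := by
  have := circleMap_zero_ne_zero hρ θ
  simp only [carlemanWeight, Pi.one_apply, map_one]
  push_cast
  field_simp

theorem carlemanWeight_one_axis_re (ε ω : ℝ) :
    (carlemanWeight 1 ε (ω * I)).re = 1 - ε ^ 2 / ω ^ 2 ∧
      (carlemanWeight 1 ε (-(ω * I))).re = 1 - ε ^ 2 / ω ^ 2 := by
  have h : (1 : ℂ) + (ε : ℂ) ^ 2 / (ω * I) ^ 2 * 1 = ((1 - ε ^ 2 / ω ^ 2 : ℝ) : ℂ) := by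
    rw [mul_pow, I_sq]; push_cast; ring
  simp only [carlemanWeight, Pi.one_apply, map_one, neg_sq, h, ofReal_re, and_self]

theorem circleMap_mul_carlemanWeight_one_re {ε : ℝ} (hε : 0 < ε) (θ : ℝ) :
    (circleMap 0 ε θ * carlemanWeight 1 ε (circleMap 0 ε θ)).re = 2 * ε * Real.cos θ := by
  have h : ((ε ^ 2 : ℝ) : ℂ) / circleMap 0 ε θ = conj (circleMap 0 ε θ) := by
    rw [div_eq_iff (circleMap_zero_ne_zero hε θ), mul_comm, mul_conj, normSq_eq_norm_sq,
      norm_circleMap_zero_of_nonneg hε.le]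
  rw [circleMap_mul_carlemanWeight_one ε hε, h, add_re, conj_re, circleMap_zero_re]; ring

/-- **Carleman's formula** on a half annulus for a function with finitely many zeros `a j`, of
orders `d j`. -/
theorem integral_axis_halfAnnulus {ε ρ : ℝ} (hε : 0 < ε) (hερ : ε < ρ) {ι : Type*} (J : Finset ι)
    (a : ι → ℂ) (d : ι → ℕ) (ha : ∀ j ∈ J, 0 < (a j).re ∧ ε < ‖a j‖ ∧ ‖a j‖ < ρ) {G g : ℂ → ℂ}
    (hG : ∀ s ∈ halfAnnulus ε ρ, G s = (∏ j ∈ J, ((s - a j) / (s + conj (a j))) ^ d j) * g s)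
    (hgc : ContinuousOn g (halfAnnulus ε ρ)) (hg0 : ∀ s ∈ halfAnnulus ε ρ, g s ≠ 0)
    (hgd : ∀ s : ℂ, 0 < s.re → ε < ‖s‖ → ‖s‖ < ρ → DifferentiableAt ℂ g s)
    {ℓ : ℝ → ℂ} (hℓ : ContinuousOn ℓ (Icc (-(π / 2)) (π / 2)))
    (hℓe : ∀ θ ∈ Icc (-(π / 2)) (π / 2), exp (ℓ θ) = G (circleMap 0 ρ θ)) :
    ∫ ω in ε..ρ, (Real.log ‖G (ω * I)‖ + Real.log ‖G (-(ω * I))‖) * (1 - ε ^ 2 / ω ^ 2) =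
      (∫ θ in (-(π / 2))..(π / 2),
          (ℓ θ * (circleMap 0 ρ θ + ((ε ^ 2 : ℝ) : ℂ) / circleMap 0 ρ θ)).re) -
        2 * ε * (∫ θ in (-(π / 2))..(π / 2), Real.log ‖G (circleMap 0 ε θ)‖ * Real.cos θ) +
        2 * π * ∑ j ∈ J, d j * ((a j).re * (1 - ε ^ 2 / ‖a j‖ ^ 2)) := by
  have hρ : 0 < ρ := hε.trans hερ
  have hpi : -(π / 2) ≤ π / 2 := by linarith [Real.pi_pos]
  have hout : ∀ θ ∈ Icc (-(π / 2)) (π / 2), circleMap 0 ρ θ ∈ halfAnnulus ε ρ := fun θ hθ =>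
    ⟨circleMap_zero_re_nonneg hρ.le hθ, by rw [norm_circleMap_zero_of_nonneg hρ.le]; exact hερ.le,
      (norm_circleMap_zero_of_nonneg hρ.le θ).le⟩
  have hinn : ∀ θ ∈ Icc (-(π / 2)) (π / 2), circleMap 0 ε θ ∈ halfAnnulus ε ρ := fun θ hθ =>
    ⟨circleMap_zero_re_nonneg hε.le hθ, (norm_circleMap_zero_of_nonneg hε.le θ).ge,
      by rw [norm_circleMap_zero_of_nonneg hε.le]; exact hερ.le⟩
  have hwd : ∀ s : ℂ, s ≠ 0 → DifferentiableAt ℂ (carlemanWeight 1 ε) s := by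
    intro s hs
    change DifferentiableAt ℂ (fun s : ℂ => (1 : ℂ) + (ε : ℂ) ^ 2 / s ^ 2 * conj 1) s
    have := pow_ne_zero 2 hs
    fun_prop (disch := assumption)
  have hwc : ContinuousOn (carlemanWeight 1 ε) (halfAnnulus ε ρ) := fun s hs =>
    (hwd s (norm_pos_iff.1 (hε.trans_le hs.2.1))).continuousAt.continuousWithinAt
  have key := integral_axis_eq_of_ne_zero hε hερ hgc hg0 hgd hwc
    (fun s _ h2 _ => hwd s (norm_pos_iff.1 (hε.trans h2)))
    (fun ω h1 _ => carlemanWeight_axis_im (r' := |ω| + 1) (by simp) hε h1 (by linarith))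
    (fun s _ hs => carlemanWeight_arc_im 1 hε hs)
    (ℓ := fun θ => ℓ θ - ∑ j ∈ J, d j * logBlaschke (a j) ρ θ)
    (hℓ.sub (continuousOn_finsetSum J fun j hj =>
      continuousOn_const.mul (continuous_logBlaschke (ha j hj).2.2).continuousOn))
    (fun θ hθ => exp_sub_sum_logBlaschke hρ hθ (fun j hj => ⟨(ha j hj).1, (ha j hj).2.2⟩)
      ((hℓe θ hθ).trans (hG _ (hout θ hθ))))
  simp only [circleMap_mul_carlemanWeight_one ε hρ, circleMap_mul_carlemanWeight_one_re hε,
    carlemanWeight_one_axis_re] at key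
  rw [integral_sub_sum_logBlaschke J a d hρ (fun j hj => (ha j hj).2.2) (ε ^ 2) hℓ] at key
  have hlhs : ∫ ω in ε..ρ, (Real.log ‖G (ω * I)‖ + Real.log ‖G (-(ω * I))‖) *
      (1 - ε ^ 2 / ω ^ 2) = ∫ ω in ε..ρ, (Real.log ‖g (ω * I)‖ * (1 - ε ^ 2 / ω ^ 2) +
        Real.log ‖g (-(ω * I))‖ * (1 - ε ^ 2 / ω ^ 2)) := by
    have hax : ∀ ω : ℝ, (ω * I : ℂ) ∈ halfAnnulus ε ρ → ‖G (ω * I)‖ = ‖g (ω * I)‖ := by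
      intro ω hω
      rw [hG _ hω, norm_mul, norm_prod, Finset.prod_eq_one, one_mul]
      intro j hj
      rw [norm_pow, norm_blaschke_mul_I _ (ha j hj).1, one_pow]
    refine intervalIntegral.integral_congr fun ω hω => ?_
    rw [uIcc_of_le hερ.le] at hω
    have h1 := hax ω (mul_I_mem_halfAnnulus hε hω).1
    have h2 := hax (-ω) (by
      rw [show (((-ω : ℝ) : ℂ) * I) = -(ω * I) by push_cast; ring]
      exact (mul_I_mem_halfAnnulus hε hω).2)
    rw [show (((-ω : ℝ) : ℂ) * I) = -(ω * I) by push_cast; ring] at h2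
    simp only [h1, h2]; ring
  have hne : ∀ θ ∈ Icc (-(π / 2)) (π / 2), ∀ j ∈ J, (circleMap 0 ε θ - a j) /
      (circleMap 0 ε θ + conj (a j)) ≠ 0 := by
    intro θ hθ j hj
    refine blaschke_ne_zero (ha j hj).1 (circleMap_zero_re_nonneg hε.le hθ) fun h => ?_
    have := (ha j hj).2.1
    rw [← h, norm_circleMap_zero_of_nonneg hε.le] at this
    exact lt_irrefl _ this
  have hGin : ∫ θ in (-(π / 2))..(π / 2), Real.log ‖G (circleMap 0 ε θ)‖ * Real.cos θ =
      ∫ θ in (-(π / 2))..(π / 2), ((∑ j ∈ J, d j * (Real.log ‖(circleMap 0 ε θ - a j) /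
        (circleMap 0 ε θ + conj (a j))‖ * Real.cos θ)) +
          Real.log ‖g (circleMap 0 ε θ)‖ * Real.cos θ) := by
    refine intervalIntegral.integral_congr fun θ hθ => ?_
    rw [uIcc_of_le hpi] at hθ
    rw [hG _ (hinn θ hθ), log_norm_prod_blaschke_mul J a d (hne θ hθ) (hg0 _ (hinn θ hθ)), add_mul,
      Finset.sum_mul]
    congr 1
    exact Finset.sum_congr rfl fun j _ => by ring
  have i1 : IntervalIntegrable (fun θ => Real.log ‖g (circleMap 0 ε θ)‖ * Real.cos θ) volume
      (-(π / 2)) (π / 2) := ContinuousOn.intervalIntegrable_of_Icc hpi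
    (((hgc.comp (continuous_circleMap 0 ε).continuousOn hinn).norm.log fun θ hθ =>
      norm_ne_zero_iff.2 (hg0 _ (hinn θ hθ))).mul Real.continuous_cos.continuousOn)
  have i2 : ∀ j ∈ J, IntervalIntegrable (fun θ => (d j : ℝ) * (Real.log ‖(circleMap 0 ε θ - a j) /
        (circleMap 0 ε θ + conj (a j))‖ * Real.cos θ)) volume (-(π / 2)) (π / 2) := by
    intro j hj
    refine ContinuousOn.intervalIntegrable_of_Icc hpi (continuousOn_const.mul
      (ContinuousOn.mul (ContinuousOn.log (ContinuousOn.norm (ContinuousOn.div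
        (by fun_prop) (by fun_prop) ?_)) ?_) Real.continuous_cos.continuousOn))
    · intro θ hθ h
      exact hne θ hθ j hj (by rw [h, div_zero])
    · exact fun θ hθ => norm_ne_zero_iff.2 (hne θ hθ j hj)
  rw [intervalIntegral.integral_add (by simpa only [Finset.sum_fn] using IntervalIntegrable.sum J i2)
    i1, intervalIntegral.integral_finsetSum i2] at hGin
  have hsum : 2 * ε * ∑ j ∈ J, ∫ θ in (-(π / 2))..(π / 2), (d j : ℝ) *
      (Real.log ‖(circleMap 0 ε θ - a j) / (circleMap 0 ε θ + conj (a j))‖ * Real.cos θ) =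
      -(2 * π * ∑ j ∈ J, d j * ((a j).re * (ε ^ 2 / ‖a j‖ ^ 2))) := by
    rw [Finset.mul_sum, Finset.mul_sum, ← Finset.sum_neg_distrib]
    refine Finset.sum_congr rfl fun j hj => ?_
    rw [intervalIntegral.integral_const_mul, mul_left_comm,
      integral_log_norm_blaschke hε (ha j hj).2.1]
    ring
  have hsum2 : ∑ j ∈ J, (d j : ℝ) * ((a j).re * (1 - ε ^ 2 / ‖a j‖ ^ 2)) =
      ∑ j ∈ J, (d j : ℝ) * (a j).re - ∑ j ∈ J, d j * ((a j).re * (ε ^ 2 / ‖a j‖ ^ 2)) := by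
    rw [← Finset.sum_sub_distrib]
    exact Finset.sum_congr rfl fun j _ => by ring
  have hginn : ∫ θ in (-(π / 2))..(π / 2), Real.log ‖g (circleMap 0 ε θ)‖ *
      (2 * ε * Real.cos θ) = 2 * ε * ∫ θ in (-(π / 2))..(π / 2),
        Real.log ‖g (circleMap 0 ε θ)‖ * Real.cos θ := by
    rw [← intervalIntegral.integral_const_mul]
    exact intervalIntegral.integral_congr fun θ _ => by ring
  rw [hlhs, key, hGin, hginn, hsum2, mul_add (2 * ε), hsum]
  ring

theorem isCompact_halfDisc (r : ℝ) : IsCompact {s : ℂ | 0 ≤ s.re ∧ ‖s‖ ≤ r} := by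
  have : {s : ℂ | 0 ≤ s.re ∧ ‖s‖ ≤ r} = Metric.closedBall 0 r ∩ {s | 0 ≤ s.re} := by
    ext s; simp [and_comm]
  rw [this]
  exact (isCompact_closedBall _ _).inter_right (isClosed_le continuous_const continuous_re)

/-- Cauchy's theorem on a half disc for a function that is continuous up to the boundary. -/
theorem integral_axis_eq_of_continuousOn {r r' : ℝ} (hr : 0 < r) (hr' : r < r') {G k : ℂ → ℂ}
    (hGc : ContinuousOn G {s | 0 ≤ s.re ∧ ‖s‖ ≤ r})
    (hG0 : ∀ s : ℂ, 0 ≤ s.re → ‖s‖ ≤ r → G s ≠ 0)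
    (hGd : ∀ s : ℂ, 0 < s.re → ‖s‖ < r → DifferentiableAt ℂ G s)
    (hk : DifferentiableOn ℂ k (Metric.ball 0 r'))
    (hkim : ∀ ω : ℝ, |ω| < r' → (k (ω * I)).im = 0)
    {ℓ : ℝ → ℂ} (hℓ : ContinuousOn ℓ (Icc (-(π / 2)) (π / 2)))
    (hℓe : ∀ θ ∈ Icc (-(π / 2)) (π / 2), exp (ℓ θ) = G (circleMap 0 r θ)) :
    ∫ ω in (-r)..r, Real.log ‖G (ω * I)‖ * (k (ω * I)).re =
      ∫ θ in (-(π / 2))..(π / 2), (ℓ θ * (circleMap 0 r θ * k (circleMap 0 r θ))).re := by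
  have hlogc : ContinuousOn (fun s => Real.log ‖G s‖) {s | 0 ≤ s.re ∧ ‖s‖ ≤ r} :=
    hGc.norm.log fun s hs => norm_ne_zero_iff.2 (hG0 s hs.1 hs.2)
  obtain ⟨B, hB⟩ := (isCompact_halfDisc r).exists_bound_of_continuousOn hlogc
  refine integral_axis_eq_of_subexponential hr hr' (hGc.mono fun s hs => ⟨hs.1, hs.2.2⟩)
    (fun s h1 _ h3 => hG0 s h1 h3) hGd hk hkim
    (ContinuousOn.intervalIntegrable_of_Icc (by linarith) (hlogc.comp
      (by fun_prop : Continuous fun ω : ℝ => (ω * I : ℂ)).continuousOn fun ω hω =>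
        ⟨by simp, by simpa [abs_le] using hω⟩)) (fun η hη => ?_) hℓ hℓe
  refine Eventually.frequently ?_
  have hlim : Tendsto (fun ε : ℝ => ε * |B|) (𝓝[>] 0) (𝓝 0) := by
    have : ContinuousAt (fun ε : ℝ => ε * |B|) 0 := by fun_prop
    simpa using this.tendsto.mono_left (nhdsWithin_le_nhds (s := Ioi 0))
  filter_upwards [hlim.eventually_le_const hη, Ioo_mem_nhdsGT hr] with ε h1 h2 s hs hsε
  refine le_trans ?_ h1
  have := hB s ⟨hs, hsε.trans_le h2.2.le⟩
  rw [Real.norm_eq_abs] at this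
  exact mul_le_mul_of_nonneg_left (this.trans (le_abs_self B)) h2.1.le

/-- Carleman's formula on a half disc, the function being continuous up to the boundary. -/
theorem integral_axis_halfDisc {r : ℝ} (hr : 0 < r) {ι : Type*} (J : Finset ι)
    (a : ι → ℂ) (d : ι → ℕ) (ha : ∀ j ∈ J, 0 < (a j).re ∧ ‖a j‖ < r) {G g : ℂ → ℂ}
    (hG : ∀ s : ℂ, 0 ≤ s.re → ‖s‖ ≤ r →
      G s = (∏ j ∈ J, ((s - a j) / (s + conj (a j))) ^ d j) * g s)
    (hgc : ContinuousOn g {s | 0 ≤ s.re ∧ ‖s‖ ≤ r}) (hg0 : ∀ s : ℂ, 0 ≤ s.re → ‖s‖ ≤ r → g s ≠ 0)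
    (hgd : ∀ s : ℂ, 0 < s.re → ‖s‖ < r → DifferentiableAt ℂ g s)
    {ℓ : ℝ → ℂ} (hℓ : ContinuousOn ℓ (Icc (-(π / 2)) (π / 2)))
    (hℓe : ∀ θ ∈ Icc (-(π / 2)) (π / 2), exp (ℓ θ) = G (circleMap 0 r θ)) :
    ∫ ω in (-r)..r, Real.log ‖G (ω * I)‖ =
      (∫ θ in (-(π / 2))..(π / 2), (ℓ θ * circleMap 0 r θ).re) +
        2 * π * ∑ j ∈ J, d j * (a j).re := by
  have hrr : -r ≤ r := by linarith
  have hax : ∀ ω ∈ Icc (-r) r, 0 ≤ (ω * I : ℂ).re ∧ ‖(ω * I : ℂ)‖ ≤ r := fun ω hω =>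
    ⟨by simp, by simpa [abs_le] using hω⟩
  have key := integral_axis_eq_of_continuousOn (k := 1) (r' := r + 1) hr (by linarith)
    hgc hg0 hgd (differentiableOn_const 1) (by simp)
    (ℓ := fun θ => ℓ θ - ∑ j ∈ J, d j * logBlaschke (a j) r θ)
    (hℓ.sub (continuousOn_finsetSum J fun j hj =>
      continuousOn_const.mul (continuous_logBlaschke (ha j hj).2).continuousOn))
    (fun θ hθ => exp_sub_sum_logBlaschke hr hθ ha ((hℓe θ hθ).trans (hG _
      (circleMap_zero_re_nonneg hr.le hθ) (norm_circleMap_zero_of_nonneg hr.le θ).le)))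
  have h0 := integral_sub_sum_logBlaschke J a d hr (fun j hj => (ha j hj).2) 0 hℓ
  simp only [ofReal_zero, zero_div, add_zero] at h0
  simp only [Pi.one_apply, one_re, mul_one] at key
  rw [← h0, ← key]
  refine intervalIntegral.integral_congr fun ω hω => ?_
  rw [uIcc_of_le hrr] at hω
  rw [hG _ (hax ω hω).1 (hax ω hω).2, norm_mul, norm_prod, Finset.prod_eq_one, one_mul]
  intro j hj
  rw [norm_pow, norm_blaschke_mul_I _ (ha j hj).1, one_pow]

/-! ### The zeros of the sensitivity function -/

/-- What the argument uses of a stable sensitivity function `S`: it is holomorphic in the open right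
half plane with zeros exactly at the `p j`, of orders `d j`, and its singularities on the imaginary
axis are the points of `E` and `y * I`. The `p j` and the points of `E` accumulate at most at
`y * I`. -/
structure IsSensitivity (S : ℂ → ℂ) (p : ℕ → ℂ) (d : ℕ → ℕ) (E : Set ℂ) (y : ℝ) : Prop where
  re_pos : ∀ j, 0 < (p j).re
  apply_eq_zero : ∀ j, S (p j) = 0
  order_eq : ∀ j, analyticOrderAt S (p j) = d j
  injective : Function.Injective p
  re_eq_zero : ∀ q ∈ E, q.re = 0
  differentiableOn : DifferentiableOn ℂ S {s : ℂ | 0 < s.re}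
  continuousOn : ContinuousOn S {s : ℂ | 0 ≤ s.re ∧ s ∉ E ∧ s ≠ y * I}
  ne_zero : ∀ s : ℂ, 0 ≤ s.re → s ∉ range p → s ∉ E → s ≠ y * I → S s ≠ 0
  finite_zeros : ∀ K : Set ℂ, IsCompact K → (y * I : ℂ) ∉ K → {j | p j ∈ K}.Finite
  finite_singular : ∀ K : Set ℂ, IsCompact K → (y * I : ℂ) ∉ K → (E ∩ K).Finite
  growth : ∀ q ∈ insert (y * I : ℂ) E, HasSubexponentialGrowthAt S E q
  locallyIntegrable : LocallyIntegrable (fun ω : ℝ => Real.log ‖S (ω * I)‖)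

theorem analyticAt_of_re_pos {S : ℂ → ℂ} (hS : DifferentiableOn ℂ S {s : ℂ | 0 < s.re}) {s : ℂ}
    (hs : 0 < s.re) : AnalyticAt ℂ S s :=
  hS.analyticAt ((isOpen_lt continuous_const continuous_re).mem_nhds hs)

/-- A pole of `L` of order `d` is a zero of `S = 1 / (1 + L)` of order `d`. -/
theorem analyticOrderAt_eq_of_pole {L S : ℂ → ℂ} {z : ℂ} {n : ℕ} (hn : 0 < n)
    (hS : AnalyticAt ℂ S z) (hL : meromorphicOrderAt L z = ((-(n : ℤ) : ℤ) : WithTop ℤ))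
    (h : ∀ᶠ s in 𝓝[≠] z, S s = 1 / (1 + L s)) : analyticOrderAt S z = n := by
  have hLm : MeromorphicAt L z := by
    by_contra hcon
    rw [meromorphicOrderAt_of_not_meromorphicAt hcon] at hL
    have h0 : (0 : ℤ) = -(n : ℤ) := WithTop.coe_injective hL
    omega
  have h1 : meromorphicOrderAt ((fun _ => (1 : ℂ)) + L) z = ((-(n : ℤ) : ℤ) : WithTop ℤ) := by
    rw [meromorphicOrderAt_add_eq_right_of_lt (MeromorphicAt.const 1 z), hL]
    rw [hL, meromorphicOrderAt_const, if_neg one_ne_zero]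
    have : (-(n : ℤ) : ℤ) < 0 := by omega
    exact_mod_cast this
  have h2 : meromorphicOrderAt S z = ((n : ℤ) : WithTop ℤ) := by
    have h3 : S =ᶠ[𝓝[≠] z] ((fun _ => (1 : ℂ)) + L)⁻¹ := by
      filter_upwards [h] with s hs
      simp [hs]
    rw [meromorphicOrderAt_congr h3, meromorphicOrderAt_inv, h1]
    norm_cast
    simp
  rw [hS.meromorphicOrderAt_eq] at h2
  cases h4 : analyticOrderAt S z with
  | top => rw [h4] at h2; simp at h2
  | coe m =>
    rw [h4, ENat.map_natCast] at h2
    have h5 : (m : ℤ) = n := by exact_mod_cast WithTop.coe_injective h2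
    have : m = n := by exact_mod_cast h5
    rw [this]

theorem finite_preimage_of_accPt {p : ℕ → ℂ} (hp : Function.Injective p) {q : ℂ}
    (h : ∀ z : ℂ, AccPt z (𝓟 (range p)) → z = q) {K : Set ℂ} (hK : IsCompact K) (hq : q ∉ K) :
    {j | p j ∈ K}.Finite := by
  by_contra hinf
  have h1 : (p '' {j | p j ∈ K}).Infinite := Set.Infinite.image hp.injOn hinf
  obtain ⟨x, hx, hacc⟩ := h1.exists_accPt_of_subset_isCompact hK (by rintro _ ⟨j, hj, rfl⟩; exact hj)
  have := h x (hacc.mono (principal_mono.2 (image_subset_range _ _)))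
  exact hq (this ▸ hx)

theorem finite_inter_of_accPt {E : Set ℂ} {q : ℂ} (h : ∀ z : ℂ, AccPt z (𝓟 E) → z = q) {K : Set ℂ}
    (hK : IsCompact K) (hq : q ∉ K) : (E ∩ K).Finite := by
  by_contra hinf
  obtain ⟨x, hx, hacc⟩ := Set.Infinite.exists_accPt_of_subset_isCompact hinf hK inter_subset_right
  have := h x (hacc.mono (principal_mono.2 inter_subset_left))
  exact hq (this ▸ hx)

theorem order_of_isPoleEnumeration {L S : ℂ → ℂ} {p : ℕ → ℂ} {d : ℕ → ℕ} {pstar : ℂ} {E : Set ℂ}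
    (hp : IsPoleEnumeration L p d pstar)
    (hlim : ∀ z : ℂ, AccPt z (𝓟 (range p)) → z = pstar)
    (hE : ∀ q ∈ E, q.re = 0) (hS : IsStableSensitivity L S p E pstar) {j : ℕ}
    (hj : p j ≠ pstar) : analyticOrderAt S (p j) = d j := by
  refine analyticOrderAt_eq_of_pole (hp.order_pos j)
    (analyticAt_of_re_pos hS.differentiableOn (hp.re_pos j)) (hp.order_eq j) ?_
  have h1 : ∀ᶠ s in 𝓝[≠] p j, s ∉ range p := by
    have : ¬ AccPt (p j) (𝓟 (range p)) := fun h => hj (hlim _ h)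
    rw [accPt_iff_frequently] at this
    rw [eventually_nhdsWithin_iff]
    filter_upwards [not_frequently.1 this] with s hs hne hmem using hs ⟨hne, hmem⟩
  have h2 : ∀ᶠ s in 𝓝[≠] p j, 0 < s.re := nhdsWithin_le_nhds
    ((isOpen_lt continuous_const continuous_re).mem_nhds (hp.re_pos j))
  have h3 : ∀ᶠ s in 𝓝[≠] p j, s ≠ pstar := nhdsWithin_le_nhds (isOpen_ne.mem_nhds hj)
  filter_upwards [h1, h2, h3] with s h1 h2 h3
  exact (hS.eq_inv s h2.le h1 (fun h => h2.ne' (hE s h)) h3).2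

/-- The zeros of `S` cannot accumulate inside the half plane, as `S` does not vanish identically. -/
theorem re_pstar_eq_zero {L S : ℂ → ℂ} {p : ℕ → ℂ} {d : ℕ → ℕ} {pstar : ℂ} {E : Set ℂ}
    (hp : IsPoleEnumeration L p d pstar)
    (hlim : ∀ z : ℂ, AccPt z (𝓟 (range p)) ↔ z = pstar)
    (hE : ∀ q ∈ E, q.re = 0) (hS : IsStableSensitivity L S p E pstar) : pstar.re = 0 := by
  have hacc := accPt_iff_frequently.1 ((hlim pstar).2 rfl)
  have hnonneg : 0 ≤ pstar.re := by
    have : ∃ᶠ s in 𝓝 pstar, s ∈ {s : ℂ | 0 ≤ s.re} := hacc.mono (by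
      rintro s ⟨-, j, rfl⟩; exact (hp.re_pos j).le)
    exact (isClosed_le continuous_const continuous_re).mem_of_frequently_of_tendsto this tendsto_id
  by_contra hne
  have hpos : 0 < pstar.re := lt_of_le_of_ne hnonneg (Ne.symm hne)
  have hord : ∀ j, p j ≠ pstar → analyticOrderAt S (p j) = d j := fun j hj =>
    order_of_isPoleEnumeration hp (fun z h => (hlim z).1 h) hE hS hj
  have hz : ∃ᶠ s in 𝓝[≠] pstar, S s = 0 := by
    rw [frequently_nhdsWithin_iff]
    refine hacc.mono ?_
    rintro s ⟨hs, j, rfl⟩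
    refine ⟨?_, hs⟩
    have h1 := hord j hs
    by_contra h0
    rw [analyticOrderAt_eq_zero.2 (Or.inr h0)] at h1
    have := hp.order_pos j
    have h2 : d j = 0 := by exact_mod_cast h1.symm
    omega
  have hconv : IsPreconnected {s : ℂ | 0 < s.re} :=
    (convex_halfSpace_re_gt 0).isPreconnected
  have hzero := AnalyticOnNhd.eqOn_zero_of_preconnected_of_frequently_eq_zero
    (fun s hs => analyticAt_of_re_pos hS.differentiableOn hs) hconv hpos hz
  obtain ⟨s, hs, j, rfl⟩ := hacc.exists
  have htop : analyticOrderAt S (p j) = ⊤ := by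
    rw [analyticOrderAt_eq_top]
    filter_upwards [(isOpen_lt continuous_const continuous_re).mem_nhds (hp.re_pos j)] with s hs
    exact hzero hs
  rw [hord j hs] at htop
  exact ENat.natCast_ne_top _ htop

/-- The facts about the closed loop on which the proof depends; the loop transfer function `L` plays
no further part. -/
theorem isSensitivity_of_loop {L S : ℂ → ℂ} {p : ℕ → ℂ} {d : ℕ → ℕ} {pstar : ℂ} {E : Set ℂ}
    (hp : IsPoleEnumeration L p d pstar)
    (hlim : ∀ z : ℂ, AccPt z (𝓟 (range p)) ↔ z = pstar)
    (hE : ∀ q ∈ E, q.re = 0) (hElim : ∀ z : ℂ, AccPt z (𝓟 E) → z = pstar)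
    (hS : IsStableSensitivity L S p E pstar)
    (hgrowth : ∀ q ∈ insert pstar E, HasSubexponentialGrowthAt S E q)
    (hloc : LocallyIntegrable (bodeIntegrand S)) : IsSensitivity S p d E pstar.im := by
  have hre := re_pstar_eq_zero hp hlim hE hS
  have hy : (pstar.im * I : ℂ) = pstar := by
    apply Complex.ext <;> simp [hre]
  have hne : ∀ j, p j ≠ pstar := fun j h => by
    have := hp.re_pos j; rw [h, hre] at this; exact lt_irrefl _ this
  have hord : ∀ j, analyticOrderAt S (p j) = d j := fun j =>
    order_of_isPoleEnumeration hp (fun z h => (hlim z).1 h) hE hS (hne j)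
  refine ⟨hp.re_pos, fun j => ?_, hord, hp.injective, hE, hS.differentiableOn, ?_, ?_, ?_, ?_, ?_,
    ?_⟩
  · by_contra h0
    have h1 := hord j
    rw [analyticOrderAt_eq_zero.2 (Or.inr h0)] at h1
    have := hp.order_pos j
    have h2 : d j = 0 := by exact_mod_cast h1.symm
    omega
  · rw [hy]; exact hS.continuousOn
  · rw [hy]
    intro s h1 h2 h3 h4
    obtain ⟨h5, h6⟩ := hS.eq_inv s h1 h2 h3 h4
    rw [h6]; exact one_div_ne_zero h5
  · rw [hy]
    exact fun K hK hq => finite_preimage_of_accPt hp.injective (fun z h => (hlim z).1 h) hK hq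
  · rw [hy]
    exact fun K hK hq => finite_inter_of_accPt hElim hK hq
  · rw [hy]; exact hgrowth
  · have h2 : (fun ω : ℝ => Real.log ‖S (ω * I)‖) = (2⁻¹ : ℝ) • bodeIntegrand S := by
      funext ω
      simp [bodeIntegrand, Real.log_pow]
    rw [h2]
    exact hloc.smul _

/-! ### Dividing out zeros -/

theorem exists_eq_pow_mul {U : Set ℂ} (hU : IsOpen U) {f : ℂ → ℂ} (hf : DifferentiableOn ℂ f U)
    {z : ℂ} (hz : z ∈ U) {n : ℕ} (hn : analyticOrderAt f z = n) :
    ∃ g : ℂ → ℂ, DifferentiableOn ℂ g U ∧ (∀ s, f s = (s - z) ^ n * g s) ∧ g z ≠ 0 ∧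
      ∀ s ∈ U, s ≠ z → analyticOrderAt g s = analyticOrderAt f s := by
  have hfz : AnalyticAt ℂ f z := hf.analyticAt (hU.mem_nhds hz)
  obtain ⟨g₁, hg₁, hg₁0, hfg⟩ := (hfz.analyticOrderAt_eq_natCast).1 hn
  set g : ℂ → ℂ := Function.update (fun s => f s / (s - z) ^ n) z (g₁ z) with hg
  have hgz : g z = g₁ z := Function.update_self _ _ _
  have hgs : ∀ s, s ≠ z → g s = f s / (s - z) ^ n := fun s hs => Function.update_of_ne hs _ _
  have hmul : ∀ s, f s = (s - z) ^ n * g s := by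
    intro s
    by_cases hs : s = z
    · rw [hs, hgz]; simpa using hfg.self_of_nhds
    · rw [hgs s hs, mul_div_cancel₀ _ (pow_ne_zero _ (sub_ne_zero.2 hs))]
  have hev : g =ᶠ[𝓝 z] g₁ := by
    filter_upwards [hfg] with s hs
    by_cases h : s = z
    · rw [h, hgz]
    · rw [hgs s h, hs, smul_eq_mul, mul_div_cancel_left₀ _ (pow_ne_zero _ (sub_ne_zero.2 h))]
  have hgd : DifferentiableOn ℂ g U := by
    intro s hs
    by_cases h : s = z
    · rw [h]
      exact (hg₁.differentiableAt.congr_of_eventuallyEq hev).differentiableWithinAt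
    · have h1 : g =ᶠ[𝓝 s] fun s => f s / (s - z) ^ n := by
        filter_upwards [isOpen_ne.mem_nhds h] with w hw using hgs w hw
      have h2 := hf.differentiableAt (hU.mem_nhds hs)
      have h3 : (s - z) ^ n ≠ 0 := pow_ne_zero _ (sub_ne_zero.2 h)
      exact ((h2.div (by fun_prop) h3).congr_of_eventuallyEq h1).differentiableWithinAt
  refine ⟨g, hgd, hmul, by rwa [hgz], fun s hs hsz => ?_⟩
  have h1 : f = (fun s => (s - z) ^ n) * g := funext hmul
  have h2 : AnalyticAt ℂ (fun s : ℂ => (s - z) ^ n) s := by fun_prop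
  have h3 : analyticOrderAt (fun s : ℂ => (s - z) ^ n) s = 0 :=
    analyticOrderAt_eq_zero.2 (Or.inr (pow_ne_zero _ (sub_ne_zero.2 hsz)))
  conv_rhs => rw [h1]
  rw [analyticOrderAt_mul h2 (hgd.analyticAt (hU.mem_nhds hs)), h3, zero_add]

namespace IsSensitivity

variable {S : ℂ → ℂ} {p : ℕ → ℂ} {d : ℕ → ℕ} {E : Set ℂ} {y : ℝ}

theorem notMem_of_re_pos (h : IsSensitivity S p d E y) {s : ℂ} (hs : 0 < s.re) :
    s ∉ E ∧ s ≠ y * I := by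
  refine ⟨fun hE => hs.ne' (h.re_eq_zero s hE), ?_⟩
  rintro rfl
  simp at hs

/-- The zeros `p j` with `j ∈ J` can be divided out of `S`. -/
theorem exists_eq_prod_mul (h : IsSensitivity S p d E y) (J : Finset ℕ) :
    ∃ g : ℂ → ℂ, DifferentiableOn ℂ g {s : ℂ | 0 < s.re} ∧
      (∀ s, S s = (∏ j ∈ J, (s - p j) ^ d j) * g s) ∧ (∀ j ∈ J, g (p j) ≠ 0) ∧
      ∀ s : ℂ, 0 < s.re → (∀ j ∈ J, s ≠ p j) → analyticOrderAt g s = analyticOrderAt S s := by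
  induction J using Finset.induction_on with
  | empty => exact ⟨S, h.differentiableOn, by simp, by simp, fun s _ _ => rfl⟩
  | insert j J hj ih =>
    obtain ⟨g, hgd, hgm, hg0, hgo⟩ := ih
    have hjJ : ∀ i ∈ J, p j ≠ p i := fun i hi hji => hj (h.injective hji ▸ hi)
    obtain ⟨g', hgd', hgm', hg0', hgo'⟩ := exists_eq_pow_mul
      (isOpen_lt continuous_const continuous_re) hgd (h.re_pos j)
      ((hgo _ (h.re_pos j) hjJ).trans (h.order_eq j))
    refine ⟨g', hgd', fun s => ?_, fun i hi => ?_, fun s hs hsJ => ?_⟩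
    · rw [Finset.prod_insert hj, hgm, hgm']; ring
    · rcases Finset.mem_insert.1 hi with rfl | hi
      · exact hg0'
      · intro h0
        exact hg0 i hi (by rw [hgm', h0, mul_zero])
    · rw [hgo' s hs (hsJ j (Finset.mem_insert_self _ _)),
        hgo s hs fun i hi => hsJ i (Finset.mem_insert_of_mem hi)]

/-- Around a centre `c` in the open half plane, `S` is a product of Blaschke factors of the half
plane `Re s > Re c` with a function that does not vanish where `J` exhausts the zeros of `S`. -/
theorem exists_blaschke_factorization (h : IsSensitivity S p d E y) {c : ℂ} (hc : 0 < c.re)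
    (J : Finset ℕ) (hJ : ∀ j ∈ J, 0 < (p j - c).re) :
    ∃ g : ℂ → ℂ, (∀ s : ℂ, 0 ≤ s.re → DifferentiableAt ℂ g s) ∧
      (∀ s : ℂ, 0 ≤ s.re → S (c + s) =
        (∏ j ∈ J, ((s - (p j - c)) / (s + conj (p j - c))) ^ d j) * g s) ∧
      ∀ s : ℂ, 0 ≤ s.re → (∀ j, c + s = p j → j ∈ J) → g s ≠ 0 := by
  obtain ⟨g, hgd, hgm, hg0, -⟩ := h.exists_eq_prod_mul J
  have hden : ∀ s : ℂ, 0 ≤ s.re → ∀ j ∈ J, s + conj (p j - c) ≠ 0 := by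
    intro s hs j hj h0
    have h1 := congrArg re h0
    have h2 := hJ j hj
    simp only [add_re, conj_re, zero_re] at h1
    linarith
  have hpos : ∀ s : ℂ, 0 ≤ s.re → 0 < (c + s).re := fun s hs => by
    rw [add_re]; linarith
  refine ⟨fun s => (∏ j ∈ J, (s + conj (p j - c)) ^ d j) * g (c + s), fun s hs => ?_, fun s hs => ?_,
    fun s hs hsJ => ?_⟩
  · have h1 : DifferentiableAt ℂ g (c + s) := hgd.differentiableAt
      ((isOpen_lt continuous_const continuous_re).mem_nhds (hpos s hs))
    have h2 : DifferentiableAt ℂ (fun s => g (c + s)) s :=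
      DifferentiableAt.comp (f := fun s => c + s) s h1 (by fun_prop)
    refine DifferentiableAt.mul ?_ h2
    exact DifferentiableAt.fun_finsetProd fun j _ => by fun_prop
  · rw [hgm, ← mul_assoc, ← Finset.prod_mul_distrib]
    congr 1
    refine Finset.prod_congr rfl fun j hj => ?_
    rw [div_pow, div_mul_cancel₀ _ (pow_ne_zero _ (hden s hs j hj))]
    congr 1; ring
  · refine mul_ne_zero (Finset.prod_ne_zero_iff.2 fun j hj => pow_ne_zero _ (hden s hs j hj)) ?_
    by_cases hr : c + s ∈ range p
    · obtain ⟨j, hj⟩ := hr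
      rw [← hj]; exact hg0 j (hsJ j hj.symm)
    · have h1 := h.ne_zero (c + s) (hpos s hs).le hr (h.notMem_of_re_pos (hpos s hs)).1
        (h.notMem_of_re_pos (hpos s hs)).2
      intro h0
      exact h1 (by rw [hgm, h0, mul_zero])

/-- Carleman's formula for `S` on a half annulus in the open half plane. -/
theorem integral_vertical_halfAnnulus (h : IsSensitivity S p d E y) {c : ℂ} (hc : 0 < c.re)
    {ε ρ : ℝ} (hε : 0 < ε) (hερ : ε < ρ) (J : Finset ℕ)
    (hJ : ∀ j, j ∈ J ↔ 0 < (p j - c).re ∧ ε < ‖p j - c‖ ∧ ‖p j - c‖ < ρ)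
    (hb : ∀ j, (p j).re ≠ c.re) (hbε : ∀ j, 0 ≤ (p j - c).re → ‖p j - c‖ ≠ ε)
    (hbρ : ∀ j, 0 ≤ (p j - c).re → ‖p j - c‖ ≠ ρ)
    {ℓ : ℝ → ℂ} (hℓ : ContinuousOn ℓ (Icc (-(π / 2)) (π / 2)))
    (hℓe : ∀ θ ∈ Icc (-(π / 2)) (π / 2), exp (ℓ θ) = S (c + circleMap 0 ρ θ)) :
    ∫ ω in ε..ρ, (Real.log ‖S (c + ω * I)‖ + Real.log ‖S (c + -(ω * I))‖) * (1 - ε ^ 2 / ω ^ 2) =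
      (∫ θ in (-(π / 2))..(π / 2),
          (ℓ θ * (circleMap 0 ρ θ + ((ε ^ 2 : ℝ) : ℂ) / circleMap 0 ρ θ)).re) -
        2 * ε * (∫ θ in (-(π / 2))..(π / 2), Real.log ‖S (c + circleMap 0 ε θ)‖ * Real.cos θ) +
        2 * π * ∑ j ∈ J, d j * ((p j - c).re * (1 - ε ^ 2 / ‖p j - c‖ ^ 2)) := by
  obtain ⟨g, hgd, hgm, hg0⟩ := h.exists_blaschke_factorization hc J fun j hj => ((hJ j).1 hj).1
  refine integral_axis_halfAnnulus hε hερ J (fun j => p j - c) d (fun j hj => (hJ j).1 hj)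
    (G := fun s => S (c + s)) (g := g) (fun s hs => hgm s hs.1)
    (fun s hs => (hgd s hs.1).continuousAt.continuousWithinAt) (fun s hs => ?_)
    (fun s h1 _ _ => hgd s h1.le) hℓ hℓe
  refine hg0 s hs.1 fun j hj => (hJ j).2 ?_
  have hs' : p j - c = s := by rw [← hj]; ring
  have h1 := hb j
  have h2 := hbε j
  have h3 := hbρ j
  rw [hs'] at h2 h3 ⊢
  refine ⟨lt_of_le_of_ne hs.1 fun h0 => h1 ?_, lt_of_le_of_ne hs.2.1 (h2 hs.1).symm,
    lt_of_le_of_ne hs.2.2 (h3 hs.1)⟩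
  rw [← hj, add_re, ← h0, add_zero]

/-- Carleman's formula for `S` on a half disc in the open half plane. -/
theorem integral_vertical_halfDisc (h : IsSensitivity S p d E y) {c : ℂ} (hc : 0 < c.re)
    {r : ℝ} (hr : 0 < r) (J : Finset ℕ)
    (hJ : ∀ j, j ∈ J ↔ 0 < (p j - c).re ∧ ‖p j - c‖ < r)
    (hb : ∀ j, (p j).re ≠ c.re) (hbr : ∀ j, 0 ≤ (p j - c).re → ‖p j - c‖ ≠ r)
    {ℓ : ℝ → ℂ} (hℓ : ContinuousOn ℓ (Icc (-(π / 2)) (π / 2)))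
    (hℓe : ∀ θ ∈ Icc (-(π / 2)) (π / 2), exp (ℓ θ) = S (c + circleMap 0 r θ)) :
    ∫ ω in (-r)..r, Real.log ‖S (c + ω * I)‖ =
      (∫ θ in (-(π / 2))..(π / 2), (ℓ θ * circleMap 0 r θ).re) +
        2 * π * ∑ j ∈ J, d j * (p j - c).re := by
  obtain ⟨g, hgd, hgm, hg0⟩ := h.exists_blaschke_factorization hc J fun j hj => ((hJ j).1 hj).1
  refine integral_axis_halfDisc hr J (fun j => p j - c) d (fun j hj => (hJ j).1 hj)
    (G := fun s => S (c + s)) (g := g) (fun s h1 _ => hgm s h1)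
    (fun s hs => (hgd s hs.1).continuousAt.continuousWithinAt) (fun s hs hsr => ?_)
    (fun s h1 _ => hgd s h1.le) hℓ hℓe
  refine hg0 s hs fun j hj => (hJ j).2 ?_
  have hs' : p j - c = s := by rw [← hj]; ring
  have h1 := hb j
  have h3 := hbr j
  rw [hs'] at h3 ⊢
  refine ⟨lt_of_le_of_ne hs fun h0 => h1 ?_, lt_of_le_of_ne hsr (h3 hs)⟩
  rw [← hj, add_re, ← h0, add_zero]

end IsSensitivity

/-! ### Shifting into the open half plane -/

/-- Small shifts `δ > 0` for which no zero of `S` lies on the line `Re s = δ`. -/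
def shiftFilter (p : ℕ → ℂ) : Filter ℝ := 𝓝[>] 0 ⊓ 𝓟 {δ : ℝ | ∀ j, (p j).re ≠ δ}

instance (p : ℕ → ℂ) : (shiftFilter p).NeBot := by
  rw [shiftFilter, inf_principal_neBot_iff]
  intro U hU
  obtain ⟨b, hb, hbU⟩ := mem_nhdsGT_iff_exists_Ioo_subset.1 hU
  have hd : Dense (range fun j => (p j).re)ᶜ := (countable_range _).dense_compl ℝ
  obtain ⟨x, hx, hxd⟩ := hd.inter_open_nonempty _ isOpen_Ioo (nonempty_Ioo.2 (mem_Ioi.1 hb))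
  exact ⟨x, hbU hx, fun j hj => hxd ⟨j, hj⟩⟩

instance (p : ℕ → ℂ) : (shiftFilter p).IsCountablyGenerated := by
  unfold shiftFilter; infer_instance

theorem shiftFilter_le (p : ℕ → ℂ) : shiftFilter p ≤ 𝓝[>] 0 := inf_le_left

theorem eventually_shiftFilter (p : ℕ → ℂ) :
    ∀ᶠ δ in shiftFilter p, 0 < δ ∧ ∀ j, (p j).re ≠ δ :=
  Eventually.and (shiftFilter_le p self_mem_nhdsWithin) (mem_inf_of_right (mem_principal_self _))

/-- The points of the closed right half plane where `S` is continuous and does not vanish. -/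
def regularPoints (p : ℕ → ℂ) (E : Set ℂ) (y : ℝ) : Set ℂ :=
  {s : ℂ | 0 ≤ s.re ∧ s ∉ range p ∧ s ∉ E ∧ s ≠ y * I}

/-- The closed half circle of radius `r` around the point `c` of the imaginary axis. -/
def halfCircle (c : ℂ) (r : ℝ) : Set ℂ := {s : ℂ | 0 ≤ s.re ∧ ‖s - c‖ = r}

theorem isCompact_halfCircle (c : ℂ) (r : ℝ) : IsCompact (halfCircle c r) := by
  have : halfCircle c r = Metric.sphere c r ∩ {s | 0 ≤ s.re} := by
    ext s; simp [halfCircle, and_comm]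
  rw [this]
  exact (isCompact_sphere _ _).inter_right (isClosed_le continuous_const continuous_re)

theorem add_circleMap_mem_halfCircle {c : ℂ} (hc : c.re = 0) {r θ : ℝ} (hr : 0 ≤ r)
    (hθ : θ ∈ Icc (-(π / 2)) (π / 2)) : c + circleMap 0 r θ ∈ halfCircle c r :=
  ⟨by rw [add_re, hc, zero_add]; exact circleMap_zero_re_nonneg hr hθ,
    by rw [add_sub_cancel_left, norm_circleMap_zero_of_nonneg hr]⟩

theorem neg_pi_div_two_le : -(π / 2) ≤ π / 2 := by linarith [Real.pi_pos]

theorem norm_log_le_of_norm_sub_one_le {w : ℂ} {η : ℝ} (hw : ‖w - 1‖ ≤ η) (hη : η ≤ 1 / 2) :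
    w ∈ slitPlane ∧ ‖log w‖ ≤ 3 / 2 * η := by
  have h1 : w = 1 + (w - 1) := by ring
  constructor
  · rw [h1]; exact one_add_mem_slitPlane (by linarith)
  · rw [h1]
    exact (norm_log_one_add_half_le_self (hw.trans hη)).trans (by linarith)

namespace IsSensitivity

variable {S : ℂ → ℂ} {p : ℕ → ℂ} {d : ℕ → ℕ} {E : Set ℂ} {y : ℝ}

theorem ne_zero_of_regular (h : IsSensitivity S p d E y) {s : ℂ} (hs : s ∈ regularPoints p E y) :
    S s ≠ 0 := h.ne_zero s hs.1 hs.2.1 hs.2.2.1 hs.2.2.2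

theorem continuousOn_regular (h : IsSensitivity S p d E y) :
    ContinuousOn S (regularPoints p E y) :=
  h.continuousOn.mono fun _ hs => ⟨hs.1, hs.2.2.1, hs.2.2.2⟩

theorem continuousOn_re_pos (h : IsSensitivity S p d E y) : ContinuousOn S {s : ℂ | 0 < s.re} :=
  h.differentiableOn.continuousOn

/-- `S (s + δ)` is close to `S s`, uniformly for `s` in a compact set of regular points. -/
theorem eventually_norm_div_sub_one_le (h : IsSensitivity S p d E y) {K : Set ℂ} (hK : IsCompact K)
    (hKr : K ⊆ regularPoints p E y) {η : ℝ} (hη : 0 < η) :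
    ∀ᶠ δ : ℝ in 𝓝[>] 0, ∀ s ∈ K, ‖S (s + δ) / S s - 1‖ ≤ η := by
  set T : Set (ℝ × ℂ) := {x | 0 ≤ x.1 ∧ x.2 ∈ K} with hT
  have hc : ContinuousOn (fun x : ℝ × ℂ => S (x.2 + x.1) / S x.2) T := by
    refine ContinuousOn.div (h.continuousOn.comp (by fun_prop) ?_)
      (h.continuousOn_regular.comp continuous_snd.continuousOn fun x hx => hKr hx.2)
      fun x hx => h.ne_zero_of_regular (hKr hx.2)
    intro x hx
    have hr := hKr hx.2
    rcases hx.1.eq_or_lt with h0 | h0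
    · simp only [← h0, ofReal_zero, add_zero]; exact ⟨hr.1, hr.2.2.1, hr.2.2.2⟩
    · have hpos : 0 < (x.2 + (x.1 : ℂ)).re := by
        rw [add_re, ofReal_re]; linarith [hr.1]
      exact ⟨hpos.le, h.notMem_of_re_pos hpos⟩
  have key : ∀ᶠ δ : ℝ in 𝓝 0, ∀ s ∈ K, 0 ≤ δ → s ∈ K → ‖S (s + δ) / S s - 1‖ ≤ η := by
    refine hK.eventually_forall_of_forall_eventually fun s hs => ?_
    have h0 : ((0 : ℝ), s) ∈ T := ⟨le_refl _, hs⟩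
    have h1 : Tendsto (fun x : ℝ × ℂ => ‖S (x.2 + x.1) / S x.2 - 1‖) (𝓝[T] (0, s)) (𝓝 0) := by
      have h2 := (((hc _ h0).sub continuousWithinAt_const).norm (f := fun x : ℝ × ℂ =>
        S (x.2 + x.1) / S x.2 - 1)).tendsto
      simpa [div_self (h.ne_zero_of_regular (hKr hs))] using h2
    have h3 := h1.eventually_le_const hη
    rw [eventually_nhdsWithin_iff] at h3
    filter_upwards [h3] with x hx h4 h5 using hx ⟨h4, h5⟩
  filter_upwards [nhdsWithin_le_nhds key, self_mem_nhdsWithin] with δ h1 h2 s hs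
  exact h1 s hs (le_of_lt h2) hs

/-- A branch of `log S` on a half circle extends continuously to the shifted half circles. -/
theorem exists_branch_shift (h : IsSensitivity S p d E y) {c : ℂ} (hc : c.re = 0) {r : ℝ}
    (hr : 0 < r) (hcr : halfCircle c r ⊆ regularPoints p E y) {ℓ : ℝ → ℂ}
    (hℓ : ContinuousOn ℓ (Icc (-(π / 2)) (π / 2)))
    (hℓe : ∀ θ ∈ Icc (-(π / 2)) (π / 2), exp (ℓ θ) = S (c + circleMap 0 r θ)) :
    ∃ m : ℝ → ℝ → ℂ, (∀ᶠ δ : ℝ in 𝓝[>] 0, ContinuousOn (m δ) (Icc (-(π / 2)) (π / 2)) ∧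
        ∀ θ ∈ Icc (-(π / 2)) (π / 2), exp (m δ θ) = S (c + δ + circleMap 0 r θ)) ∧
      ∀ w : ℝ → ℂ, ContinuousOn w (Icc (-(π / 2)) (π / 2)) →
        Tendsto (fun δ => ∫ θ in (-(π / 2))..(π / 2), (m δ θ * w θ).re) (𝓝[>] 0)
          (𝓝 (∫ θ in (-(π / 2))..(π / 2), (ℓ θ * w θ).re)) := by
  have hmem : ∀ θ ∈ Icc (-(π / 2)) (π / 2), c + circleMap 0 r θ ∈ halfCircle c r :=
    fun θ hθ => add_circleMap_mem_halfCircle hc hr.le hθ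
  set m : ℝ → ℝ → ℂ := fun δ θ =>
    ℓ θ + log (S (c + circleMap 0 r θ + δ) / S (c + circleMap 0 r θ)) with hm
  have hev := h.eventually_norm_div_sub_one_le (isCompact_halfCircle c r) hcr
    (show (0 : ℝ) < 1 / 2 by norm_num)
  have hmc : ∀ᶠ δ : ℝ in 𝓝[>] 0, ContinuousOn (m δ) (Icc (-(π / 2)) (π / 2)) := by
    filter_upwards [hev, self_mem_nhdsWithin] with δ h1 h2
    refine hℓ.add (ContinuousOn.clog (ContinuousOn.div ?_ ?_ ?_) ?_)
    · refine h.continuousOn_re_pos.comp (by fun_prop) fun θ hθ => ?_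
      have h3 := (hmem θ hθ).1
      have h4 : 0 < δ := h2
      simp only [mem_ofPred_eq, add_re, ofReal_re] at h3 ⊢
      linarith
    · exact h.continuousOn_regular.comp (by fun_prop) fun θ hθ => hcr (hmem θ hθ)
    · exact fun θ hθ => h.ne_zero_of_regular (hcr (hmem θ hθ))
    · exact fun θ hθ => (norm_log_le_of_norm_sub_one_le (h1 _ (hmem θ hθ)) le_rfl).1
  refine ⟨m, ?_, fun w hw => ?_⟩
  · filter_upwards [hmc, hev] with δ h1 h2
    refine ⟨h1, fun θ hθ => ?_⟩
    have h3 := (norm_log_le_of_norm_sub_one_le (h2 _ (hmem θ hθ)) le_rfl).1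
    simp only [hm]
    rw [exp_add, exp_log (slitPlane_ne_zero h3), hℓe θ hθ,
      mul_div_cancel₀ _ (h.ne_zero_of_regular (hcr (hmem θ hθ)))]
    congr 1; ring
  · refine intervalIntegral.tendsto_integral_filter_of_dominated_convergence
      (fun θ => (‖ℓ θ‖ + 1) * ‖w θ‖) ?_ ?_ ?_ ?_
    · filter_upwards [hmc] with δ h1
      rw [uIoc_of_le neg_pi_div_two_le]
      exact ((continuous_re.comp_continuousOn (h1.mul hw)).mono
        Ioc_subset_Icc_self).aestronglyMeasurable measurableSet_Ioc
    · filter_upwards [hev] with δ h1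
      refine Eventually.of_forall fun θ hθ => ?_
      rw [uIoc_of_le neg_pi_div_two_le] at hθ
      rw [Real.norm_eq_abs]
      refine (abs_re_le_norm _).trans ?_
      rw [norm_mul]
      gcongr
      refine (norm_add_le _ _).trans ?_
      have h2 := (norm_log_le_of_norm_sub_one_le (h1 _ (hmem θ (Ioc_subset_Icc_self hθ))) le_rfl).2
      linarith
    · exact ContinuousOn.intervalIntegrable_of_Icc neg_pi_div_two_le
        ((hℓ.norm.add continuousOn_const).mul hw.norm)
    · refine Eventually.of_forall fun θ hθ => ?_
      rw [uIoc_of_le neg_pi_div_two_le] at hθ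
      have h1 : Tendsto (fun δ : ℝ => log (S (c + circleMap 0 r θ + δ) / S (c + circleMap 0 r θ)))
          (𝓝[>] 0) (𝓝 0) := by
        rw [Metric.tendsto_nhds]
        intro η hη
        filter_upwards [h.eventually_norm_div_sub_one_le (isCompact_halfCircle c r) hcr
          (show (0 : ℝ) < min (1 / 2) (η / 2) by positivity)] with δ h2
        have h3 := (norm_log_le_of_norm_sub_one_le (h2 _ (hmem θ (Ioc_subset_Icc_self hθ)))
          (min_le_left _ _)).2
        rw [dist_zero_right]
        linarith [min_le_right (1 / 2) (η / 2)]
      have h2 : Tendsto (fun δ => (m δ θ * w θ).re) (𝓝[>] 0) (𝓝 ((ℓ θ + 0) * w θ).re) :=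
        (continuous_re.tendsto _).comp ((tendsto_const_nhds.add h1).mul_const _)
      rwa [add_zero] at h2

theorem eventually_ne_radius (h : IsSensitivity S p d E y) {c : ℂ}
    (hc : c.re = 0) {r : ℝ} (hcr : halfCircle c r ⊆ regularPoints p E y) :
    ∀ᶠ δ : ℝ in 𝓝[>] 0, ∀ j, 0 ≤ (p j - (c + δ)).re → ‖p j - (c + δ)‖ ≠ r := by
  filter_upwards [h.eventually_norm_div_sub_one_le (isCompact_halfCircle c r) hcr
    (show (0 : ℝ) < 1 / 2 by norm_num)] with δ h1 j h2 h3
  have h4 := h1 (p j - δ) ⟨by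
    simp only [sub_re, add_re, ofReal_re, hc] at h2 ⊢; linarith, by rw [← h3]; congr 1; ring⟩
  rw [sub_add_cancel, h.apply_eq_zero j, zero_div, zero_sub, norm_neg, norm_one] at h4
  norm_num at h4

theorem exists_branch (h : IsSensitivity S p d E y) {c : ℂ} (hc : c.re = 0) {r : ℝ}
    (hr : 0 < r) (hcr : halfCircle c r ⊆ regularPoints p E y) :
    ∃ ℓ : ℝ → ℂ, ContinuousOn ℓ (Icc (-(π / 2)) (π / 2)) ∧
      ∀ θ ∈ Icc (-(π / 2)) (π / 2), exp (ℓ θ) = S (c + circleMap 0 r θ) :=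
  exists_continuousOn_log_Icc neg_pi_div_two_le
    (h.continuousOn_regular.comp (by fun_prop) fun _ hθ =>
      hcr (add_circleMap_mem_halfCircle hc hr.le hθ))
    fun _ hθ => h.ne_zero_of_regular (hcr (add_circleMap_mem_halfCircle hc hr.le hθ))

/-! ### Convergence of integrals along vertical segments -/

theorem intervalIntegrable_mul (h : IsSensitivity S p d E y) {φ : ℝ → ℝ} {a b : ℝ} (hab : a ≤ b)
    (hφ : ContinuousOn φ (Icc a b)) :
    IntervalIntegrable (fun ω => Real.log ‖S (ω * I)‖ * φ ω) volume a b := by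
  refine IntervalIntegrable.mul_continuousOn ?_ (by rwa [uIcc_of_le hab])
  exact (h.locallyIntegrable.integrableOn_isCompact isCompact_uIcc).intervalIntegrable

theorem continuous_log_norm_shift (h : IsSensitivity S p d E y) {δ : ℝ} (hδ : 0 < δ)
    (hδp : ∀ j, (p j).re ≠ δ) : Continuous fun ω : ℝ => Real.log ‖S (δ + ω * I)‖ := by
  have hpos : ∀ ω : ℝ, 0 < (δ + ω * I : ℂ).re := fun ω => by simpa using hδ
  refine Continuous.log (continuous_norm.comp
    (h.continuousOn_re_pos.comp_continuous (by fun_prop) hpos)) fun ω => norm_ne_zero_iff.2 ?_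
  refine h.ne_zero _ (hpos ω).le ?_ (h.notMem_of_re_pos (hpos ω)).1 (h.notMem_of_re_pos (hpos ω)).2
  rintro ⟨j, hj⟩
  exact hδp j (by rw [hj]; simp)

theorem intervalIntegrable_shift_mul (h : IsSensitivity S p d E y) {δ : ℝ} (hδ : 0 < δ)
    (hδp : ∀ j, (p j).re ≠ δ) {φ : ℝ → ℝ} {a b : ℝ} (hab : a ≤ b)
    (hφ : ContinuousOn φ (Icc a b)) :
    IntervalIntegrable (fun ω => Real.log ‖S (δ + ω * I)‖ * φ ω) volume a b :=
  ContinuousOn.intervalIntegrable_of_Icc hab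
    ((h.continuous_log_norm_shift hδ hδp).continuousOn.mul hφ)

end IsSensitivity

/-- The integral of `log |S(δ + iω)|` over `[a, b]` with weight `φ` tends to that of
`log |S(iω)|` as `δ → 0`. -/
def AxisConvergence (S : ℂ → ℂ) (p : ℕ → ℂ) (φ : ℝ → ℝ) (a b : ℝ) : Prop :=
  Tendsto (fun δ : ℝ => ∫ ω in a..b, Real.log ‖S (δ + ω * I)‖ * φ ω) (shiftFilter p)
    (𝓝 (∫ ω in a..b, Real.log ‖S (ω * I)‖ * φ ω))

namespace IsSensitivity

variable {S : ℂ → ℂ} {p : ℕ → ℂ} {d : ℕ → ℕ} {E : Set ℂ} {y : ℝ}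

theorem axisConvergence_trans (h : IsSensitivity S p d E y) {φ : ℝ → ℝ} {a b c : ℝ} (hab : a ≤ b)
    (hbc : b ≤ c) (hφ : ContinuousOn φ (Icc a c)) (h1 : AxisConvergence S p φ a b)
    (h2 : AxisConvergence S p φ b c) : AxisConvergence S p φ a c := by
  have hφ1 : ContinuousOn φ (Icc a b) := hφ.mono (Icc_subset_Icc_right hbc)
  have hφ2 : ContinuousOn φ (Icc b c) := hφ.mono (Icc_subset_Icc_left hab)
  have h3 := Tendsto.add h1 h2
  rw [intervalIntegral.integral_add_adjacent_intervals (h.intervalIntegrable_mul hab hφ1)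
    (h.intervalIntegrable_mul hbc hφ2)] at h3
  refine h3.congr' ?_
  filter_upwards [eventually_shiftFilter p] with δ hδ
  exact intervalIntegral.integral_add_adjacent_intervals
    (h.intervalIntegrable_shift_mul hδ.1 hδ.2 hab hφ1)
    (h.intervalIntegrable_shift_mul hδ.1 hδ.2 hbc hφ2)

theorem axisConvergence_of_regular (h : IsSensitivity S p d E y) {φ : ℝ → ℝ} {a b : ℝ}
    (hab : a ≤ b) (hφ : ContinuousOn φ (Icc a b))
    (hreg : ∀ ω ∈ Icc a b, (ω * I : ℂ) ∈ regularPoints p E y) : AxisConvergence S p φ a b := by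
  set K : Set ℂ := (fun ω : ℝ => (ω * I : ℂ)) '' Icc a b with hK
  have hKc : IsCompact K := isCompact_Icc.image (by fun_prop)
  have hKr : K ⊆ regularPoints p E y := by rintro _ ⟨ω, hω, rfl⟩; exact hreg ω hω
  have hKm : ∀ ω ∈ Icc a b, (ω * I : ℂ) ∈ K := fun ω hω => ⟨ω, hω, rfl⟩
  have hlog : ContinuousOn (fun ω : ℝ => Real.log ‖S (ω * I)‖) (Icc a b) :=
    (h.continuousOn_regular.comp (by fun_prop : Continuous fun ω : ℝ => (ω * I : ℂ)).continuousOn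
      hreg).norm.log fun ω hω => norm_ne_zero_iff.2 (h.ne_zero_of_regular (hreg ω hω))
  have hdiff : ∀ η : ℝ, 0 < η → η ≤ 1 / 2 → ∀ᶠ δ : ℝ in shiftFilter p, ∀ ω ∈ Icc a b,
      |Real.log ‖S (δ + ω * I)‖ - Real.log ‖S (ω * I)‖| ≤ 3 / 2 * η := by
    intro η hη hη2
    filter_upwards [shiftFilter_le p (h.eventually_norm_div_sub_one_le hKc hKr hη)] with δ h1 ω hω
    have h2 := norm_log_le_of_norm_sub_one_le (h1 _ (hKm ω hω)) hη2
    have h3 := slitPlane_ne_zero h2.1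
    have h4 : S (ω * I) ≠ 0 := h.ne_zero_of_regular (hreg ω hω)
    have h5 : S (ω * I + δ) ≠ 0 := fun h0 => h3 (by rw [h0, zero_div])
    rw [add_comm (δ : ℂ), ← Real.log_div (norm_ne_zero_iff.2 h5) (norm_ne_zero_iff.2 h4),
      ← norm_div, ← log_re]
    exact (abs_re_le_norm _).trans h2.2
  refine intervalIntegral.tendsto_integral_filter_of_dominated_convergence
    (fun ω => (|Real.log ‖S (ω * I)‖| + 1) * |φ ω|) ?_ ?_ ?_ ?_
  · filter_upwards [eventually_shiftFilter p] with δ hδ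
    rw [uIoc_of_le hab]
    exact (h.intervalIntegrable_shift_mul hδ.1 hδ.2 hab hφ).1.aestronglyMeasurable
  · filter_upwards [hdiff (1 / 2) (by norm_num) le_rfl] with δ h1
    refine Eventually.of_forall fun ω hω => ?_
    rw [uIoc_of_le hab] at hω
    rw [norm_mul, Real.norm_eq_abs, Real.norm_eq_abs]
    gcongr
    have h2 := h1 ω (Ioc_subset_Icc_self hω)
    have h3 := abs_sub_abs_le_abs_sub (Real.log ‖S (δ + ω * I)‖) (Real.log ‖S (ω * I)‖)
    linarith
  · exact ContinuousOn.intervalIntegrable_of_Icc hab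
      ((hlog.abs.add continuousOn_const).mul hφ.abs)
  · refine Eventually.of_forall fun ω hω => Tendsto.mul_const _ ?_
    rw [uIoc_of_le hab] at hω
    rw [Metric.tendsto_nhds]
    intro η hη
    filter_upwards [hdiff (min (1 / 2) (η / 2)) (by positivity) (min_le_left _ _)] with δ h1
    rw [Real.dist_eq]
    linarith [h1 ω (Ioc_subset_Icc_self hω), min_le_right (1 / 2) (η / 2)]

end IsSensitivity

/-! ### Singular points on the axis -/

/-- Holomorphic weights `k` away from `y * I` that are real on the imaginary axis. -/
structure IsAxisWeight (k : ℂ → ℂ) (y : ℝ) : Prop where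
  differentiableAt : ∀ s : ℂ, s ≠ y * I → DifferentiableAt ℂ k s
  im_eq_zero : ∀ ω : ℝ, ω ≠ y → (k (ω * I)).im = 0

theorem IsAxisWeight.continuousOn {k : ℂ → ℂ} {y a b : ℝ} (hk : IsAxisWeight k y)
    (hy : y ∉ Icc a b) : ContinuousOn (fun ω : ℝ => (k (ω * I)).re) (Icc a b) := by
  intro ω hω
  have h1 : (ω * I : ℂ) ≠ y * I := by
    intro h0
    have : ω = y := by simpa using congrArg im h0
    exact hy (this ▸ hω)
  exact (continuous_re.continuousAt.comp (ContinuousAt.comp (f := fun ω : ℝ => (ω * I : ℂ))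
    (hk.differentiableAt _ h1).continuousAt (by fun_prop))).continuousWithinAt

namespace IsSensitivity

variable {S : ℂ → ℂ} {p : ℕ → ℂ} {d : ℕ → ℕ} {E : Set ℂ} {y : ℝ}

/-- A point of `E` other than `y * I` is isolated from the zeros and the other singularities. -/
theorem exists_regular_nhds (h : IsSensitivity S p d E y) {η : ℝ} (hη : η ≠ y) :
    ∃ r₀ > 0, r₀ < |η - y| ∧ ∀ s : ℂ, 0 ≤ s.re → s ≠ η * I → ‖s - η * I‖ < r₀ →
      s ∈ regularPoints p E y := by
  set c : ℂ := η * I with hc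
  have hcy : ‖(y * I : ℂ) - c‖ = |η - y| := by
    rw [hc, ← sub_mul, norm_mul, norm_I, mul_one, ← ofReal_sub, norm_real, Real.norm_eq_abs,
      abs_sub_comm]
  have hpos : 0 < |η - y| := abs_pos.2 (sub_ne_zero.2 hη)
  set K : Set ℂ := Metric.closedBall c (|η - y| / 2) with hK
  have hKc : IsCompact K := isCompact_closedBall _ _
  have hyK : (y * I : ℂ) ∉ K := by
    rw [hK, Metric.mem_closedBall, dist_eq_norm, hcy]; linarith
  set F : Set ℂ := ((E ∩ K) ∪ p '' {j | p j ∈ K}) \ {c} with hF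
  have hFf : F.Finite :=
    ((h.finite_singular K hKc hyK).union ((h.finite_zeros K hKc hyK).image p)).subset sdiff_subset
  obtain ⟨r, hr, hrF⟩ := Metric.isOpen_iff.1 hFf.isClosed.isOpen_compl c (by simp [hF])
  refine ⟨min r (|η - y| / 2), by positivity, (min_le_right _ _).trans_lt (by linarith),
    fun s hs hsc hsr => ?_⟩
  have h1 : s ∉ F := hrF (by
    rw [Metric.mem_ball, dist_eq_norm]; exact hsr.trans_le (min_le_left _ _))
  have h2 : s ∈ K := by
    rw [hK, Metric.mem_closedBall, dist_eq_norm]; exact (hsr.trans_le (min_le_right _ _)).le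
  refine ⟨hs, ?_, fun hE => h1 ⟨Or.inl ⟨hE, h2⟩, hsc⟩, ?_⟩
  · rintro ⟨j, rfl⟩
    exact h1 ⟨Or.inr ⟨j, h2, rfl⟩, hsc⟩
  · rintro rfl; exact hyK h2

/-- At a point of `E` other than `y * I` there is no mass in the limit: both the integral along the
axis and that along the shifted axis are given by the same arc integral. -/
theorem axisConvergence_near_singular (h : IsSensitivity S p d E y) {k : ℂ → ℂ}
    (hk : IsAxisWeight k y) {η : ℝ} (hηE : (η * I : ℂ) ∈ E) {r₀ : ℝ} (hr₀ : r₀ < |η - y|)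
    (hreg : ∀ s : ℂ, 0 ≤ s.re → s ≠ η * I → ‖s - η * I‖ < r₀ → s ∈ regularPoints p E y)
    {r : ℝ} (hr : 0 < r) (hrr : 2 * r < r₀) :
    AxisConvergence S p (fun ω => (k (ω * I)).re) (η - r) (η + r) := by
  set c : ℂ := η * I with hc
  have hcre : c.re = 0 := by simp [hc]
  have hyI : y ∉ Icc (η - r) (η + r) := by
    intro hy
    have : |η - y| ≤ r := abs_le.2 ⟨by linarith [hy.2], by linarith [hy.1]⟩
    linarith
  have hcircle : halfCircle c r ⊆ regularPoints p E y := by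
    intro s hs
    refine hreg s hs.1 ?_ (by rw [hs.2]; linarith)
    rintro rfl
    have := hs.2
    rw [sub_self, norm_zero] at this
    linarith
  obtain ⟨ℓ, hℓ, hℓe⟩ := h.exists_branch hcre hr hcircle
  obtain ⟨m, hm, hmt⟩ := h.exists_branch_shift hcre hr hcircle hℓ hℓe
  have hkne : ∀ s : ℂ, ‖s‖ < r₀ → c + s ≠ y * I := by
    intro s hs h0
    have h1 : s = ((y - η : ℝ) : ℂ) * I := by
      rw [← add_sub_cancel_left c s, h0, hc]; push_cast; ring
    rw [h1, norm_mul, norm_I, mul_one, norm_real, Real.norm_eq_abs, abs_sub_comm] at hs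
    linarith
  have hkd : DifferentiableOn ℂ (fun s => k (c + s)) (Metric.ball 0 r₀) := by
    intro s hs
    have h1 := hk.differentiableAt (c + s) (hkne s (by simpa using hs))
    exact (DifferentiableAt.comp (f := fun s => c + s) s h1 (by fun_prop)).differentiableWithinAt
  have hadd : ∀ ω : ℝ, c + ω * I = ((η + ω : ℝ) : ℂ) * I := fun ω => by
    rw [hc]; push_cast; ring
  have hkim : ∀ ω : ℝ, |ω| < r₀ → (k (c + ω * I)).im = 0 := by
    intro ω hω
    rw [hadd]
    refine hk.im_eq_zero _ ?_
    rintro rfl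
    rw [sub_add_cancel_left, abs_neg] at hr₀
    linarith
  have hkc : ContinuousOn (fun θ => k (c + circleMap 0 r θ)) (Icc (-(π / 2)) (π / 2)) :=
    hkd.continuousOn.comp (continuous_circleMap 0 r).continuousOn fun θ _ => by
      rw [mem_ball_zero_iff, norm_circleMap_zero_of_nonneg hr.le]; linarith
  have hregr : ∀ s : ℂ, 0 ≤ s.re → s ≠ 0 → ‖s‖ ≤ r → c + s ∈ regularPoints p E y :=
    fun s h1 h2 h3 => hreg _ (by rw [add_re, hcre, zero_add]; exact h1)
      (by simpa using h2) (by rw [add_sub_cancel_left]; linarith)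
  have hdiff : ∀ s : ℂ, 0 < s.re → DifferentiableAt ℂ S s := fun s hs =>
    h.differentiableOn.differentiableAt ((isOpen_lt continuous_const continuous_re).mem_nhds hs)
  have hcomp : ∀ f : ℝ → ℝ, ∫ ω in (η - r)..(η + r), f ω = ∫ ω in (-r)..r, f (η + ω) := by
    intro f
    rw [intervalIntegral.integral_comp_add_left, sub_eq_add_neg]
  have hlim : ∫ ω in (η - r)..(η + r), Real.log ‖S (ω * I)‖ * (k (ω * I)).re =
      ∫ θ in (-(π / 2))..(π / 2),
        (ℓ θ * (circleMap 0 r θ * k (c + circleMap 0 r θ))).re := by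
    rw [hcomp]
    simp only [← hadd]
    refine integral_axis_eq_of_subexponential (G := fun s => S (c + s)) (k := fun s => k (c + s))
      hr (by linarith : r < r₀) ?_ ?_ ?_ hkd hkim ?_ ?_ hℓ hℓe
    · exact h.continuousOn_regular.comp (by fun_prop) fun s hs => hregr s hs.1 hs.2.1 hs.2.2
    · exact fun s h1 h2 h3 => h.ne_zero_of_regular (hregr s h1 h2 h3)
    · intro s hs _
      exact DifferentiableAt.comp (f := fun s => c + s) s
        (hdiff _ (by rw [add_re, hcre, zero_add]; exact hs)) (by fun_prop)
    · have h1 := h.intervalIntegrable_mul (a := η - r) (b := η + r) (φ := fun _ => 1)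
        (by linarith) continuousOn_const
      have h2 := h1.comp_add_left η
      simp only [mul_one, ← hadd] at h2
      rwa [show η - r - η = -r by ring, show η + r - η = r by ring] at h2
    · intro κ hκ
      refine (h.growth c (mem_insert_of_mem _ hηE) κ hκ).mono fun ε hε s hs hsε => ?_
      exact (hε (c + s) (by rw [add_re, hcre, zero_add]; exact hs)
        (by rw [add_sub_cancel_left]; exact hsε)).2.2
  rw [AxisConvergence, hlim]
  refine ((hmt _ ((continuous_circleMap 0 r).continuousOn.mul hkc)).mono_left
    (shiftFilter_le p)).congr' ?_
  filter_upwards [shiftFilter_le p hm, shiftFilter_le p (Ioo_mem_nhdsGT hr)] with δ h1 h2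
  rw [hcomp]
  have hre : ∀ s : ℂ, 0 ≤ s.re → 0 < (c + δ + s).re := fun s hs => by
    simp only [add_re, hcre, ofReal_re, zero_add]; linarith [h2.1]
  have hadd' : ∀ ω : ℝ, (δ : ℂ) + ((η + ω : ℝ) : ℂ) * I = c + δ + ω * I := fun ω => by
    rw [← hadd]; ring
  simp only [hadd']
  simp only [← hadd]
  symm
  refine integral_axis_eq_of_continuousOn (G := fun s => S (c + δ + s)) (k := fun s => k (c + s))
    hr (by linarith : r < r₀) ?_ ?_ ?_ hkd hkim h1.1 h1.2
  · exact h.continuousOn_re_pos.comp (by fun_prop) fun s hs => hre s hs.1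
  · intro s hs hsr
    refine h.ne_zero_of_regular (hreg _ (hre s hs).le ?_ ?_)
    · intro h0
      have := hre s hs
      rw [h0, hcre] at this
      exact lt_irrefl _ this
    · rw [show c + δ + s - c = δ + s by ring]
      refine (norm_add_le _ _).trans_lt ?_
      rw [norm_real, Real.norm_eq_abs, abs_of_pos h2.1]
      linarith [h2.2]
  · intro s hs _
    exact DifferentiableAt.comp (f := fun s => c + δ + s) s (hdiff _ (hre s hs.le)) (by fun_prop)

/-- Convergence on every segment that avoids `y * I` and whose endpoints are not singular, by
induction on the number of singular points in it. -/
theorem axisConvergence_of_notMem (h : IsSensitivity S p d E y) {k : ℂ → ℂ}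
    (hk : IsAxisWeight k y) {a b : ℝ} (hab : a ≤ b) (hy : y ∉ Icc a b) (ha : (a * I : ℂ) ∉ E)
    (hb : (b * I : ℂ) ∉ E) : AxisConvergence S p (fun ω => (k (ω * I)).re) a b := by
  have hfin : ∀ a b : ℝ, y ∉ Icc a b → {ω : ℝ | ω ∈ Icc a b ∧ (ω * I : ℂ) ∈ E}.Finite := by
    intro a b hy
    have hK : IsCompact ((fun ω : ℝ => (ω * I : ℂ)) '' Icc a b) :=
      isCompact_Icc.image (by fun_prop)
    have hinj : Function.Injective fun ω : ℝ => (ω * I : ℂ) := fun x z hxz => by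
      simpa using hxz
    have h1 := h.finite_singular _ hK (by rintro ⟨ω, hω, h0⟩; exact hy (hinj h0 ▸ hω))
    exact (h1.preimage hinj.injOn).subset fun ω hω => ⟨hω.2, ω, hω.1, rfl⟩
  obtain ⟨n, hn⟩ : ∃ n, {ω : ℝ | ω ∈ Icc a b ∧ (ω * I : ℂ) ∈ E}.ncard ≤ n := ⟨_, le_rfl⟩
  induction n generalizing a b with
  | zero =>
    refine h.axisConvergence_of_regular hab (hk.continuousOn hy) fun ω hω => ?_
    have hempty := (Set.ncard_eq_zero (hfin a b hy)).1 (Nat.le_zero.1 hn)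
    refine ⟨by simp, ?_, fun hE => ?_, fun h0 => ?_⟩
    · rintro ⟨j, hj⟩
      have := h.re_pos j
      rw [hj] at this; simp at this
    · exact eq_empty_iff_forall_notMem.1 hempty ω ⟨hω, hE⟩
    · have : ω = y := by simpa using h0
      exact hy (this ▸ hω)
  | succ n ih =>
    by_cases hempty : {ω : ℝ | ω ∈ Icc a b ∧ (ω * I : ℂ) ∈ E} = ∅
    · exact ih hab hy ha hb (by rw [hempty, ncard_empty]; exact Nat.zero_le n)
    obtain ⟨η, hη, hηE⟩ := nonempty_iff_ne_empty.2 hempty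
    have hηa : a < η := lt_of_le_of_ne hη.1 (by rintro rfl; exact ha hηE)
    have hηb : η < b := lt_of_le_of_ne hη.2 (by rintro rfl; exact hb hηE)
    have hηy : η ≠ y := by rintro rfl; exact hy hη
    obtain ⟨r₀, hr₀, hr₀y, hreg⟩ := h.exists_regular_nhds hηy
    obtain ⟨r, hr, hrr⟩ := exists_between
      (show 0 < min (r₀ / 2) (min (η - a) (b - η)) from lt_min (by linarith)
        (lt_min (by linarith) (by linarith)))
    have hr1 : 2 * r < r₀ := by linarith [hrr.trans_le (min_le_left _ _)]
    have hr2 : r < η - a := hrr.trans_le ((min_le_right _ _).trans (min_le_left _ _))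
    have hr3 : r < b - η := hrr.trans_le ((min_le_right _ _).trans (min_le_right _ _))
    have hnotE : ∀ t : ℝ, |t| = r → ((η + t : ℝ) * I : ℂ) ∉ E := by
      intro t ht
      have h1 : ((η + t : ℝ) * I : ℂ) - η * I = t * I := by push_cast; ring
      refine (hreg ((η + t : ℝ) * I) (by simp) ?_ ?_).2.2.1
      · intro h0
        rw [h0, sub_self] at h1
        have : t = 0 := by simpa using h1.symm
        rw [this, abs_zero] at ht
        linarith
      · rw [h1, norm_mul, norm_I, mul_one, norm_real, Real.norm_eq_abs, ht]; linarith
    have hE1 : (((η - r : ℝ) : ℂ) * I) ∉ E := by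
      simpa [sub_eq_add_neg] using hnotE (-r) (by rw [abs_neg, abs_of_pos hr])
    have hE2 : (((η + r : ℝ) : ℂ) * I) ∉ E := hnotE r (abs_of_pos hr)
    have hcard : ∀ a' b' : ℝ, a ≤ a' → b' ≤ b → η ∉ Icc a' b' →
        {ω : ℝ | ω ∈ Icc a' b' ∧ (ω * I : ℂ) ∈ E}.ncard ≤ n := by
      intro a' b' h1 h2 h3
      have : {ω : ℝ | ω ∈ Icc a' b' ∧ (ω * I : ℂ) ∈ E}.ncard <
          {ω : ℝ | ω ∈ Icc a b ∧ (ω * I : ℂ) ∈ E}.ncard := by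
        refine Set.ncard_lt_ncard ⟨fun ω hω => ⟨Icc_subset_Icc h1 h2 hω.1, hω.2⟩, fun hsub => ?_⟩
          (hfin a b hy)
        exact h3 (hsub ⟨hη, hηE⟩).1
      omega
    have c1 := ih (a := a) (b := η - r) (by linarith)
      (fun hm => hy ⟨hm.1, by linarith [hm.2]⟩) ha hE1
      (hcard _ _ le_rfl (by linarith) fun hm => by linarith [hm.2])
    have c2 := h.axisConvergence_near_singular hk hηE hr₀y hreg hr hr1
    have c3 := ih (a := η + r) (b := b) (by linarith)
      (fun hm => hy ⟨by linarith [hm.1], hm.2⟩) hE2 hb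
      (hcard _ _ (by linarith) le_rfl fun hm => by linarith [hm.1])
    have hkc := hk.continuousOn hy
    exact h.axisConvergence_trans (by linarith) (by linarith) hkc
      (h.axisConvergence_trans (by linarith) (by linarith)
        (hkc.mono (Icc_subset_Icc_right (by linarith))) c1 c2) c3

end IsSensitivity

/-! ### The limit point of the zeros -/

theorem isAxisWeight_one_add_div (ε y : ℝ) :
    IsAxisWeight (fun s => 1 + (ε : ℂ) ^ 2 / (s - y * I) ^ 2) y ∧
      ∀ ω : ℝ, (1 + (ε : ℂ) ^ 2 / (ω * I - y * I) ^ 2).re = 1 - ε ^ 2 / (ω - y) ^ 2 := by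
  have h : ∀ ω : ℝ, 1 + (ε : ℂ) ^ 2 / (ω * I - y * I) ^ 2 =
      ((1 - ε ^ 2 / (ω - y) ^ 2 : ℝ) : ℂ) := by
    intro ω
    rw [← sub_mul, mul_pow, I_sq, mul_neg_one, div_neg]; push_cast; ring
  refine ⟨⟨fun s hs => ?_, fun ω _ => by rw [h, ofReal_im]⟩, fun ω => by rw [h, ofReal_re]⟩
  have := pow_ne_zero 2 (sub_ne_zero.2 hs)
  fun_prop (disch := assumption)

theorem isAxisWeight_one (y : ℝ) : IsAxisWeight (fun _ => 1) y :=
  ⟨fun _ _ => by fun_prop, fun _ _ => by simp⟩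

/-- An integral over two segments that are symmetric about `y`, folded. -/
theorem integral_fold_annulus {y ε ρ : ℝ} {f ψ : ℝ → ℝ} (hψ : ∀ ω, ψ (-ω) = ψ ω)
    (h1 : IntervalIntegrable (fun ω => f ω * ψ (ω - y)) volume (y + ε) (y + ρ))
    (h2 : IntervalIntegrable (fun ω => f ω * ψ (ω - y)) volume (y - ρ) (y - ε)) :
    (∫ ω in (y + ε)..(y + ρ), f ω * ψ (ω - y)) + ∫ ω in (y - ρ)..(y - ε), f ω * ψ (ω - y) =
      ∫ ω in ε..ρ, (f (y + ω) + f (y - ω)) * ψ ω := by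
  have e1 := intervalIntegral.integral_comp_add_left (a := ε) (b := ρ)
    (fun ω => f ω * ψ (ω - y)) y
  have e2 := intervalIntegral.integral_comp_sub_left (a := ε) (b := ρ)
    (fun ω => f ω * ψ (ω - y)) y
  have i1 := h1.comp_add_left y
  have i2 := h2.comp_sub_left y
  simp only [add_sub_cancel_left, sub_sub_cancel_left, sub_sub_cancel, hψ] at e1 e2 i1 i2
  rw [← e1, ← e2, ← intervalIntegral.integral_add i1 i2.symm]
  exact intervalIntegral.integral_congr fun ω _ => by ring

namespace IsSensitivity

variable {S : ℂ → ℂ} {p : ℕ → ℂ} {d : ℕ → ℕ} {E : Set ℂ} {y : ℝ}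

theorem ne_radius (h : IsSensitivity S p d E y) {c : ℂ} {r : ℝ}
    (hcr : halfCircle c r ⊆ regularPoints p E y) (j : ℕ) : ‖p j - c‖ ≠ r := fun h0 =>
  (hcr ⟨(h.re_pos j).le, h0⟩).2.1 ⟨j, rfl⟩

/-- For small shifts, no zero crosses a half circle that avoids the zeros. -/
theorem eventually_norm_lt_iff (h : IsSensitivity S p d E y) {c : ℂ} {r : ℝ}
    (hcr : halfCircle c r ⊆ regularPoints p E y) :
    ∀ᶠ δ : ℝ in 𝓝[>] 0, ∀ j, ‖p j - (c + δ)‖ < r ↔ ‖p j - c‖ < r := by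
  have hy : ‖(y * I : ℂ) - c‖ ≠ r := fun h0 =>
    (hcr (show (y * I : ℂ) ∈ halfCircle c r from ⟨by simp, h0⟩)).2.2.2 rfl
  set κ : ℝ := |‖(y * I : ℂ) - c‖ - r| / 2 with hκ
  have hκ0 : 0 < κ := half_pos (abs_pos.2 (sub_ne_zero.2 hy))
  set K : Set ℂ := {s | |‖s - c‖ - r| ≤ κ} with hK
  have hKc : IsCompact K := by
    refine (isCompact_closedBall c (r + κ)).of_isClosed_subset
      (isClosed_le (by fun_prop) continuous_const) fun s hs => ?_
    rw [mem_closedBall_iff_norm]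
    have := (abs_le.1 (show |‖s - c‖ - r| ≤ κ from hs)).2
    linarith
  have hyK : (y * I : ℂ) ∉ K := by
    intro h0
    have : |‖(y * I : ℂ) - c‖ - r| ≤ κ := h0
    linarith
  have hfin := h.finite_zeros K hKc hyK
  have h1 : ∀ᶠ δ : ℝ in 𝓝[>] 0, ∀ j ∈ {j | p j ∈ K}, (‖p j - (c + δ)‖ < r ↔ ‖p j - c‖ < r) := by
    rw [eventually_all_finite hfin]
    intro j _
    have hcont : Tendsto (fun δ : ℝ => ‖p j - (c + δ)‖) (𝓝[>] 0) (𝓝 ‖p j - c‖) := by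
      have : ContinuousAt (fun δ : ℝ => ‖p j - (c + δ)‖) 0 := by fun_prop
      simpa using this.tendsto.mono_left (nhdsWithin_le_nhds (s := Ioi 0))
    rcases lt_or_gt_of_ne (h.ne_radius hcr j) with h2 | h2
    · filter_upwards [hcont.eventually_lt_const h2] with δ h3 using iff_of_true h3 h2
    · filter_upwards [hcont.eventually_const_lt h2] with δ h3 using
        iff_of_false (not_lt.2 h3.le) (not_lt.2 h2.le)
  filter_upwards [h1, Ioo_mem_nhdsGT hκ0] with δ h2 h3 j
  by_cases hj : p j ∈ K
  · exact h2 j hj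
  · have h4 : κ < |‖p j - c‖ - r| := not_le.1 hj
    have h5 : |‖p j - (c + δ)‖ - ‖p j - c‖| ≤ δ := by
      refine (abs_norm_sub_norm_le _ _).trans ?_
      rw [show p j - (c + δ) - (p j - c) = -(δ : ℂ) by ring, norm_neg, norm_real,
        Real.norm_eq_abs, abs_of_pos h3.1]
    rw [abs_le] at h5
    rcases lt_abs.1 h4 with h6 | h6
    · exact iff_of_false (by linarith [h3.2]) (by linarith)
    · exact iff_of_true (by linarith [h3.2]) (by linarith)

theorem mul_I_notMem_of_halfCircle {r t : ℝ} {η : ℝ}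
    (hcr : halfCircle (η * I) r ⊆ regularPoints p E y) (ht : |t| = r) :
    ((η + t : ℝ) * I : ℂ) ∉ E := by
  refine (hcr ⟨by simp, ?_⟩).2.2.1
  rw [show ((η + t : ℝ) * I : ℂ) - η * I = t * I by push_cast; ring, norm_mul, norm_I, mul_one,
    norm_real, Real.norm_eq_abs, ht]

theorem mul_I_notMem_of_halfCircle' {r : ℝ} (hr : 0 < r) {η : ℝ}
    (hcr : halfCircle (η * I) r ⊆ regularPoints p E y) :
    ((η + r : ℝ) * I : ℂ) ∉ E ∧ ((η - r : ℝ) * I : ℂ) ∉ E := by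
  refine ⟨mul_I_notMem_of_halfCircle hcr (abs_of_pos hr), ?_⟩
  rw [sub_eq_add_neg]
  exact mul_I_notMem_of_halfCircle hcr (by rw [abs_neg, abs_of_pos hr])

/-- Carleman's formula for `S` on a half annulus centred at the limit point of the zeros, with
arbitrarily many singular points on the two segments of the axis. -/
theorem integral_axis_around_limit (h : IsSensitivity S p d E y) {ε ρ : ℝ} (hε : 0 < ε)
    (hερ : ε < ρ) (hεr : halfCircle (y * I) ε ⊆ regularPoints p E y)
    (hρr : halfCircle (y * I) ρ ⊆ regularPoints p E y) (J : Finset ℕ)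
    (hJ : ∀ j, j ∈ J ↔ ε < ‖p j - y * I‖ ∧ ‖p j - y * I‖ < ρ)
    {ℓ : ℝ → ℂ} (hℓ : ContinuousOn ℓ (Icc (-(π / 2)) (π / 2)))
    (hℓe : ∀ θ ∈ Icc (-(π / 2)) (π / 2), exp (ℓ θ) = S (y * I + circleMap 0 ρ θ)) :
    ∫ ω in ε..ρ, (Real.log ‖S ((y + ω : ℝ) * I)‖ + Real.log ‖S ((y - ω : ℝ) * I)‖) *
        (1 - ε ^ 2 / ω ^ 2) =
      (∫ θ in (-(π / 2))..(π / 2),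
          (ℓ θ * (circleMap 0 ρ θ + ((ε ^ 2 : ℝ) : ℂ) / circleMap 0 ρ θ)).re) -
        2 * ε * (∫ θ in (-(π / 2))..(π / 2),
          Real.log ‖S (y * I + circleMap 0 ε θ)‖ * Real.cos θ) +
        2 * π * ∑ j ∈ J, d j * ((p j).re * (1 - ε ^ 2 / ‖p j - y * I‖ ^ 2)) := by
  have hρ : 0 < ρ := hε.trans hερ
  set c : ℂ := y * I with hc
  have hcre : c.re = 0 := by simp [hc]
  set ψ : ℝ → ℝ := fun ω => 1 - ε ^ 2 / ω ^ 2 with hψ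
  have hψneg : ∀ ω, ψ (-ω) = ψ ω := fun ω => by simp only [hψ, neg_sq]
  obtain ⟨hk, hkre⟩ := isAxisWeight_one_add_div ε y
  have hnot1 : y ∉ Icc (y + ε) (y + ρ) := fun hm => by linarith [hm.1]
  have hnot2 : y ∉ Icc (y - ρ) (y - ε) := fun hm => by linarith [hm.2]
  have hφ1 := hk.continuousOn hnot1
  have hφ2 := hk.continuousOn hnot2
  have t1 := h.axisConvergence_of_notMem hk (by linarith) hnot1
    (mul_I_notMem_of_halfCircle' hε hεr).1 (mul_I_notMem_of_halfCircle' hρ hρr).1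
  have t2 := h.axisConvergence_of_notMem hk (by linarith) hnot2
    (mul_I_notMem_of_halfCircle' hρ hρr).2 (mul_I_notMem_of_halfCircle' hε hεr).2
  have hi1 := h.intervalIntegrable_mul (by linarith : y + ε ≤ y + ρ) hφ1
  have hi2 := h.intervalIntegrable_mul (by linarith : y - ρ ≤ y - ε) hφ2
  have t3 := Tendsto.add t1 t2
  simp only [hkre] at t3 hφ1 hφ2 hi1 hi2
  have hφψ : ∀ ω, 1 - ε ^ 2 / (ω - y) ^ 2 = ψ (ω - y) := fun ω => rfl
  simp only [hφψ] at t3 hφ1 hφ2 hi1 hi2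
  rw [integral_fold_annulus (f := fun ω => Real.log ‖S (ω * I)‖) hψneg hi1 hi2] at t3
  obtain ⟨m, hm, hmt⟩ := h.exists_branch_shift hcre hρ hρr hℓ hℓe
  obtain ⟨ℓ', hℓ', hℓe'⟩ := h.exists_branch hcre hε hεr
  obtain ⟨m', hm', hmt'⟩ := h.exists_branch_shift hcre hε hεr hℓ' hℓe'
  have houter := (hmt (fun θ => circleMap 0 ρ θ + ((ε ^ 2 : ℝ) : ℂ) / circleMap 0 ρ θ)
    ((continuous_circleMap 0 ρ).add (continuous_const.div (continuous_circleMap 0 ρ)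
      (circleMap_zero_ne_zero hρ))).continuousOn).mono_left (shiftFilter_le p)
  have hinner := (hmt' (fun θ => (Real.cos θ : ℂ))
    (by fun_prop : Continuous fun θ : ℝ => (Real.cos θ : ℂ)).continuousOn).mono_left
      (shiftFilter_le p)
  have hlogcos : ∀ {f : ℝ → ℂ} {b : ℂ}, (∀ θ ∈ Icc (-(π / 2)) (π / 2),
      exp (f θ) = S (b + circleMap 0 ε θ)) → ∫ θ in (-(π / 2))..(π / 2),
        (f θ * (Real.cos θ : ℂ)).re = ∫ θ in (-(π / 2))..(π / 2),
          Real.log ‖S (b + circleMap 0 ε θ)‖ * Real.cos θ := by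
    intro f b hf
    refine intervalIntegral.integral_congr fun θ hθ => ?_
    rw [uIcc_of_le neg_pi_div_two_le] at hθ
    simp only [re_mul_ofReal, re_eq_log_norm_of_exp_eq (hf θ hθ)]
  have hsum : Tendsto (fun δ : ℝ => ∑ j ∈ J, d j * ((p j - (c + δ)).re *
      (1 - ε ^ 2 / ‖p j - (c + δ)‖ ^ 2))) (shiftFilter p)
      (𝓝 (∑ j ∈ J, d j * ((p j).re * (1 - ε ^ 2 / ‖p j - c‖ ^ 2)))) := by
    refine tendsto_finsetSum _ fun j hj => ?_
    have h0 : ‖p j - c‖ ^ 2 ≠ 0 := pow_ne_zero _ (hε.trans ((hJ j).1 hj).1).ne'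
    have hcont : ContinuousAt (fun δ : ℝ => d j * ((p j - (c + δ)).re *
        (1 - ε ^ 2 / ‖p j - (c + δ)‖ ^ 2))) 0 := by
      have h2 : ContinuousAt (fun δ : ℝ => ‖p j - (c + δ)‖ ^ 2) 0 := by fun_prop
      have h3 : ContinuousAt (fun δ : ℝ => (p j - (c + δ)).re) 0 := by fun_prop
      exact continuousAt_const.mul (h3.mul (continuousAt_const.sub
        (continuousAt_const.div h2 (by simpa using h0))))
    have h4 := hcont.tendsto.mono_left ((shiftFilter_le p).trans nhdsWithin_le_nhds)
    simpa [hcre] using h4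
  refine tendsto_nhds_unique t3 ?_
  rw [← hlogcos hℓe']
  refine ((houter.sub (hinner.const_mul (2 * ε))).add (hsum.const_mul (2 * π))).congr' ?_
  have hJre : ∀ᶠ δ : ℝ in 𝓝[>] 0, ∀ j ∈ J, 0 < (p j - (c + δ)).re := by
    rw [Filter.eventually_all_finset]
    intro j _
    filter_upwards [Ioo_mem_nhdsGT (h.re_pos j)] with δ hδ
    simp only [sub_re, add_re, hcre, ofReal_re]
    linarith [hδ.2]
  filter_upwards [eventually_shiftFilter p, shiftFilter_le p hm, shiftFilter_le p hm',
    shiftFilter_le p (h.eventually_norm_lt_iff hεr), shiftFilter_le p (h.eventually_norm_lt_iff hρr),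
    shiftFilter_le p (h.eventually_ne_radius hcre hεr),
    shiftFilter_le p (h.eventually_ne_radius hcre hρr), shiftFilter_le p hJre]
    with δ hδ h1 h2 h3 h4 h5 h6 h7
  have hcδ : (c + δ).re = δ := by simp [hcre]
  rw [hlogcos h2.2]
  have key := h.integral_vertical_halfAnnulus (c := c + δ) (by rw [hcδ]; exact hδ.1) hε hερ J ?_
    (fun j => by rw [hcδ]; exact hδ.2 j) h5 h6 h1.1 h1.2
  · rw [← key, integral_fold_annulus (f := fun ω : ℝ => Real.log ‖S (δ + ω * I)‖) hψneg
      (h.intervalIntegrable_shift_mul hδ.1 hδ.2 (by linarith) hφ1)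
      (h.intervalIntegrable_shift_mul hδ.1 hδ.2 (by linarith) hφ2)]
    refine intervalIntegral.integral_congr fun ω _ => ?_
    simp only [hψ]
    rw [show (δ : ℂ) + ((y + ω : ℝ) : ℂ) * I = c + δ + ω * I by rw [hc]; push_cast; ring,
      show (δ : ℂ) + ((y - ω : ℝ) : ℂ) * I = c + δ + -(ω * I) by rw [hc]; push_cast; ring]
  · intro j
    constructor
    · intro hj
      have h8 := (hJ j).1 hj
      have h9 := h7 j hj
      refine ⟨h9, lt_of_le_of_ne ?_ (h5 j h9.le).symm, (h4 j).2 h8.2⟩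
      exact not_lt.1 fun h10 => absurd ((h3 j).1 h10) (not_lt.2 h8.1.le)
    · rintro ⟨-, h8, h9⟩
      refine (hJ j).2 ⟨lt_of_le_of_ne ?_ (h.ne_radius hεr j).symm, (h4 j).1 h9⟩
      exact not_lt.1 fun h10 => absurd ((h3 j).2 h10) (not_lt.2 h8.le)

theorem finite_zeros_annulus (h : IsSensitivity S p d E y) {ε : ℝ} (hε : 0 < ε) (R : ℝ) :
    {j | ε ≤ ‖p j - y * I‖ ∧ ‖p j‖ ≤ R}.Finite := by
  refine h.finite_zeros {s : ℂ | ε ≤ ‖s - y * I‖ ∧ ‖s‖ ≤ R} ?_ ?_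
  · refine (isCompact_closedBall (0 : ℂ) R).of_isClosed_subset ?_ fun s hs => by simpa using hs.2
    exact (isClosed_le continuous_const (by fun_prop : Continuous fun s : ℂ => ‖s - y * I‖)).inter
      (isClosed_le continuous_norm continuous_const)
  · rintro ⟨h1, -⟩
    rw [sub_self, norm_zero] at h1
    linarith

/-- Arbitrarily small half circles around the limit point of the zeros are regular, and `log |S|` is
of size `o(1 / ε)` there. -/
theorem frequently_regular (h : IsSensitivity S p d E y) {η : ℝ} (hη : 0 < η) :
    ∃ᶠ ε : ℝ in 𝓝[>] 0, halfCircle (y * I) ε ⊆ regularPoints p E y ∧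
      ∀ s ∈ halfCircle (y * I) ε, ε * |Real.log ‖S s‖| ≤ η := by
  refine ((h.growth _ (mem_insert _ _) η hη).and_eventually self_mem_nhdsWithin).mono ?_
  rintro ε ⟨h1, h2⟩
  refine ⟨fun s hs => ?_, fun s hs => (h1 s hs.1 hs.2).2.2⟩
  obtain ⟨h3, h4, -⟩ := h1 s hs.1 hs.2
  refine ⟨hs.1, ?_, h3, ?_⟩
  · rintro ⟨j, rfl⟩; exact h4 (h.apply_eq_zero j)
  · rintro rfl
    have h5 := hs.2
    rw [sub_self, norm_zero] at h5
    exact (ne_of_gt (show 0 < ε from h2)) h5.symm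

/-- The contribution of the zeros in the half disc of centre `c` and radius `r`. -/
noncomputable def zeroWeight (p : ℕ → ℂ) (d : ℕ → ℕ) (c : ℂ) (r : ℝ) (j : ℕ) : ℝ :=
  if ‖p j - c‖ < r then d j * (p j).re else 0

theorem zeroWeight_nonneg (h : IsSensitivity S p d E y) (c : ℂ) (r : ℝ) (j : ℕ) :
    0 ≤ zeroWeight p d c r j := by
  unfold zeroWeight
  split_ifs
  · exact mul_nonneg (Nat.cast_nonneg _) (h.re_pos j).le
  · exact le_rfl

/-- Letting the inner radius tend to `0` in `integral_axis_around_limit` along radii where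
`log |S|` is small compared with `1 / ε`: the zeros near the limit point have a finite sum, and
Carleman's formula holds on the half disc. -/
theorem hasSum_zeroWeight (h : IsSensitivity S p d E y) {ρ : ℝ} (hρ : 0 < ρ)
    (hρr : halfCircle (y * I) ρ ⊆ regularPoints p E y)
    {ℓ : ℝ → ℂ} (hℓ : ContinuousOn ℓ (Icc (-(π / 2)) (π / 2)))
    (hℓe : ∀ θ ∈ Icc (-(π / 2)) (π / 2), exp (ℓ θ) = S (y * I + circleMap 0 ρ θ)) :
    HasSum (zeroWeight p d (y * I) ρ) (((∫ ω in (y - ρ)..(y + ρ), Real.log ‖S (ω * I)‖) -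
      ∫ θ in (-(π / 2))..(π / 2), (ℓ θ * circleMap 0 ρ θ).re) / (2 * π)) := by
  set c : ℂ := y * I with hc
  set f : ℕ → ℝ := zeroWeight p d c ρ with hf
  have hf0 : ∀ j, 0 ≤ f j := h.zeroWeight_nonneg c ρ
  have hpc : ∀ j, 0 < ‖p j - c‖ := fun j => norm_pos_iff.2 (sub_ne_zero.2 fun h0 =>
    (h.notMem_of_re_pos (h.re_pos j)).2 h0)
  set B : ℝ := ∫ ω in (y - ρ)..(y + ρ), Real.log ‖S (ω * I)‖ with hB
  set A : ℝ := ∫ θ in (-(π / 2))..(π / 2), (ℓ θ * circleMap 0 ρ θ).re with hA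
  set X : ℝ → ℝ := fun ε => ∫ ω in ε..ρ, (Real.log ‖S ((y + ω : ℝ) * I)‖ +
    Real.log ‖S ((y - ω : ℝ) * I)‖) * (1 - ε ^ 2 / ω ^ 2) with hX
  set Y : ℝ → ℝ := fun ε => ∫ θ in (-(π / 2))..(π / 2),
    (ℓ θ * (circleMap 0 ρ θ + ((ε ^ 2 : ℝ) : ℂ) / circleMap 0 ρ θ)).re with hY
  have hXt : Tendsto X (𝓝[>] 0) (𝓝 B) := by
    have hi := (h.intervalIntegrable_mul (a := y - ρ) (b := y + ρ) (φ := fun _ => 1)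
      (by linarith) continuousOn_const).comp_add_left y
    simp only [mul_one] at hi
    rw [show y - ρ - y = -ρ by ring, show y + ρ - y = ρ by ring] at hi
    obtain ⟨-, i1, i2⟩ := intervalIntegrable_of_neg hρ.le hi
    have e1 : B = ∫ ω in (0 : ℝ)..ρ, (Real.log ‖S ((y + ω : ℝ) * I)‖ * 1 +
        Real.log ‖S ((y + -ω : ℝ) * I)‖ * 1) := by
      simp only [mul_one]
      rw [← integral_fold hρ.le hi,
        intervalIntegral.integral_comp_add_left (fun ω : ℝ => Real.log ‖S (ω * I)‖), hB,
        sub_eq_add_neg]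
    have hcont : ∀ ε ∈ Ioo 0 ρ, ContinuousOn (fun ω : ℝ => 1 - ε ^ 2 / ω ^ 2) (Icc ε ρ) :=
      fun ε hε => continuousOn_const.sub (continuousOn_const.div (by fun_prop) fun ω hω =>
        pow_ne_zero _ (hε.1.trans_le hω.1).ne')
    have hbound : ∀ ε ∈ Ioo 0 ρ, ∀ ω ∈ Icc ε ρ, |1 - ε ^ 2 / ω ^ 2| ≤ 1 := by
      intro ε hε ω hω
      have h1 : ε ^ 2 / ω ^ 2 ≤ 1 := by
        rw [div_le_one (pow_pos (hε.1.trans_le hω.1) 2)]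
        exact pow_le_pow_left₀ hε.1.le hω.1 2
      have h2 : 0 ≤ ε ^ 2 / ω ^ 2 := by positivity
      exact abs_le.2 ⟨by linarith, by linarith⟩
    have hlim : ∀ ω ∈ Ioc 0 ρ, Tendsto (fun ε : ℝ => 1 - ε ^ 2 / ω ^ 2) (𝓝[>] 0) (𝓝 1) := by
      intro ω _
      have : ContinuousAt (fun ε : ℝ => 1 - ε ^ 2 / ω ^ 2) 0 := by fun_prop
      simpa using this.tendsto.mono_left (nhdsWithin_le_nhds (s := Ioi 0))
    have key := tendsto_integral_axis (H₁ := fun ε ω => 1 - ε ^ 2 / ω ^ 2)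
      (H₂ := fun ε ω => 1 - ε ^ 2 / ω ^ 2) (K₁ := fun _ => 1) (K₂ := fun _ => 1) hρ i1 i2
      hcont hcont hbound hbound hlim hlim
    rw [e1]
    refine key.congr fun ε => intervalIntegral.integral_congr fun ω _ => ?_
    simp only [sub_eq_add_neg y]; ring
  have hYt : Tendsto Y (𝓝[>] 0) (𝓝 A) := by
    have i1 : IntervalIntegrable (fun θ => (ℓ θ * circleMap 0 ρ θ).re) volume (-(π / 2)) (π / 2) :=
      ContinuousOn.intervalIntegrable_of_Icc neg_pi_div_two_le
        (continuous_re.comp_continuousOn (hℓ.mul (continuous_circleMap 0 ρ).continuousOn))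
    have i2 : IntervalIntegrable (fun θ => (ℓ θ / circleMap 0 ρ θ).re) volume (-(π / 2)) (π / 2) :=
      ContinuousOn.intervalIntegrable_of_Icc neg_pi_div_two_le
        (continuous_re.comp_continuousOn (hℓ.div (continuous_circleMap 0 ρ).continuousOn
          fun θ _ => circleMap_zero_ne_zero hρ θ))
    have e1 : ∀ ε, Y ε = A + ε ^ 2 * ∫ θ in (-(π / 2))..(π / 2), (ℓ θ / circleMap 0 ρ θ).re := by
      intro ε
      rw [hA, ← intervalIntegral.integral_const_mul,
        ← intervalIntegral.integral_add i1 (i2.const_mul _)]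
      refine intervalIntegral.integral_congr fun θ _ => ?_
      rw [← re_ofReal_mul, ← add_re]
      congr 1; ring
    have : ContinuousAt (fun ε : ℝ => A + ε ^ 2 *
        ∫ θ in (-(π / 2))..(π / 2), (ℓ θ / circleMap 0 ρ θ).re) 0 := by fun_prop
    have h2 := this.tendsto.mono_left (nhdsWithin_le_nhds (s := Ioi 0))
    rw [show Y = _ from funext e1]
    simpa using h2
  have hXY : Tendsto (fun ε => (X ε - Y ε) / (2 * π)) (𝓝[>] 0) (𝓝 ((B - A) / (2 * π))) :=
    (hXt.sub hYt).div_const _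
  -- On good radii `ε`, the zeros with `ε < |p j - c| < ρ` contribute `(X ε - Y ε) / 2π` up to `κ`.
  have hgood : ∀ κ : ℝ, 0 < κ → ∃ᶠ ε : ℝ in 𝓝[>] 0, ε ∈ Ioo 0 ρ ∧ ∃ J : Finset ℕ,
      (∀ j, j ∈ J ↔ ε < ‖p j - c‖ ∧ ‖p j - c‖ < ρ) ∧
      |(X ε - Y ε) / (2 * π) - ∑ j ∈ J, d j * ((p j).re * (1 - ε ^ 2 / ‖p j - c‖ ^ 2))| ≤ κ := by
    intro κ hκ
    refine ((h.frequently_regular hκ).and_eventually (Ioo_mem_nhdsGT hρ)).mono ?_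
    rintro ε ⟨⟨h1, h2⟩, hε⟩
    have hfin : {j | ε < ‖p j - c‖ ∧ ‖p j - c‖ < ρ}.Finite := by
      refine (h.finite_zeros_annulus hε.1 (‖c‖ + ρ)).subset fun j hj => ⟨hj.1.le, ?_⟩
      have := norm_add_le (p j - c) c
      rw [sub_add_cancel] at this
      linarith [hj.2]
    refine ⟨hε, hfin.toFinset, fun j => by simp, ?_⟩
    have key := h.integral_axis_around_limit hε.1 hε.2 h1 hρr hfin.toFinset (fun j => by simp [hc])
      hℓ hℓe
    set Z : ℝ := ∫ θ in (-(π / 2))..(π / 2), Real.log ‖S (c + circleMap 0 ε θ)‖ * Real.cos θ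
    set W : ℝ := ∑ j ∈ hfin.toFinset, d j * ((p j).re * (1 - ε ^ 2 / ‖p j - c‖ ^ 2))
    have hsimp : (X ε - Y ε) / (2 * π) - W = -(2 * ε * Z) / (2 * π) := by
      have e1 : X ε = Y ε - 2 * ε * Z + 2 * π * W := key
      rw [e1]
      have := Real.pi_pos.ne'
      field_simp
      ring
    have hZ := intervalIntegral.norm_integral_le_of_norm_le_const (a := -(π / 2)) (b := π / 2)
      (C := κ / ε) (f := fun θ => Real.log ‖S (c + circleMap 0 ε θ)‖ * Real.cos θ) ?_
    · rw [hsimp, abs_div, abs_neg, abs_mul, abs_of_pos (by linarith [hε.1] : 0 < 2 * ε),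
        abs_of_pos (by positivity : 0 < 2 * π), div_le_iff₀ (by positivity)]
      rw [Real.norm_eq_abs, show π / 2 - -(π / 2) = π by ring, abs_of_pos Real.pi_pos] at hZ
      calc _ ≤ 2 * ε * (κ / ε * π) := mul_le_mul_of_nonneg_left hZ (by linarith [hε.1])
        _ = κ * (2 * π) := by have := hε.1.ne'; field_simp
    · intro θ hθ
      rw [uIoc_of_le neg_pi_div_two_le] at hθ
      have h3 := h2 _ (add_circleMap_mem_halfCircle (by simp) hε.1.le
        (Ioc_subset_Icc_self hθ))
      rw [norm_mul, Real.norm_eq_abs, Real.norm_eq_abs]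
      refine (mul_le_of_le_one_right (abs_nonneg _) (Real.abs_cos_le_one θ)).trans ?_
      rw [le_div_iff₀ hε.1, mul_comm]
      exact h3
  have hterm : ∀ {ε : ℝ} {j : ℕ}, 0 < ε → ε < ‖p j - c‖ → 0 ≤ 1 - ε ^ 2 / ‖p j - c‖ ^ 2 ∧
      1 - ε ^ 2 / ‖p j - c‖ ^ 2 ≤ 1 := by
    intro ε j h1 h2
    have h3 : ε ^ 2 / ‖p j - c‖ ^ 2 ≤ 1 := by
      rw [div_le_one (pow_pos (hpc j) 2)]
      exact pow_le_pow_left₀ h1.le h2.le 2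
    have h4 : 0 ≤ ε ^ 2 / ‖p j - c‖ ^ 2 := by positivity
    exact ⟨by linarith, by linarith⟩
  have hle : ∀ F : Finset ℕ, ∑ j ∈ F, f j ≤ (B - A) / (2 * π) := by
    intro F
    refine le_of_forall_pos_le_add fun κ hκ => ?_
    have hF : Tendsto (fun ε : ℝ => ∑ j ∈ F, f j * (1 - ε ^ 2 / ‖p j - c‖ ^ 2)) (𝓝[>] 0)
        (𝓝 (∑ j ∈ F, f j)) := by
      refine tendsto_finsetSum _ fun j _ => ?_
      have : ContinuousAt (fun ε : ℝ => f j * (1 - ε ^ 2 / ‖p j - c‖ ^ 2)) 0 := by fun_prop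
      simpa using this.tendsto.mono_left (nhdsWithin_le_nhds (s := Ioi 0))
    have hFε : ∀ᶠ ε : ℝ in 𝓝[>] 0, ∀ j ∈ F, ε < ‖p j - c‖ := by
      rw [Filter.eventually_all_finset]
      intro j _
      filter_upwards [Ioo_mem_nhdsGT (hpc j)] with ε hε using hε.2
    have h1 := le_of_tendsto_of_frequently (hF.sub hXY) (b := κ)
      (((hgood κ hκ).and_eventually hFε).mono ?_)
    · linarith
    · rintro ε ⟨⟨hε, J, hJ, hJκ⟩, hFε⟩
      have h2 : ∑ j ∈ F, f j * (1 - ε ^ 2 / ‖p j - c‖ ^ 2) ≤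
          ∑ j ∈ J, d j * ((p j).re * (1 - ε ^ 2 / ‖p j - c‖ ^ 2)) := by
        have h3 : ∀ j ∈ J, (d j : ℝ) * ((p j).re * (1 - ε ^ 2 / ‖p j - c‖ ^ 2)) =
            f j * (1 - ε ^ 2 / ‖p j - c‖ ^ 2) := by
          intro j hj
          rw [hf, zeroWeight, if_pos ((hJ j).1 hj).2]; ring
        rw [Finset.sum_congr rfl h3, ← Finset.sum_inter_add_sum_sdiff F J]
        have h4 : ∑ j ∈ F \ J, f j * (1 - ε ^ 2 / ‖p j - c‖ ^ 2) = 0 := by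
          refine Finset.sum_eq_zero fun j hj => ?_
          rw [Finset.mem_sdiff, hJ] at hj
          rw [hf, zeroWeight, if_neg fun h5 => hj.2 ⟨hFε j hj.1, h5⟩, zero_mul]
        rw [h4, add_zero]
        refine Finset.sum_le_sum_of_subset_of_nonneg Finset.inter_subset_right fun j hj _ => ?_
        exact mul_nonneg (hf0 j) (hterm hε.1 ((hJ j).1 hj).1).1
      linarith [(abs_le.1 hJκ).1]
  have hsummable : Summable f := summable_of_sum_le hf0 hle
  have hge : (B - A) / (2 * π) ≤ ∑' j, f j := by
    refine le_of_forall_pos_le_add fun κ hκ => ?_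
    refine le_of_tendsto_of_frequently hXY ((hgood κ hκ).mono ?_)
    rintro ε ⟨hε, J, hJ, hJκ⟩
    have h2 : ∑ j ∈ J, d j * ((p j).re * (1 - ε ^ 2 / ‖p j - c‖ ^ 2)) ≤ ∑ j ∈ J, f j := by
      refine Finset.sum_le_sum fun j hj => ?_
      have h3 := (hterm hε.1 ((hJ j).1 hj).1).2
      rw [hf, zeroWeight, if_pos ((hJ j).1 hj).2]
      exact mul_le_mul_of_nonneg_left (mul_le_of_le_one_right (h.re_pos j).le h3)
        (Nat.cast_nonneg _)
    have h4 := hsummable.sum_le_tsum J fun j _ => hf0 j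
    linarith [(abs_le.1 hJκ).2]
  have htsum : ∑' j, f j = (B - A) / (2 * π) :=
    le_antisymm (hsummable.tsum_le_of_sum_le hle) hge
  exact htsum ▸ hsummable.hasSum

end IsSensitivity

/-! ### Half discs that contain the limit point -/

namespace IsSensitivity

variable {S : ℂ → ℂ} {p : ℕ → ℂ} {d : ℕ → ℕ} {E : Set ℂ} {y : ℝ}

/-- There are arbitrarily small half discs around the limit point of the zeros whose boundary half
circle is regular and in which the zeros have a finite total weight. -/
theorem exists_summable_zeroWeight (h : IsSensitivity S p d E y) {b : ℝ} (hb : 0 < b) :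
    ∃ ρ ∈ Ioo 0 b, halfCircle (y * I) ρ ⊆ regularPoints p E y ∧
      Summable (zeroWeight p d (y * I) ρ) := by
  obtain ⟨ρ, ⟨h1, -⟩, h2⟩ :=
    ((h.frequently_regular one_pos).and_eventually (Ioo_mem_nhdsGT hb)).exists
  obtain ⟨ℓ, hℓ, hℓe⟩ := h.exists_branch (c := y * I) (by simp) h2.1 h1
  exact ⟨ρ, h2, h1, (h.hasSum_zeroWeight h2.1 h1 hℓ hℓe).summable⟩

theorem summable_zeroWeight (h : IsSensitivity S p d E y) (c : ℂ) (r : ℝ) :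
    Summable (zeroWeight p d c r) := by
  obtain ⟨ρ, hρ, -, hsum⟩ := h.exists_summable_zeroWeight one_pos
  refine hsum.of_norm_bounded_eventually ?_
  have hfin := h.finite_zeros_annulus hρ.1 (‖c‖ + r)
  filter_upwards [hfin.compl_mem_cofinite] with j hj
  rw [Real.norm_eq_abs, abs_of_nonneg (h.zeroWeight_nonneg c r j)]
  by_cases h1 : ‖p j - c‖ < r
  · have h2 : ‖p j‖ ≤ ‖c‖ + r := by
      have := norm_add_le (p j - c) c
      rw [sub_add_cancel] at this
      linarith
    have h3 : ‖p j - y * I‖ < ρ := not_le.1 fun h4 => hj ⟨h4, h2⟩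
    rw [zeroWeight, zeroWeight, if_pos h1, if_pos h3]
  · rw [zeroWeight, if_neg h1]
    exact h.zeroWeight_nonneg _ _ _

/-- The integrals over the shifted diameters of a half disc whose boundary half circle is regular
converge, whatever singular points lie on the diameter. -/
theorem tendsto_integral_shift (h : IsSensitivity S p d E y) {η r : ℝ} (hr : 0 < r)
    (hcr : halfCircle (η * I) r ⊆ regularPoints p E y) {ℓ : ℝ → ℂ}
    (hℓ : ContinuousOn ℓ (Icc (-(π / 2)) (π / 2)))
    (hℓe : ∀ θ ∈ Icc (-(π / 2)) (π / 2), exp (ℓ θ) = S (η * I + circleMap 0 r θ)) :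
    Tendsto (fun δ : ℝ => ∫ ω in (η - r)..(η + r), Real.log ‖S (δ + ω * I)‖) (shiftFilter p)
      (𝓝 ((∫ θ in (-(π / 2))..(π / 2), (ℓ θ * circleMap 0 r θ).re) +
        2 * π * ∑' j, zeroWeight p d (η * I) r j)) := by
  have hc : (η * I : ℂ).re = 0 := by simp
  obtain ⟨m, hm, hmt⟩ := h.exists_branch_shift hc hr hcr hℓ hℓe
  have harc := (hmt (circleMap 0 r) (continuous_circleMap 0 r).continuousOn).mono_left
    (shiftFilter_le p)
  set T : ℝ → ℕ → ℝ := fun δ j =>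
    if ‖p j - η * I‖ < r then d j * max ((p j).re - δ) 0 else 0 with hT
  have hTt : Tendsto (fun δ => ∑' j, T δ j) (shiftFilter p)
      (𝓝 (∑' j, zeroWeight p d (η * I) r j)) := by
    refine tendsto_tsum_of_dominated_convergence (h.summable_zeroWeight (η * I) r) (fun j => ?_) ?_
    · simp only [hT, zeroWeight]
      split_ifs
      · have : ContinuousAt (fun δ : ℝ => d j * max ((p j).re - δ) 0) 0 := by fun_prop
        have h1 := this.tendsto.mono_left ((shiftFilter_le p).trans nhdsWithin_le_nhds)
        simpa [max_eq_left (h.re_pos j).le] using h1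
      · exact tendsto_const_nhds
    · filter_upwards [eventually_shiftFilter p] with δ hδ j
      simp only [hT, zeroWeight]
      split_ifs
      · rw [Real.norm_eq_abs, abs_of_nonneg (by positivity)]
        exact mul_le_mul_of_nonneg_left (max_le (by linarith [hδ.1]) (h.re_pos j).le)
          (Nat.cast_nonneg _)
      · simp
  refine (harc.add (hTt.const_mul (2 * π))).congr' ?_
  filter_upwards [eventually_shiftFilter p, shiftFilter_le p hm,
    shiftFilter_le p (h.eventually_norm_lt_iff hcr),
    shiftFilter_le p (h.eventually_ne_radius hc hcr)] with δ hδ h1 h2 h3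
  have hcδ : (η * I + δ : ℂ).re = δ := by simp
  have hsub : ∀ j, (p j - (η * I + δ)).re = (p j).re - δ := fun j => by rw [sub_re, hcδ]
  have hfin : {j | δ < (p j).re ∧ ‖p j - η * I‖ < r}.Finite := by
    refine (h.finite_zeros (Metric.closedBall (η * I) r ∩ {s : ℂ | δ ≤ s.re})
      ((isCompact_closedBall _ _).inter_right (isClosed_le continuous_const continuous_re)) ?_).subset
      fun j hj => ⟨mem_closedBall_iff_norm.2 hj.2.le, hj.1.le⟩
    rintro ⟨-, h4⟩
    have h5 : δ ≤ 0 := by simpa using h4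
    linarith [hδ.1]
  have key := h.integral_vertical_halfDisc (c := η * I + δ) (by rw [hcδ]; exact hδ.1) hr
    hfin.toFinset (fun j => by simp [h2 j]) (fun j => by rw [hcδ]; exact hδ.2 j) h3 h1.1 h1.2
  have hsum : ∑ j ∈ hfin.toFinset, d j * (p j - (η * I + δ)).re = ∑' j, T δ j := by
    rw [tsum_eq_sum (s := hfin.toFinset) fun j hj => ?_]
    · refine Finset.sum_congr rfl fun j hj => ?_
      obtain ⟨h4, h5⟩ := hfin.mem_toFinset.1 hj
      simp only [hT]
      rw [if_pos h5, max_eq_left (by linarith), hsub]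
    · simp only [hT]
      split_ifs with h4
      · have h5 : ¬ δ < (p j).re := fun h5 => hj (hfin.mem_toFinset.2 ⟨h5, h4⟩)
        rw [max_eq_right (by linarith), mul_zero]
      · rfl
  rw [← hsum, ← key, sub_eq_add_neg,
    ← intervalIntegral.integral_comp_add_left (fun ω : ℝ => Real.log ‖S (δ + ω * I)‖)]
  refine intervalIntegral.integral_congr fun ω _ => ?_
  congr 3; push_cast; ring

/-- Carleman's formula for `S` on a half disc whose diameter contains the limit point of the
zeros. -/
theorem integral_axis_eq (h : IsSensitivity S p d E y) {η r : ℝ} (hy : |y - η| < r)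
    (hcr : halfCircle (η * I) r ⊆ regularPoints p E y) {ℓ : ℝ → ℂ}
    (hℓ : ContinuousOn ℓ (Icc (-(π / 2)) (π / 2)))
    (hℓe : ∀ θ ∈ Icc (-(π / 2)) (π / 2), exp (ℓ θ) = S (η * I + circleMap 0 r θ)) :
    ∫ ω in (η - r)..(η + r), Real.log ‖S (ω * I)‖ =
      (∫ θ in (-(π / 2))..(π / 2), (ℓ θ * circleMap 0 r θ).re) +
        2 * π * ∑' j, zeroWeight p d (η * I) r j := by
  have hr : 0 < r := (abs_nonneg _).trans_lt hy
  rw [abs_lt] at hy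
  obtain ⟨ρ, hρ, hρr, -⟩ := h.exists_summable_zeroWeight
    (show 0 < min (y - (η - r)) (η + r - y) from lt_min (by linarith) (by linarith))
  have hρ1 := hρ.2.trans_le (min_le_left _ _)
  have hρ2 := hρ.2.trans_le (min_le_right _ _)
  obtain ⟨ℓ', hℓ', hℓe'⟩ := h.exists_branch (c := y * I) (by simp) hρ.1 hρr
  have hmid : AxisConvergence S p (fun _ => 1) (y - ρ) (y + ρ) := by
    have h1 := h.tendsto_integral_shift hρ.1 hρr hℓ' hℓe'
    rw [(h.hasSum_zeroWeight hρ.1 hρr hℓ' hℓe').tsum_eq, mul_div_cancel₀ _ (by positivity),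
      add_sub_cancel] at h1
    simpa only [AxisConvergence, mul_one] using h1
  have h1 := h.axisConvergence_of_notMem (isAxisWeight_one y) (a := η - r) (b := y - ρ)
    (by linarith) (fun hm => by linarith [hm.2, hρ.1]) (mul_I_notMem_of_halfCircle' hr hcr).2
    (mul_I_notMem_of_halfCircle' hρ.1 hρr).2
  have h2 := h.axisConvergence_of_notMem (isAxisWeight_one y) (a := y + ρ) (b := η + r)
    (by linarith) (fun hm => by linarith [hm.1, hρ.1]) (mul_I_notMem_of_halfCircle' hρ.1 hρr).1
    (mul_I_notMem_of_halfCircle' hr hcr).1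
  simp only [one_re] at h1 h2
  have h3 := h.axisConvergence_trans (by linarith [hρ.1]) (by linarith) continuousOn_const
    (h.axisConvergence_trans (by linarith) (by linarith [hρ.1]) continuousOn_const h1 hmid) h2
  simp only [AxisConvergence, mul_one] at h3
  exact tendsto_nhds_unique h3 (h.tendsto_integral_shift hr hcr hℓ hℓe)

/-! ### Large half discs -/

theorem tendsto_ofReal_tsum_zeroWeight (h : IsSensitivity S p d E y) :
    Tendsto (fun R : ℝ => ENNReal.ofReal (4 * π * ∑' j, zeroWeight p d 0 R j)) atTop
      (𝓝 (∑' j, ENNReal.ofReal (4 * π * (d j * (p j).re)))) := by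
  have h0 : ∀ R j, 0 ≤ 4 * π * zeroWeight p d 0 R j := fun R j =>
    mul_nonneg (by positivity) (h.zeroWeight_nonneg 0 R j)
  have e : ∀ R : ℝ, ENNReal.ofReal (4 * π * ∑' j, zeroWeight p d 0 R j) =
      ∑' j, ENNReal.ofReal (4 * π * zeroWeight p d 0 R j) := fun R => by
    rw [← tsum_mul_left, ENNReal.ofReal_tsum_of_nonneg (h0 R)
      ((h.summable_zeroWeight 0 R).mul_left _)]
  simp only [e]
  refine tendsto_order.2 ⟨fun a ha => ?_, fun b hb => Eventually.of_forall fun R => ?_⟩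
  · rw [ENNReal.tsum_eq_iSup_sum, lt_iSup_iff] at ha
    obtain ⟨F, hF⟩ := ha
    have h1 : ∀ᶠ R : ℝ in atTop, ∀ j ∈ F, ‖p j‖ < R := by
      rw [Filter.eventually_all_finset]
      exact fun j _ => eventually_gt_atTop _
    filter_upwards [h1] with R hR
    refine hF.trans_le (le_trans (Finset.sum_le_sum fun j hj => ?_)
      (ENNReal.sum_le_tsum (f := fun j => ENNReal.ofReal (4 * π * zeroWeight p d 0 R j)) F))
    rw [zeroWeight, sub_zero, if_pos (hR j hj)]
  · refine (ENNReal.tsum_le_tsum fun j => ENNReal.ofReal_le_ofReal ?_).trans_lt hb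
    refine mul_le_mul_of_nonneg_left ?_ (by positivity)
    rw [zeroWeight]
    split_ifs
    · exact le_rfl
    · exact mul_nonneg (Nat.cast_nonneg _) (h.re_pos j).le

theorem countable_singular (h : IsSensitivity S p d E y) : E.Countable := by
  have h1 : E ⊆ {(y * I : ℂ)} ∪ ⋃ n : ℕ, E ∩ (Metric.closedBall 0 n ∩
      {s | 1 / ((n : ℝ) + 1) ≤ ‖s - y * I‖}) := by
    intro s hs
    by_cases h0 : s = y * I
    · exact Or.inl h0
    · right
      obtain ⟨m, hm⟩ := exists_nat_ge ‖s‖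
      obtain ⟨n, hn⟩ := exists_nat_one_div_lt (norm_pos_iff.2 (sub_ne_zero.2 h0))
      refine mem_iUnion.2 ⟨max m n, hs, ?_, ?_⟩
      · rw [mem_closedBall_zero_iff]
        exact hm.trans (by exact_mod_cast le_max_left m n)
      · refine le_trans (one_div_le_one_div_of_le (by positivity) ?_) hn.le
        have : (n : ℝ) ≤ (max m n : ℕ) := by exact_mod_cast le_max_right m n
        linarith
  refine ((countable_singleton _).union (countable_iUnion fun n => Finite.countable ?_)).mono h1
  refine h.finite_singular _ ((isCompact_closedBall 0 (n : ℝ)).inter_right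
    (isClosed_le continuous_const (by fun_prop : Continuous fun s : ℂ => ‖s - y * I‖))) ?_
  rintro ⟨-, h2⟩
  rw [mem_ofPred_eq, sub_self, norm_zero] at h2
  have : (0 : ℝ) < 1 / ((n : ℝ) + 1) := by positivity
  linarith

/-- All but countably many radii are admissible. -/
theorem exists_countable_admissibleRadii (h : IsSensitivity S p d E y) :
    ∃ N : Set ℝ, N.Countable ∧ Ioi 0 \ N ⊆ admissibleRadii p E (y * I) := by
  refine ⟨(range fun j => ‖p j‖) ∪ norm '' E ∪ {‖(y * I : ℂ)‖},
    ((countable_range _).union (h.countable_singular.image _)).union (countable_singleton _), ?_⟩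
  rintro R ⟨hR, hRN⟩
  refine ⟨hR, fun s hs => ⟨?_, fun hE => ?_, ?_⟩⟩
  · rintro ⟨j, rfl⟩; exact hRN (Or.inl (Or.inl ⟨j, hs⟩))
  · exact hRN (Or.inl (Or.inr ⟨s, hE, hs⟩))
  · rintro rfl; exact hRN (Or.inr hs.symm)

/-- The Bode integral over `[-R, R]` for admissible `R`. -/
theorem integral_bodeIntegrand_eq (h : IsSensitivity S p d E y) {R : ℝ} (hy : |y| < R)
    (hR : R ∈ admissibleRadii p E (y * I)) {ℓ : ℝ → ℂ}
    (hℓ : ContinuousOn ℓ (Icc (-(π / 2)) (π / 2)))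
    (hℓe : ∀ θ ∈ Icc (-(π / 2)) (π / 2), exp (ℓ θ) = S (R * exp (θ * I))) :
    ∫ ω in (-R)..R, bodeIntegrand S ω =
      2 * (∫ θ in (-(π / 2))..(π / 2), ℓ θ * (R * exp (θ * I) * I)).im +
        4 * π * ∑' j, zeroWeight p d 0 R j := by
  have hcr : halfCircle ((0 : ℝ) * I) R ⊆ regularPoints p E y := by
    rintro s ⟨h1, h2⟩
    rw [ofReal_zero, zero_mul, sub_zero] at h2
    exact ⟨h1, hR.2 s h2⟩
  have key := h.integral_axis_eq (η := 0) (by rwa [sub_zero]) hcr hℓ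
    (fun θ hθ => by rw [hℓe θ hθ, ofReal_zero, zero_mul, zero_add, circleMap_zero])
  rw [zero_sub, zero_add, ofReal_zero, zero_mul] at key
  have hint : IntervalIntegrable (fun θ : ℝ => ℓ θ * (R * exp (θ * I) * I)) volume
      (-(π / 2)) (π / 2) :=
    ContinuousOn.intervalIntegrable_of_Icc neg_pi_div_two_le (hℓ.mul (by fun_prop))
  have him : (∫ θ in (-(π / 2))..(π / 2), ℓ θ * (R * exp (θ * I) * I)).im =
      ∫ θ in (-(π / 2))..(π / 2), (ℓ θ * circleMap 0 R θ).re := by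
    rw [← imCLM_apply, ← imCLM.intervalIntegral_comp_comm hint]
    refine intervalIntegral.integral_congr fun θ _ => ?_
    simp only [imCLM_apply, ← mul_assoc, mul_I_im, circleMap_zero]
  rw [him]
  have hb : ∀ ω, bodeIntegrand S ω = 2 * Real.log ‖S (ω * I)‖ := fun ω => by
    rw [bodeIntegrand, Real.log_pow]; norm_cast
  simp only [hb]
  rw [intervalIntegral.integral_const_mul, key]
  ring

/-- The limit of the Bode integral over `[-R, R]` along admissible radii. -/
theorem tendsto_integral_bodeIntegrand (h : IsSensitivity S p d E y)
    (hlarge : LargeArcIntegralVanishes S (admissibleRadii p E (y * I))) :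
    Tendsto (fun R : ℝ => ((∫ ω in (-R)..R, bodeIntegrand S ω : ℝ) : EReal))
      (atTop ⊓ 𝓟 (admissibleRadii p E (y * I)))
      (𝓝 ((∑' j, ENNReal.ofReal (4 * π * (d j * (p j).re)) : ENNReal) : EReal)) := by
  obtain ⟨logS, hbranch, hlim⟩ := hlarge
  have h1 := ((continuous_im.tendsto 0).comp hlim).const_mul 2
  simp only [zero_im, mul_zero] at h1
  have h2 : Tendsto (fun R : ℝ => ((2 * (∫ θ in (-(π / 2))..(π / 2),
      logS R θ * (R * exp (θ * I) * I)).im : ℝ) : EReal))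
      (atTop ⊓ 𝓟 (admissibleRadii p E (y * I))) (𝓝 ((0 : ℝ) : EReal)) :=
    (continuous_coe_real_ereal.tendsto 0).comp h1
  have h3 := (continuous_coe_ennreal_ereal.tendsto _).comp
    (h.tendsto_ofReal_tsum_zeroWeight.mono_left
      (inf_le_left (b := 𝓟 (admissibleRadii p E (y * I)))))
  have h4 := (EReal.continuousAt_add (p := (((0 : ℝ) : EReal),
    ((∑' j, ENNReal.ofReal (4 * π * (d j * (p j).re)) : ENNReal) : EReal)))
    (Or.inl (by simp)) (Or.inl (by simp))).tendsto.comp (h2.prodMk_nhds h3)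
  simp only [EReal.coe_zero, zero_add] at h4
  refine h4.congr' ?_
  filter_upwards [mem_inf_of_left (eventually_gt_atTop |y|),
    mem_inf_of_right (mem_principal_self _)] with R hR hRA
  have hb := hbranch R hRA
  simp only [Function.comp_apply]
  rw [h.integral_bodeIntegrand_eq hR hRA hb.1 hb.2, EReal.coe_add, EReal.coe_ennreal_ofReal,
    max_eq_left (mul_nonneg (by positivity) (tsum_nonneg fun j => h.zeroWeight_nonneg 0 R j))]

end IsSensitivity

/-! ### The limit along all radii -/

/-- A continuous function with a limit at infinity along all but countably many radii has that
limit. -/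
theorem tendsto_atTop_of_countable {X : Type*} [TopologicalSpace X] [RegularSpace X] {G : ℝ → X}
    {A N : Set ℝ} {T : X} (hG : Continuous G) (hN : N.Countable) (hNA : Ioi 0 \ N ⊆ A)
    (h : Tendsto G (atTop ⊓ 𝓟 A) (𝓝 T)) : Tendsto G atTop (𝓝 T) := by
  refine (closed_nhds_basis T).tendsto_right_iff.2 fun V hV => ?_
  have h1 := h.eventually hV.1
  rw [eventually_inf_principal, eventually_atTop] at h1
  obtain ⟨R₀, hR₀⟩ := h1
  filter_upwards [eventually_gt_atTop (max R₀ 0)] with R hR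
  have h2 := (hN.dense_compl ℝ).open_subset_closure_inter (isOpen_Ioi (a := max R₀ 0)) hR
  refine hV.2.closure_subset (map_mem_closure hG h2 ?_)
  rintro x ⟨hx, hxN⟩
  exact hR₀ x ((le_max_left _ _).trans (le_of_lt hx))
    (hNA ⟨(le_max_right R₀ 0).trans_lt hx, hxN⟩)

theorem continuous_integral_symm {f : ℝ → ℝ} (hf : LocallyIntegrable f) :
    Continuous fun R : ℝ => ∫ ω in (-R)..R, f ω := by
  have hi : ∀ a b, IntervalIntegrable f volume a b := fun a b =>
    (hf.integrableOn_isCompact isCompact_uIcc).intervalIntegrable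
  have h1 := intervalIntegral.continuous_primitive hi 0
  refine (h1.sub (h1.comp continuous_neg)).congr fun R => ?_
  exact intervalIntegral.integral_interval_sub_left (hi _ _) (hi _ _)

end BodeIntegral

theorem theorem3 (L S : ℂ → ℂ) (p : ℕ → ℂ) (d : ℕ → ℕ) (pstar : ℂ) (E : Set ℂ)
    (hp : BodeIntegral.IsPoleEnumeration L p d pstar)
    (hlim : ∀ z : ℂ, AccPt z (𝓟 (Set.range p)) ↔ z = pstar)
    (hE : ∀ q ∈ E, q.re = 0)
    (hElim : ∀ z : ℂ, AccPt z (𝓟 E) → z = pstar)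
    (hS : BodeIntegral.IsStableSensitivity L S p E pstar)
    (hgrowth : ∀ q ∈ insert pstar E, BodeIntegral.HasSubexponentialGrowthAt S E q)
    (hlarge : BodeIntegral.LargeArcIntegralVanishes S
      (BodeIntegral.admissibleRadii p E pstar))
    (hloc : LocallyIntegrable (BodeIntegral.bodeIntegrand S)) :
    pstar.re = 0 ∧
    Tendsto
      (fun R : ℝ => ((∫ ω in (-R)..R, BodeIntegral.bodeIntegrand S ω : ℝ) : EReal))
      atTop
      (𝓝 ((∑' j, ENNReal.ofReal (4 * Real.pi * (d j * (p j).re)) : ENNReal) : EReal)) ∧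
    (Integrable (BodeIntegral.bodeIntegrand S) →
      Summable (fun j => (d j : ℝ) * (p j).re) ∧
      ∫ ω : ℝ, BodeIntegral.bodeIntegrand S ω = 4 * Real.pi * ∑' j, (d j : ℝ) * (p j).re) := by
  have hre : pstar.re = 0 := BodeIntegral.re_pstar_eq_zero hp hlim hE hS
  have h : BodeIntegral.IsSensitivity S p d E pstar.im :=
    BodeIntegral.isSensitivity_of_loop hp hlim hE hElim hS hgrowth hloc
  have hstar : (pstar.im * Complex.I : ℂ) = pstar := by
    apply Complex.ext <;> simp [hre]
  have hcont := BodeIntegral.continuous_integral_symm hloc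
  obtain ⟨N, hN, hNA⟩ := h.exists_countable_admissibleRadii
  have htend := BodeIntegral.tendsto_atTop_of_countable
    (continuous_coe_real_ereal.comp hcont) hN hNA
    (h.tendsto_integral_bodeIntegrand (by rwa [hstar]))
  refine ⟨hre, htend, fun hint => ?_⟩
  have h0 : ∀ j, 0 ≤ 4 * Real.pi * (d j * (p j).re) := fun j =>
    mul_nonneg (by positivity) (mul_nonneg (Nat.cast_nonneg _) (hp.re_pos j).le)
  have h1 := (continuous_coe_real_ereal.tendsto _).comp
    (intervalIntegral_tendsto_integral hint tendsto_neg_atTop_atBot tendsto_id)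
  have h2 := tendsto_nhds_unique h1 htend
  have hne : ∑' j, ENNReal.ofReal (4 * Real.pi * (d j * (p j).re)) ≠ ⊤ := by
    intro h3
    rw [h3, EReal.coe_ennreal_top] at h2
    exact EReal.coe_ne_top _ h2
  have h3 := ENNReal.summable_toReal hne
  have h4 := ENNReal.tsum_toReal_eq fun j =>
    (ENNReal.ofReal_ne_top : ENNReal.ofReal (4 * Real.pi * (d j * (p j).re)) ≠ ⊤)
  simp only [ENNReal.toReal_ofReal (h0 _)] at h3 h4
  refine ⟨(summable_mul_left_iff (by positivity)).1 h3, ?_⟩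
  rw [← tsum_mul_left, ← h4, ← EReal.coe_eq_coe_iff, h2, EReal.coe_ennreal_toReal hne]
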